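/- **Theorem (rigidity of geometric embeddings).** Let $\mathbb K\in\{\mathbb R,\mathbb C,\mathbb H,\mathbb O\}$ and let $\mathbf H^d_{\mathbb K}$ be the $d$-dimensional hyperbolic space over $\mathbb K$, where $d\ge 3$ if $\mathbb K=\mathbb R$, $d\ge 2$ if $\mathbb K=\mathbb C$, $d\ge 1$ if $\mathbb K=\mathbb H$ and $d=2$ if $\mathbb K=\mathbb O$. Let $G=\mathrm{Iso}(\mathbf H^d_{\mathbb K})$, with Lie algebra $\mathfrak g$, let $P\subset G$ be the stabilizer of a point $o\in\partial\mathbf H^d_{\mathbb K}$, let $\mathbf X=\partial\mathbf H^d_{\mathbb K}=G/P$ and $\Omega_o=\mathbf X\setminus\{o\}$. A *Cartan geometry* $(M,B,\omega)$ modelled on $\mathbf X$ is a smooth principal (right) $P$-bundle $B\to M$ over a manifold $M$ with a smooth $\mathfrak g$-valued $1$-form $\omega$ on $B$ such that every $\omega_b:T_bB\to\mathfrak g$ is an isomorphism, $\omega(X^\dagger)=X$ for the vector field $X^\dagger$ on $B$ generated by the one-parameter subgroup of $P$ with velocity $X$, and $R_p^*\omega=\mathrm{Ad}(p^{-1})\omega$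 for all $p\in P$. A map $\sigma:M\to M'$ between manifolds with Cartan geometries $(M,B,\omega)$, $(M',B',\omega')$ modelled on $\mathbf X$ is a *geometric embedding* (resp. a *geometric isomorphism*) if it lifts to a $P$-equivariant embedding (resp. to a $P$-equivariant diffeomorphism) $\hat\sigma:B\to B'$ with $\hat\sigma^*\omega'=\omega$. The space $\mathbf X$ carries the Cartan geometry $(\mathbf X,G,\omega_G)$, where $\omega_G$ is the Maurer–Cartan form. If $\Gamma\subset P$ is a discrete subgroup which acts freely and properly discontinuously on $\Omega_o$, then $\Gamma\backslash\Omega_o$ carries the induced Cartan geometry, with bundle $\Gamma\backslash (G\setminus P)$ and with the form induced by $\omega_G$. Let $(M,B,\omega)$ be a Cartan geometry modelled on $\mathbf X$ on a connected (Hausdorff) manifold $M$, let $\Gamma\subset P$ be a discrete subgroup acting freely and properly discontinuously on $\Omega_o$, and let $\sigma:\Gamma\backslash\Omega_o\to M$ be a geometric embedding. Then one of the following holds: 1. $M$ is geometrically isomorphic to $\mathbf X$, $\Gamma=\{e\}$, and there is a point $\kappa\in M$ such that $\sigma(\Omega_o)=M\setminus\{\kappa\}$; 2. $\sigma$ is a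 geometric isomorphism from $\Gamma\backslash\Omega_o$ onto $M$. -/

import Mathlib

open scoped Manifold ContDiff Topology Quaternion

noncomputable section

/-! ## Hyperbolic spaces over the real normed division algebras -/

/-- The octonions, as the Cayley-Dickson double of Hamilton's quaternions. -/
def Octonion : Type := ℍ[ℝ] × ℍ[ℝ]

namespace Octonion

instance : TopologicalSpace Octonion := inferInstanceAs (TopologicalSpace (ℍ[ℝ] × ℍ[ℝ]))

/-- The Cayley-Dickson product `(a, b)(c, e) = (ac - ē b, e a + b c̄)`. -/
instance : Mul Octonion :=
  ⟨fun x y => ((x.1 * y.1 - star y.2 * x.2, y.2 * x.1 + x.2 * star y.1) : ℍ[ℝ] × ℍ[ℝ])⟩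

/-- The conjugate of an octonion. -/
def conj (x : Octonion) : Octonion := ((star x.1, -x.2) : ℍ[ℝ] × ℍ[ℝ])

/-- The real part of an octonion. -/
def re (x : Octonion) : ℝ := x.1.re

/-- The square `x x̄` of the Euclidean norm of an octonion. -/
def normSq (x : Octonion) : ℝ := Quaternion.normSq x.1 + Quaternion.normSq x.2

/-- Multiplication of an octonion by a real number. -/
def rsmul (t : ℝ) (x : Octonion) : Octonion := ((t • x.1, t • x.2) : ℍ[ℝ] × ℍ[ℝ])

end Octonion

/-- The four real normed division algebras. -/
inductive DivAlg : Type
  | real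
  | complex
  | quaternion
  | octonion

/-- The four algebras `ℝ ⊂ ℂ ⊂ ℍ ⊂ 𝕆`, realised as the standard subalgebras of `𝕆`. -/
def DivAlg.carrier : DivAlg → Set Octonion
  | .real => {x | x.2 = 0 ∧ x.1.imI = 0 ∧ x.1.imJ = 0 ∧ x.1.imK = 0}
  | .complex => {x | x.2 = 0 ∧ x.1.imJ = 0 ∧ x.1.imK = 0}
  | .quaternion => {x | x.2 = 0}
  | .octonion => Set.univ

/-- The pairs `(𝕂, d)` for which the boundary of the `d`-dimensional hyperbolic space over `𝕂`
is a sphere of dimension at least two: `d ≥ 3` over `ℝ`, `d ≥ 2` over `ℂ`, `d ≥ 1` over `ℍ`,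
`d = 2` over `𝕆`. -/
def DivAlg.Admissible : DivAlg → ℕ → Prop
  | .real, d => 3 ≤ d
  | .complex, d => 2 ≤ d
  | .quaternion, d => 1 ≤ d
  | .octonion, d => d = 2

/-- The hyperbolic space `H^d_𝕂`, in the (projective) unit ball model: the open unit ball of `𝕂^d`.
The point `x` stands for the negative line of the form `-|x₀|² + |x₁|² + ⋯ + |x_d|²` spanned
by `(1, x)`. -/
def HypSpace (K : DivAlg) (d : ℕ) : Type :=
  {x : Fin d → Octonion // (∀ i, x i ∈ K.carrier) ∧ ∑ i, (x i).normSq < 1}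

/-- The boundary at infinity `∂H^d_𝕂`: the unit sphere of `𝕂^d`. -/
def HypBoundary (K : DivAlg) (d : ℕ) : Type :=
  {x : Fin d → Octonion // (∀ i, x i ∈ K.carrier) ∧ ∑ i, (x i).normSq = 1}

namespace HypSpace

variable {K : DivAlg} {d : ℕ}

instance : TopologicalSpace (HypSpace K d) :=
  TopologicalSpace.induced Subtype.val inferInstance

/-- The real part of the trace of the product of the Hermitian matrices `(xᵢ x̄ⱼ εⱼ)` and
`(yᵢ ȳⱼ εⱼ)`, where `x₀ = y₀ = 1`, `ε = (-1, 1, …, 1)`. When `𝕂` is associative this is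
`|1 - ∑ x̄ᵢ yᵢ|²`, the squared modulus of the Hermitian product of `(1, x)` and `(1, y)`. -/
def pairing (x y : Fin d → Octonion) : ℝ :=
  1 - 2 * ∑ i, ((x i).conj * y i).re + ∑ i, ∑ j, ((x i * (x j).conj) * (y j * (y i).conj)).re

/-- The hyperbolic distance `δ` (up to a constant factor), given by
`cosh² δ(x, y) = ⟨x, y⟩² / (⟨x, x⟩ ⟨y, y⟩)`. -/
def hdist (x y : HypSpace K d) : ℝ :=
  Real.arcosh (Real.sqrt (pairing x.1 y.1 /
    ((1 - ∑ i, (x.1 i).normSq) * (1 - ∑ i, (y.1 i).normSq))))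

end HypSpace

/-- The bijections of `H^d_𝕂` which preserve the distance, as a group of permutations. -/
def hypIsoSubgroup (K : DivAlg) (d : ℕ) : Subgroup (Equiv.Perm (HypSpace K d)) where
  carrier := {f | ∀ x y, (f x).hdist (f y) = x.hdist y}
  one_mem' := fun _ _ => rfl
  mul_mem' := fun {f g} hf hg x y => (hf (g x) (g y)).trans (hg x y)
  inv_mem' := fun {f} hf x y => by
    have h := hf (f⁻¹ x) (f⁻¹ y)
    simpa using h.symm

/-- The isometry group `Iso(H^d_𝕂)`. -/
def HypIso (K : DivAlg) (d : ℕ) : Type := hypIsoSubgroup K d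

namespace HypIso

variable {K : DivAlg} {d : ℕ}

instance : Group (HypIso K d) := inferInstanceAs (Group (hypIsoSubgroup K d))

/-- An isometry, as a map. -/
def toFun (g : HypIso K d) : HypSpace K d → HypSpace K d := fun x => g.1 x

/-- The usual topology of the isometry group: pointwise convergence (for isometries it is the same
as the compact-open topology). -/
instance : TopologicalSpace (HypIso K d) :=
  TopologicalSpace.induced HypIso.toFun inferInstance

/-- The trace on `H^d_𝕂` of the filter of neighbourhoods of a boundary point in the closed ball. -/
def nhdsBoundary (o : HypBoundary K d) : Filter (HypSpace K d) :=
  Filter.comap Subtype.val (𝓝 o.1)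

/-- The stabilizer `P` of the boundary point `o` in the isometry group: the isometries whose
continuous extension to the closed ball fixes `o`. -/
def boundaryStabilizer (o : HypBoundary K d) : Subgroup (HypIso K d) where
  carrier := {g | Filter.map g.toFun (nhdsBoundary o) = nhdsBoundary o}
  one_mem' := Filter.map_id
  mul_mem' := fun {f g} hf hg => by
    have h : (f * g).toFun = f.toFun ∘ g.toFun := rfl
    simp only [Set.mem_ofPred_eq] at hf hg ⊢
    rw [h, ← Filter.map_map, hg, hf]
  inv_mem' := fun {f} hf => by
    have h : (f⁻¹).toFun ∘ f.toFun = id := by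
      funext x
      exact Equiv.symm_apply_apply f.1 x
    simp only [Set.mem_ofPred_eq] at hf ⊢
    conv_lhs => rw [← hf]
    rw [Filter.map_map, h, Filter.map_id]

end HypIso

/-! ## Lie groups -/

section Lie

variable {E : Type*} [NormedAddCommGroup E] [NormedSpace ℝ E]
  {G : Type*} [TopologicalSpace G] [ChartedSpace E G] [Group G]

/-- The adjoint action of `a ∈ G` on the Lie algebra: the differential at `1` of conjugation. -/
def lieAd (a : G) : GroupLieAlgebra 𝓘(ℝ, E) G →L[ℝ] GroupLieAlgebra 𝓘(ℝ, E) G :=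
  (mfderiv 𝓘(ℝ, E) 𝓘(ℝ, E) (fun x : G => a * x * a⁻¹) 1 : E →L[ℝ] E)

/-- The Maurer-Cartan form `ω_G` of `G`: a vector tangent at `g` is moved to the identity by left
translation by `g⁻¹`. -/
def maurerCartan (g : G) : TangentSpace 𝓘(ℝ, E) g →L[ℝ] GroupLieAlgebra 𝓘(ℝ, E) G :=
  (mfderiv 𝓘(ℝ, E) 𝓘(ℝ, E) (fun x : G => g⁻¹ * x) g : E →L[ℝ] E)

end Lie

/-- `P` is a closed subgroup of `G` and its manifold structure is that of an embedded submanifold: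
the inclusion is a smooth immersion (the topology of `P` being the induced one). -/
class IsClosedLieSubgroup (E : Type*) [NormedAddCommGroup E] [NormedSpace ℝ E]
    (F : Type*) [NormedAddCommGroup F] [NormedSpace ℝ F]
    {G : Type*} [TopologicalSpace G] [ChartedSpace E G] [Group G]
    (P : Subgroup G) [ChartedSpace F P] : Prop where
  isClosed : IsClosed (P : Set G)
  contMDiff_val : ContMDiff 𝓘(ℝ, F) 𝓘(ℝ, E) ∞ (Subtype.val : P → G)
  injective_mfderiv : ∀ p : P,
    Function.Injective (mfderiv 𝓘(ℝ, F) 𝓘(ℝ, E) (Subtype.val : P → G) p)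

/-! ## Cartan geometries -/

/-- The data of a Cartan geometry on `M` modelled on `G/P`: a map `B → M`, a right action of `P`
on `B` and a `1`-form on `B` with values in the Lie algebra of `G`. The conditions on these data are
in `CartanGeometry`. -/
structure CartanData (E : Type*) [NormedAddCommGroup E] [NormedSpace ℝ E]
    {G : Type*} [TopologicalSpace G] [ChartedSpace E G] [Group G] (P : Subgroup G)
    (M : Type*)
    (EB : Type*) [NormedAddCommGroup EB] [NormedSpace ℝ EB]
    (B : Type*) [TopologicalSpace B] [ChartedSpace EB B] where
  /-- the bundle projection -/
  proj : B → M
  /-- the right action of the structure group -/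
  act : B → P → B
  /-- the Cartan connection -/
  form : (b : B) → TangentSpace 𝓘(ℝ, EB) b →L[ℝ] GroupLieAlgebra 𝓘(ℝ, E) G

/-- The form of a Cartan geometry, as a function on the tangent bundle of `B`. -/
def CartanData.formFun {E : Type*} [NormedAddCommGroup E] [NormedSpace ℝ E]
    {G : Type*} [TopologicalSpace G] [ChartedSpace E G] [Group G] {P : Subgroup G}
    {M : Type*} {EB : Type*} [NormedAddCommGroup EB] [NormedSpace ℝ EB]
    {B : Type*} [TopologicalSpace B] [ChartedSpace EB B]
    (C : CartanData E P M EB B) : TangentBundle 𝓘(ℝ, EB) B → E :=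
  fun v => C.form v.proj v.snd

/-- A Cartan geometry `(M, B, ω)` modelled on `G/P`: a smooth principal `P`-bundle `B → M` with a
Cartan connection `ω`. -/
structure CartanGeometry (E : Type*) [NormedAddCommGroup E] [NormedSpace ℝ E]
    (F : Type*) [NormedAddCommGroup F] [NormedSpace ℝ F]
    {G : Type*} [TopologicalSpace G] [ChartedSpace E G] [Group G]
    (P : Subgroup G) [ChartedSpace F P]
    (EM : Type*) [NormedAddCommGroup EM] [NormedSpace ℝ EM]
    (M : Type*) [TopologicalSpace M] [ChartedSpace EM M]
    (EB : Type*) [NormedAddCommGroup EB] [NormedSpace ℝ EB]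
    (B : Type*) [TopologicalSpace B] [ChartedSpace EB B] [IsManifold 𝓘(ℝ, EB) ∞ B]
    extends CartanData E P M EB B where
  act_one : ∀ b, act b 1 = b
  act_mul : ∀ b p q, act b (p * q) = act (act b p) q
  proj_act : ∀ b p, proj (act b p) = proj b
  contMDiff_proj : ContMDiff 𝓘(ℝ, EB) 𝓘(ℝ, EM) ∞ proj
  /-- smooth, equivariant local trivializations -/
  locally_trivial : ∀ x : M, ∃ (U : Set M) (e : OpenPartialHomeomorph B (M × P)),
    IsOpen U ∧ x ∈ U ∧ e.source = proj ⁻¹' U ∧ e.target = U ×ˢ Set.univ ∧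
    ContMDiffOn 𝓘(ℝ, EB) (𝓘(ℝ, EM).prod 𝓘(ℝ, F)) ∞ e e.source ∧
    ContMDiffOn (𝓘(ℝ, EM).prod 𝓘(ℝ, F)) 𝓘(ℝ, EB) ∞ e.symm e.target ∧
    ∀ b ∈ e.source, (e b).1 = proj b ∧ ∀ p : P, e (act b p) = ((e b).1, (e b).2 * p)
  /-- `ω` is smooth, as a function on the tangent bundle of `B` -/
  contMDiff_form : ContMDiff 𝓘(ℝ, EB).tangent 𝓘(ℝ, E) ∞ toCartanData.formFun
  /-- `ω_b` is an isomorphism between `T_bB` and the Lie algebra of `G` -/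
  form_bijective : ∀ b, Function.Bijective (form b)
  /-- `ω(X†) = X` for the vector field `X†` on `B` generated by the one-parameter subgroup `c` of
  `P` with velocity `X` -/
  form_fundamental : ∀ c : ℝ → P, ContMDiff 𝓘(ℝ, ℝ) 𝓘(ℝ, F) ∞ c →
    (∀ s t, c (s + t) = c s * c t) → ∀ b : B,
    form (act b (c 0)) (mfderiv 𝓘(ℝ, ℝ) 𝓘(ℝ, EB) (fun t => act b (c t)) 0 (1 : ℝ)) =
      (mfderiv 𝓘(ℝ, ℝ) 𝓘(ℝ, E) (fun t => (c t : G)) 0 (1 : ℝ) : E)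
  /-- `R_p^* ω = Ad(p⁻¹) ω` -/
  form_equivariant : ∀ (p : P) (b : B) (v : TangentSpace 𝓘(ℝ, EB) b),
    form (act b p) (mfderiv 𝓘(ℝ, EB) 𝓘(ℝ, EB) (fun b' => act b' p) b v) =
      lieAd ((p : G)⁻¹) (form b v)

/-! ## Geometric embeddings and isomorphisms -/

section Morphisms

variable {E : Type*} [NormedAddCommGroup E] [NormedSpace ℝ E]
  {G : Type*} [TopologicalSpace G] [ChartedSpace E G] [Group G] {P : Subgroup G}
  {M : Type*} {EB : Type*} [NormedAddCommGroup EB] [NormedSpace ℝ EB]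
  {B : Type*} [TopologicalSpace B] [ChartedSpace EB B]
  {M' : Type*} {EB' : Type*} [NormedAddCommGroup EB'] [NormedSpace ℝ EB']
  {B' : Type*} [TopologicalSpace B'] [ChartedSpace EB' B']

/-- `φ : B → B'` is a smooth `P`-equivariant bundle map over `σ : M → M'` with `φ^* ω' = ω`. -/
structure IsGeometricLift (C : CartanData E P M EB B) (C' : CartanData E P M' EB' B')
    (σ : M → M') (φ : B → B') : Prop where
  contMDiff : ContMDiff 𝓘(ℝ, EB) 𝓘(ℝ, EB') ∞ φ
  proj_comp : ∀ b, C'.proj (φ b) = σ (C.proj b)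
  map_act : ∀ b p, φ (C.act b p) = C'.act (φ b) p
  pullback_form : ∀ (b : B) (v : TangentSpace 𝓘(ℝ, EB) b),
    C'.form (φ b) (mfderiv 𝓘(ℝ, EB) 𝓘(ℝ, EB') φ b v) = C.form b v

/-- `σ : M → M'` is a geometric embedding: it lifts to an embedding of bundles `φ : B → B'` with
`φ^* ω' = ω`. -/
def IsGeometricEmbedding (C : CartanData E P M EB B) (C' : CartanData E P M' EB' B')
    (σ : M → M') : Prop :=
  ∃ φ : B → B', IsGeometricLift C C' σ φ ∧ Topology.IsEmbedding φ

/-- `σ : M → M'` is a geometric isomorphism: it lifts to a diffeomorphism of bundles `φ : B → B'`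
with `φ^* ω' = ω`. -/
def IsGeometricIso (C : CartanData E P M EB B) (C' : CartanData E P M' EB' B')
    (σ : M → M') : Prop :=
  Function.Bijective σ ∧
    ∃ φ : Diffeomorph 𝓘(ℝ, EB) 𝓘(ℝ, EB') B B' ∞, IsGeometricLift C C' σ φ

/-- `M` and `M'` are geometrically isomorphic. -/
def GeometricallyIsomorphic (C : CartanData E P M EB B) (C' : CartanData E P M' EB' B') : Prop :=
  ∃ σ : M → M', IsGeometricIso C C' σ

end Morphisms

/-! ## The model space and its Kleinian quotients -/

section Model

variable {E : Type*} [NormedAddCommGroup E] [NormedSpace ℝ E]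
  {G : Type*} [TopologicalSpace G] [ChartedSpace E G] [Group G]

/-- The model space `X = G/P`, with its bundle `G → G/P` and the Maurer-Cartan form. -/
def modelGeometry (E : Type*) [NormedAddCommGroup E] [NormedSpace ℝ E]
    {G : Type*} [TopologicalSpace G] [ChartedSpace E G] [Group G] (P : Subgroup G) :
    CartanData E P (G ⧸ P) E G where
  proj := fun g => (g : G ⧸ P)
  act := fun g p => g * p
  form := maurerCartan

/-- `Ω_o`: the complement in `X = G/P` of the base point `o = P`. -/
def Omega (P : Subgroup G) : Type _ := {x : G ⧸ P // x ≠ ((1 : G) : G ⧸ P)}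

instance (P : Subgroup G) : TopologicalSpace (Omega P) :=
  inferInstanceAs (TopologicalSpace {x : G ⧸ P // x ≠ ((1 : G) : G ⧸ P)})

/-- The action of `P` on `Ω_o` by left translations. -/
instance (P : Subgroup G) : MulAction P (Omega P) where
  smul p x := ⟨(p : G) • x.1, fun h => x.2 <| by
    have h' := congrArg (fun y => (p : G)⁻¹ • y) h
    simp only [inv_smul_smul] at h'
    rw [h', MulAction.Quotient.smul_coe, QuotientGroup.eq]
    simp⟩
  one_smul x := Subtype.ext (one_smul G x.1)
  mul_smul p q x := Subtype.ext (mul_smul (p : G) (q : G) x.1)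

variable {F : Type*} [NormedAddCommGroup F] [NormedSpace ℝ F]

/-- `B_o`: the preimage of `Ω_o` in `G`, that is, the complement of `P`. -/
def bundleOmega (E : Type*) [NormedAddCommGroup E] [NormedSpace ℝ E]
    (F : Type*) [NormedAddCommGroup F] [NormedSpace ℝ F]
    {G : Type*} [TopologicalSpace G] [ChartedSpace E G] [Group G]
    (P : Subgroup G) [ChartedSpace F P] [h : IsClosedLieSubgroup E F P] :
    TopologicalSpace.Opens G :=
  ⟨(P : Set G)ᶜ, h.isClosed.isOpen_compl⟩

variable (P : Subgroup G) [ChartedSpace F P] [IsClosedLieSubgroup E F P]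

/-- The action of `P` on `B_o` by left translations. -/
instance : MulAction P (bundleOmega E F P) where
  smul p g := ⟨(p : G) * g.1, fun h => g.2 ((P.mul_mem_cancel_left p.2).1 h)⟩
  one_smul g := Subtype.ext (one_mul g.1)
  mul_smul p q g := Subtype.ext (mul_assoc (p : G) (q : G) g.1)

variable {P}

/-- `Γ \ Ω_o`. -/
def KleinBase (Γ : Subgroup P) : Type _ := MulAction.orbitRel.Quotient Γ (Omega P)

/-- `Γ \ B_o`. -/
def KleinBundle (E : Type*) [NormedAddCommGroup E] [NormedSpace ℝ E]
    (F : Type*) [NormedAddCommGroup F] [NormedSpace ℝ F]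
    {G : Type*} [TopologicalSpace G] [ChartedSpace E G] [Group G]
    {P : Subgroup G} [ChartedSpace F P] [IsClosedLieSubgroup E F P] (Γ : Subgroup P) : Type _ :=
  MulAction.orbitRel.Quotient Γ (bundleOmega E F P)

/-- The restriction of the Maurer-Cartan form to the open subset `B_o` of `G`. -/
def liftedForm (b : bundleOmega E F P) :
    TangentSpace 𝓘(ℝ, E) b →L[ℝ] GroupLieAlgebra 𝓘(ℝ, E) G :=
  (maurerCartan (b : G)).comp (mfderiv 𝓘(ℝ, E) 𝓘(ℝ, E) (Subtype.val : bundleOmega E F P → G) b)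

namespace KleinBundle

variable (Γ : Subgroup P)

instance : TopologicalSpace (KleinBundle E F Γ) :=
  inferInstanceAs (TopologicalSpace (Quotient (MulAction.orbitRel Γ (bundleOmega E F P))))

/-- The quotient map `B_o → Γ \ B_o`. -/
def mk (b : bundleOmega E F P) : KleinBundle E F Γ :=
  Quotient.mk (MulAction.orbitRel Γ (bundleOmega E F P)) b

theorem mk_surjective : Function.Surjective (mk (E := E) (F := F) Γ) := Quotient.mk_surjective

/-- A representative in `B_o` of a point of `Γ \ B_o`. -/
def rep (y : KleinBundle E F Γ) : bundleOmega E F P :=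
  (mk_surjective (E := E) (F := F) Γ).hasRightInverse.choose y

theorem mk_rep (y : KleinBundle E F Γ) : mk Γ (rep Γ y) = y :=
  (mk_surjective (E := E) (F := F) Γ).hasRightInverse.choose_spec y

theorem mk_eq_mk {a b : bundleOmega E F P} :
    mk Γ a = mk Γ b ↔ ∃ γ : Γ, γ • b = a := by
  have h : mk Γ a = mk Γ b ↔ (MulAction.orbitRel Γ (bundleOmega E F P)) a b := Quotient.eq
  exact h

theorem continuous_smul [LieGroup 𝓘(ℝ, E) ∞ G] (γ : Γ) :
    Continuous (fun b : bundleOmega E F P => γ • b) := by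
  have := topologicalGroup_of_lieGroup 𝓘(ℝ, E) ∞ (G := G)
  refine Continuous.subtype_mk (f := fun b : bundleOmega E F P => ((γ : P) : G) * b.1) ?_ _
  exact continuous_const.mul continuous_subtype_val

/-- Since `Γ` is discrete, `B_o → Γ \ B_o` is a covering, in particular a local homeomorphism. -/
theorem isLocalHomeomorph_mk [LieGroup 𝓘(ℝ, E) ∞ G] [DiscreteTopology Γ] :
    IsLocalHomeomorph (mk (E := E) (F := F) Γ) := by
  have := topologicalGroup_of_lieGroup 𝓘(ℝ, E) ∞ (G := G)
  have hcov : IsQuotientCoveringMap (mk (E := E) (F := F) Γ) Γ :=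
    { toIsQuotientMap := isQuotientMap_quotient_mk'
      continuous_const_smul := continuous_smul Γ
      apply_eq_iff_mem_orbit := mk_eq_mk Γ
      disjoint := by
        intro e
        have h1 : ({1} : Set Γ) ∈ 𝓝 (1 : Γ) := (isOpen_discrete _).mem_nhds rfl
        have hind : Topology.IsInducing (fun γ : Γ => ((γ : P) : G)) :=
          Topology.IsInducing.subtypeVal.comp Topology.IsInducing.subtypeVal
        rw [hind.nhds_eq_comap, Filter.mem_comap] at h1
        obtain ⟨V, hV, hV1⟩ := h1
        have hc : Filter.Tendsto
            (fun x : bundleOmega E F P × bundleOmega E F P => x.1.1 * x.2.1⁻¹)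
            (𝓝 (e, e)) (𝓝 (1 : G)) := by
          have hcont : Continuous
              (fun x : bundleOmega E F P × bundleOmega E F P => x.1.1 * x.2.1⁻¹) := by fun_prop
          have h2 := hcont.tendsto (e, e)
          simpa using h2
        have hV2 := hc hV
        rw [Filter.mem_map, nhds_prod_eq, Filter.mem_prod_same_iff] at hV2
        obtain ⟨U, hU, hUV⟩ := hV2
        refine ⟨U, hU, fun γ hγ => ?_⟩
        obtain ⟨_, ⟨x, hx, rfl⟩, hγx⟩ := hγ
        have h3 : ((γ : P) : G) * x.1 * x.1⁻¹ ∈ V := hUV (Set.mk_mem_prod hγx hx)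
        rw [mul_inv_cancel_right] at h3
        exact hV1 h3 }
  exact hcov.isCoveringMap.isLocalHomeomorph

/-- The manifold structure on `Γ \ B_o`: the charts are those of `B_o`, read through local inverses
of the quotient map. -/
instance [LieGroup 𝓘(ℝ, E) ∞ G] [DiscreteTopology Γ] : ChartedSpace E (KleinBundle E F Γ) :=
  (isLocalHomeomorph_mk Γ).chartedSpace (mk_surjective Γ)

theorem contMDiff_smul [LieGroup 𝓘(ℝ, E) ∞ G] (γ : Γ) :
    ContMDiff 𝓘(ℝ, E) 𝓘(ℝ, E) ∞ (fun b : bundleOmega E F P => γ • b) := by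
  rw [← ContMDiff.subtypeVal_comp_iff]
  exact (contMDiff_mul_left (a := ((γ : P) : G))).comp contMDiff_subtype_val

/-- A local inverse of the quotient map, followed by the quotient map, is near each point the
action of an element of `Γ`. -/
theorem localInverse_mk [LieGroup 𝓘(ℝ, E) ∞ G] [DiscreteTopology Γ] (a b : bundleOmega E F P)
    (hb : mk Γ b ∈ ((isLocalHomeomorph_mk Γ).localInverseAt a).source) :
    ∃ γ : Γ, (fun c => (isLocalHomeomorph_mk Γ).localInverseAt a (mk Γ c)) =ᶠ[𝓝 b]
      fun c => γ • c := by
  set e := (isLocalHomeomorph_mk (E := E) (F := F) Γ).localInverseAt a with he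
  have hinv : ∀ y ∈ e.source, mk Γ (e y) = y := fun y hy =>
    (isLocalHomeomorph_mk Γ).apply_localInverseAt_of_mem hy
  obtain ⟨γ, hγ⟩ := (mk_eq_mk Γ).1 (hinv _ hb)
  refine ⟨γ, ?_⟩
  have h1 : ∀ᶠ c in 𝓝 b, γ • c ∈ e.target := by
    refine (continuous_smul Γ γ).continuousAt.eventually (e.open_target.mem_nhds ?_)
    show γ • b ∈ e.target
    rw [hγ]
    exact e.map_source hb
  filter_upwards [h1] with c hc
  have h2 : mk Γ (γ • c) = mk Γ c := (mk_eq_mk Γ).2 ⟨γ, rfl⟩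
  have h3 : e.symm (γ • c) = mk Γ (γ • c) :=
    congrFun ((isLocalHomeomorph_mk Γ).localInverseAt_symm a) _
  rw [← h2, ← h3]
  exact e.right_inv hc

instance [LieGroup 𝓘(ℝ, E) ∞ G] [DiscreteTopology Γ] :
    IsManifold 𝓘(ℝ, E) ∞ (KleinBundle E F Γ) := by
  apply isManifold_of_contDiffOn
  rintro e e' ⟨y, rfl⟩ ⟨z, rfl⟩
  change ContDiffOn ℝ ∞ (𝓘(ℝ, E) ∘ ((((isLocalHomeomorph_mk Γ).localInverseAt (rep Γ y)).trans
    (chartAt E (rep Γ y))).symm.trans (((isLocalHomeomorph_mk Γ).localInverseAt (rep Γ z)).trans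
    (chartAt E (rep Γ z)))) ∘ 𝓘(ℝ, E).symm) _
  set a := rep Γ y
  set a' := rep Γ z
  have hloc := isLocalHomeomorph_mk (E := E) (F := F) Γ
  rintro u ⟨hu, -⟩
  refine ContDiffAt.contDiffWithinAt ?_
  rw [← contMDiffAt_iff_contDiffAt]
  have hu' := hu
  simp only [Set.mem_preimage, OpenPartialHomeomorph.trans_source,
    OpenPartialHomeomorph.symm_source, OpenPartialHomeomorph.trans_target, Set.mem_inter_iff,
    OpenPartialHomeomorph.coe_trans_symm, Function.comp_apply, hloc.localInverseAt_symm] at hu'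
  obtain ⟨⟨hu1, hu2⟩, hu3, hu4⟩ := hu'
  obtain ⟨γ, hγ⟩ := localInverse_mk Γ a' ((chartAt E a).symm u) hu3
  have hc1 : ContMDiffAt 𝓘(ℝ, E) 𝓘(ℝ, E) ∞ (chartAt E a).symm u :=
    contMDiffOn_chart_symm.contMDiffAt ((chartAt E a).open_target.mem_nhds hu1)
  have hγu : (hloc.localInverseAt a') (mk Γ ((chartAt E a).symm u)) = γ • (chartAt E a).symm u :=
    hγ.self_of_nhds
  have hu5 : γ • (chartAt E a).symm u ∈ (chartAt E a').source := by
    rw [← hγu]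
    exact hu4
  have hc2 : ContMDiffAt 𝓘(ℝ, E) 𝓘(ℝ, E) ∞ (chartAt E a') (γ • (chartAt E a).symm u) :=
    contMDiffOn_chart.contMDiffAt ((chartAt E a').open_source.mem_nhds hu5)
  have hc := hc2.comp u ((contMDiff_smul Γ γ).contMDiffAt.comp u hc1)
  refine hc.congr_of_eventuallyEq ?_
  filter_upwards [hc1.continuousAt.eventually hγ] with v hv
  have hv' : (hloc.localInverseAt a') (mk Γ ((chartAt E a).symm v)) = γ • (chartAt E a).symm v := hv
  simp only [Function.comp_apply, OpenPartialHomeomorph.coe_trans,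
    OpenPartialHomeomorph.coe_trans_symm, hloc.localInverseAt_symm, modelWithCornersSelf_coe,
    modelWithCornersSelf_coe_symm, id_eq, hv']

theorem chartAt_eq [LieGroup 𝓘(ℝ, E) ∞ G] [DiscreteTopology Γ] (y : KleinBundle E F Γ) :
    chartAt E y = ((isLocalHomeomorph_mk Γ).localInverseAt (rep Γ y)).trans
      (chartAt E (rep Γ y)) := rfl

theorem contMDiffAt_mk_rep [LieGroup 𝓘(ℝ, E) ∞ G] [DiscreteTopology Γ] (y : KleinBundle E F Γ) :
    ContMDiffAt 𝓘(ℝ, E) 𝓘(ℝ, E) ∞ (mk (E := E) (F := F) Γ) (rep Γ y) := by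
  set a := rep Γ y with ha
  have hloc := isLocalHomeomorph_mk (E := E) (F := F) Γ
  have h1 : ContMDiffAt 𝓘(ℝ, E) 𝓘(ℝ, E) ∞ (chartAt E a) a :=
    contMDiffOn_chart.contMDiffAt ((chartAt E a).open_source.mem_nhds (mem_chart_source E a))
  have hy : chartAt E a a ∈ (chartAt E y).target := by
    rw [chartAt_eq]
    simp [← ha]
  have h2 : ContMDiffAt 𝓘(ℝ, E) 𝓘(ℝ, E) ∞ (chartAt E y).symm (chartAt E a a) :=
    contMDiffOn_chart_symm.contMDiffAt ((chartAt E y).open_target.mem_nhds hy)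
  refine (h2.comp a h1).congr_of_eventuallyEq ?_
  filter_upwards [(chartAt E a).open_source.mem_nhds (mem_chart_source E a)] with b hb
  simp only [Function.comp_apply, chartAt_eq, OpenPartialHomeomorph.coe_trans_symm,
    hloc.localInverseAt_symm]
  rw [← ha, (chartAt E a).left_inv hb]

theorem contMDiffAt_localInverse [LieGroup 𝓘(ℝ, E) ∞ G] [DiscreteTopology Γ]
    (y : KleinBundle E F Γ) :
    ContMDiffAt 𝓘(ℝ, E) 𝓘(ℝ, E) ∞ ((isLocalHomeomorph_mk Γ).localInverseAt (rep Γ y)) y := by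
  have h1 : ContMDiffAt 𝓘(ℝ, E) 𝓘(ℝ, E) ∞ (chartAt E y) y :=
    contMDiffOn_chart.contMDiffAt ((chartAt E y).open_source.mem_nhds (mem_chart_source E y))
  have h2 : ContMDiffAt 𝓘(ℝ, E) 𝓘(ℝ, E) ∞ (chartAt E (rep Γ y)).symm (chartAt E y y) :=
    contMDiffOn_chart_symm.contMDiffAt ((chartAt E (rep Γ y)).open_target.mem_nhds
      (by
        have h := mem_chart_target E y
        rw [chartAt_eq] at h ⊢
        exact h.1))
  refine (h2.comp y h1).congr_of_eventuallyEq ?_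
  filter_upwards [(chartAt E y).open_source.mem_nhds (mem_chart_source E y)] with z hz
  rw [chartAt_eq] at hz ⊢
  exact ((chartAt E (rep Γ y)).left_inv hz.2).symm

theorem contMDiff_mk [LieGroup 𝓘(ℝ, E) ∞ G] [DiscreteTopology Γ] :
    ContMDiff 𝓘(ℝ, E) 𝓘(ℝ, E) ∞ (mk (E := E) (F := F) Γ) := by
  intro b
  obtain ⟨γ, hγ⟩ := (mk_eq_mk Γ).1 (mk_rep Γ (mk Γ b))
  have h1 := contMDiffAt_mk_rep Γ (mk Γ b)
  rw [← hγ] at h1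
  refine (h1.comp b (contMDiff_smul Γ γ).contMDiffAt).congr_of_eventuallyEq ?_
  exact Filter.Eventually.of_forall fun c => ((mk_eq_mk Γ).2 ⟨γ, rfl⟩).symm

end KleinBundle

/-- The geometry induced by `X` on `Γ \ Ω_o`: the bundle is `Γ \ B_o` and the connection is the form
`ω̄` whose pullback to `B_o` is the Maurer-Cartan form. -/
def kleinGeometry [LieGroup 𝓘(ℝ, E) ∞ G] (Γ : Subgroup P) [DiscreteTopology Γ] :
    CartanData E P (KleinBase Γ) E (KleinBundle E F Γ) where
  proj := Quotient.map
    (fun b : bundleOmega E F P => (⟨((b : G) : G ⧸ P), fun h => b.2 (by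
      rw [eq_comm, QuotientGroup.eq] at h
      simpa using h)⟩ : Omega P))
    (by
      rintro _ b ⟨γ, rfl⟩
      exact ⟨γ, rfl⟩)
  act := fun y p => Quotient.map
    (fun b : bundleOmega E F P => (⟨(b : G) * p, fun h => b.2 ((P.mul_mem_cancel_right p.2).1 h)⟩ : bundleOmega E F P))
    (by
      rintro _ b ⟨γ, rfl⟩
      exact ⟨γ, Subtype.ext (mul_assoc _ _ _).symm⟩) y
  form := fun y =>
    ((liftedForm (KleinBundle.rep Γ y) : E →L[ℝ] E).comp
      (mfderiv 𝓘(ℝ, E) 𝓘(ℝ, E) (KleinBundle.mk Γ) (KleinBundle.rep Γ y) : E →L[ℝ] E).inverse)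

theorem liftedForm_smul [LieGroup 𝓘(ℝ, E) ∞ G] (Γ : Subgroup P) (γ : Γ)
    (b : bundleOmega E F P) (v : E) :
    (liftedForm (γ • b) : E →L[ℝ] E)
      ((mfderiv 𝓘(ℝ, E) 𝓘(ℝ, E) (fun c : bundleOmega E F P => γ • c) b : E →L[ℝ] E) v) =
    (liftedForm b : E →L[ℝ] E) v := by
  have hL : ∀ g x : G, MDifferentiableAt 𝓘(ℝ, E) 𝓘(ℝ, E) (fun y : G => g * y) x := fun g x =>
    (contMDiff_mul_left (I := 𝓘(ℝ, E)) (n := ∞) (a := g)).mdifferentiable (by simp) x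
  have hval : ∀ c : bundleOmega E F P,
      MDifferentiableAt 𝓘(ℝ, E) 𝓘(ℝ, E) (Subtype.val : bundleOmega E F P → G) c := fun c =>
    (contMDiff_subtype_val (n := ∞)).mdifferentiable (by simp) c
  have hγ : MDifferentiableAt 𝓘(ℝ, E) 𝓘(ℝ, E) (fun c : bundleOmega E F P => γ • c) b :=
    (KleinBundle.contMDiff_smul Γ γ).mdifferentiable (by simp) b
  have hf : ∀ c : bundleOmega E F P, (liftedForm c : E →L[ℝ] E) =
      (mfderiv 𝓘(ℝ, E) 𝓘(ℝ, E) (fun x : bundleOmega E F P => (c : G)⁻¹ * (x : G)) c :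
        E →L[ℝ] E) := fun c =>
    (mfderiv_comp c (hL (c : G)⁻¹ (c : G)) (hval c)).symm
  have hcomp : (fun x : bundleOmega E F P => ((γ • b : bundleOmega E F P) : G)⁻¹ * (x : G)) ∘
      (fun c : bundleOmega E F P => γ • c) = fun x : bundleOmega E F P => (b : G)⁻¹ * (x : G) := by
    funext x
    change (((γ : P) : G) * (b : G))⁻¹ * (((γ : P) : G) * (x : G)) = (b : G)⁻¹ * (x : G)
    group
  have hd : MDifferentiableAt 𝓘(ℝ, E) 𝓘(ℝ, E)
      (fun x : bundleOmega E F P => ((γ • b : bundleOmega E F P) : G)⁻¹ * (x : G)) (γ • b) :=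
    (hL _ _).comp (γ • b) (hval (γ • b))
  have h := mfderiv_comp b hd hγ
  rw [hcomp] at h
  rw [hf, hf]
  exact (congrArg (fun T : E →L[ℝ] E => T v) h).symm

theorem KleinBundle.inverse_mfderiv_mk [LieGroup 𝓘(ℝ, E) ∞ G] (Γ : Subgroup P) [DiscreteTopology Γ]
    (y : KleinBundle E F Γ) (v : E) :
    (mfderiv 𝓘(ℝ, E) 𝓘(ℝ, E) (KleinBundle.mk Γ) (KleinBundle.rep Γ y) : E →L[ℝ] E).inverse
      ((mfderiv 𝓘(ℝ, E) 𝓘(ℝ, E) (KleinBundle.mk Γ) (KleinBundle.rep Γ y) : E →L[ℝ] E) v) = v := by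
  have hloc := isLocalHomeomorph_mk (E := E) (F := F) Γ
  set a := KleinBundle.rep Γ y with ha
  have hy : mk Γ a = y := mk_rep Γ y
  have h1 : MDifferentiableAt 𝓘(ℝ, E) 𝓘(ℝ, E) (mk (E := E) (F := F) Γ) a :=
    (contMDiff_mk Γ).mdifferentiable (by simp) a
  have h2 : MDifferentiableAt 𝓘(ℝ, E) 𝓘(ℝ, E) (hloc.localInverseAt a) (mk Γ a) := by
    rw [hy]
    exact (contMDiffAt_localInverse Γ y).mdifferentiableAt (by simp)
  have h2' : hloc.localInverseAt a (mk Γ a) = a := hloc.localInverseAt_apply_self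
  have e1 : (hloc.localInverseAt a) ∘ (mk Γ) =ᶠ[𝓝 a] id := by
    filter_upwards [(hloc.localInverseAt a).open_target.mem_nhds
      hloc.self_mem_localInverseAt_target] with c hc
    have := (hloc.localInverseAt a).right_inv hc
    rwa [hloc.localInverseAt_symm] at this
  have e2 : (mk Γ) ∘ (hloc.localInverseAt a) =ᶠ[𝓝 (mk Γ a)] id := by
    filter_upwards [(hloc.localInverseAt a).open_source.mem_nhds
      hloc.apply_self_mem_localInverseAt_source] with c hc
    exact hloc.apply_localInverseAt_of_mem hc
  have d1 : (mfderiv 𝓘(ℝ, E) 𝓘(ℝ, E) (hloc.localInverseAt a) (mk Γ a) : E →L[ℝ] E).comp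
      (mfderiv 𝓘(ℝ, E) 𝓘(ℝ, E) (mk Γ) a : E →L[ℝ] E) = ContinuousLinearMap.id ℝ E := by
    have h := mfderiv_comp a h2 h1
    rw [e1.mfderiv_eq, mfderiv_id] at h
    exact h.symm
  have d2 : (mfderiv 𝓘(ℝ, E) 𝓘(ℝ, E) (mk Γ) a : E →L[ℝ] E).comp
      (mfderiv 𝓘(ℝ, E) 𝓘(ℝ, E) (hloc.localInverseAt a) (mk Γ a) : E →L[ℝ] E) =
      ContinuousLinearMap.id ℝ E := by
    have h := mfderiv_comp_of_eq (I'' := 𝓘(ℝ, E)) (x := mk Γ a) (y := a) (g := mk Γ) h1 h2 h2'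
    rw [e2.mfderiv_eq, mfderiv_id, h2'] at h
    exact h.symm
  rw [ContinuousLinearMap.inverse_eq d2 d1]
  exact congrArg (fun T : E →L[ℝ] E => T v) d1

/-- The pullback to `B_o` of the form of `kleinGeometry Γ` is the Maurer-Cartan form. -/
theorem kleinGeometry_form_mk [LieGroup 𝓘(ℝ, E) ∞ G] (Γ : Subgroup P) [DiscreteTopology Γ]
    (b : bundleOmega E F P) (v : TangentSpace 𝓘(ℝ, E) b) :
    (kleinGeometry (E := E) (F := F) Γ).form (KleinBundle.mk Γ b)
      (mfderiv 𝓘(ℝ, E) 𝓘(ℝ, E) (KleinBundle.mk (E := E) (F := F) Γ) b v) = liftedForm b v := by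
  obtain ⟨γ, hγ⟩ := (KleinBundle.mk_eq_mk Γ).1 (KleinBundle.mk_rep Γ (KleinBundle.mk Γ b))
  have h1 : MDifferentiableAt 𝓘(ℝ, E) 𝓘(ℝ, E) (KleinBundle.mk (E := E) (F := F) Γ) (γ • b) :=
    (KleinBundle.contMDiff_mk Γ).mdifferentiable (by simp) _
  have h2 : MDifferentiableAt 𝓘(ℝ, E) 𝓘(ℝ, E) (fun c : bundleOmega E F P => γ • c) b :=
    (KleinBundle.contMDiff_smul Γ γ).mdifferentiable (by simp) b
  have hcomp : KleinBundle.mk Γ ∘ (fun c : bundleOmega E F P => γ • c) = KleinBundle.mk Γ := by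
    funext c
    exact (KleinBundle.mk_eq_mk Γ).2 ⟨γ, rfl⟩
  have h := mfderiv_comp b h1 h2
  rw [hcomp] at h
  have hv : (mfderiv 𝓘(ℝ, E) 𝓘(ℝ, E) (KleinBundle.mk (E := E) (F := F) Γ) b : E →L[ℝ] E) v =
      (mfderiv 𝓘(ℝ, E) 𝓘(ℝ, E) (KleinBundle.mk (E := E) (F := F) Γ) (γ • b) : E →L[ℝ] E)
        ((mfderiv 𝓘(ℝ, E) 𝓘(ℝ, E) (fun c : bundleOmega E F P => γ • c) b : E →L[ℝ] E) v) :=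
    congrArg (fun T : E →L[ℝ] E => T v) h
  have hinv := KleinBundle.inverse_mfderiv_mk (E := E) (F := F) Γ (KleinBundle.mk Γ b)
    ((mfderiv 𝓘(ℝ, E) 𝓘(ℝ, E) (fun c : bundleOmega E F P => γ • c) b : E →L[ℝ] E) v)
  have hs := liftedForm_smul Γ γ b v
  rw [hγ] at hv hs
  refine Eq.trans ?_ hs
  refine congrArg (liftedForm (KleinBundle.rep Γ (KleinBundle.mk Γ b)) : E →L[ℝ] E) ?_
  exact (congrArg (mfderiv 𝓘(ℝ, E) 𝓘(ℝ, E) (KleinBundle.mk (E := E) (F := F) Γ)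
    (KleinBundle.rep Γ (KleinBundle.mk Γ b)) : E →L[ℝ] E).inverse hv).trans hinv

end Model

end

/-!
Write `W = G \ P` for the preimage of `Ω_o` in `G`. A geometric embedding lifts to an embedding
`φ : Γ \ W → B`, and `h : W → Γ \ W → B` (`φ ∘ kleinMap` below) pulls the Cartan connection back to
the Maurer-Cartan form. Cartan connections are parallelisms, so everything is about maps preserving
parallelisms: such a map satisfies, in charts, a total differential equation `dh = Φ(x, h)`, and it
is a local diffeomorphism. If `φ` is onto, `σ` is a geometric isomorphism.

Suppose that `φ` is not onto. As `M` is connected, the open `P`-invariant set `h(W)` has a boundary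
point `b₁`. A short curve in `B` from `h(W)` to `b₁` can be developed into `G`, all the way: by
homogeneity, curves in `G` with prescribed Maurer-Cartan velocity exist for a uniform time
(`exists_development`). The development cannot stay in `W`, because `b₁` is not in `h(W)`. So it
hits `P` for a first time, and there `h` has a limit; it is not in `h(W)` because `φ` is an
embedding (`IsGeometricLift.exists_tendsto`). After translation by an element of `P`, `h` has a
limit `b` at the identity along some filter.

The subgroup `P` has codimension at least two in `G`: the boundary of the hyperbolic space contains
the image of a plane under a continuous injective map, made of the images of `o` under an explicit
family of isometries (`DivAlg.Admissible.exists_plane`), and a plane does not embed into a line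
(`finrank_add_two_le`). Therefore almost all segments, in a chart, avoid `P`, and the mean value
inequality shows that solutions of the equation `dh = Φ(x, h)` extend across `P` wherever they have
a limit (`exists_extension_at_subgroup`). Equivariance propagates the limit at the identity to all
points of `P`, so that `h` extends to a form-preserving, `P`-equivariant map `G → B` equal to
`p ↦ b p` on `P` (`extendedLift`). Its existence forces `Γ` to be trivial: `h` is `Γ`-invariant,
hence `b γ = b`, and `P` acts freely on `B`. It is then injective, and it is onto because its image
is open, closed by development once more, and `P`-invariant. Thus `B` is equivalent to `G`, and the
image of `σ` misses only the point of `M` below `b`.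
-/

noncomputable section

/-! ### Removable singularities of total differential equations in codimension two -/

section SegmentDense

variable {E : Type*} [NormedAddCommGroup E] [NormedSpace ℝ E]
  {E' : Type*} [NormedAddCommGroup E'] [NormedSpace ℝ E']

/-- From each point of `D`, the points of `D` that can be seen inside `D` are dense in `U`. This
is how the complement `D` of a closed subset of codimension at least two sits in a ball `U`. -/
def SegmentDense (D U : Set E) : Prop :=
  ∀ y ∈ D, U ⊆ closure {z | z ∈ D ∧ segment ℝ y z ⊆ D}

theorem SegmentDense.subset_closure {D U : Set E} (h : SegmentDense D U) (hD : D.Nonempty) :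
    U ⊆ closure D :=
  (h _ hD.some_mem).trans (closure_mono fun _ hz => hz.1)

/-- The mean value inequality in a nonconvex domain `D` which is segment dense. -/
theorem SegmentDense.norm_sub_sub_le {D U : Set E} (h : SegmentDense D U) (hDU : D ⊆ U)
    {f : E → E'} {f' : E → E →L[ℝ] E'} (hf : ∀ z ∈ D, HasFDerivAt f (f' z) z)
    {L : E →L[ℝ] E'} {ε : ℝ} (hL : ∀ z ∈ D, ‖f' z - L‖ ≤ ε) {u v : E} (hu : u ∈ D) (hv : v ∈ D) :
    ‖f v - f u - L (v - u)‖ ≤ ε * ‖v - u‖ := by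
  have hfv : ContinuousAt f v := (hf v hv).continuousAt
  have hcl := mem_closure_iff_frequently.1 (h u hu (hDU hv))
  have hc : ContinuousAt (fun z => ‖f z - f u - L (z - u)‖ - ε * ‖z - u‖) v := by fun_prop
  have hle : ‖f v - f u - L (v - u)‖ - ε * ‖v - u‖ ≤ 0 := by
    refine le_of_tendsto_of_frequently hc (hcl.mono ?_)
    rintro z ⟨-, hz⟩
    have := (convex_segment u z).norm_image_sub_le_of_norm_hasFDerivWithin_le'
      (fun x hx => (hf x (hz hx)).hasFDerivWithinAt) (fun x hx => hL x (hz hx))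
      (left_mem_segment ℝ u z) (right_mem_segment ℝ u z)
    linarith
  linarith

theorem SegmentDense.norm_sub_sub_le_of_continuousOn {D U : Set E} (h : SegmentDense D U)
    (hD : D.Nonempty) (hDU : D ⊆ U) {f : E → E'} {f' : E → E →L[ℝ] E'}
    (hf : ∀ z ∈ D, HasFDerivAt f (f' z) z) (hc : ∀ z ∈ U, ContinuousAt f z)
    {L : E →L[ℝ] E'} {ε : ℝ} (hL : ∀ z ∈ D, ‖f' z - L‖ ≤ ε) {u v : E} (hu : u ∈ U) (hv : v ∈ U) :
    ‖f v - f u - L (v - u)‖ ≤ ε * ‖v - u‖ := by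
  have hcl : (u, v) ∈ closure (D ×ˢ D) := by
    rw [closure_prod_eq]
    exact ⟨h.subset_closure hD hu, h.subset_closure hD hv⟩
  have hfr := mem_closure_iff_frequently.1 hcl
  have h1 : ContinuousAt (fun p : E × E => f p.1) (u, v) :=
    ContinuousAt.comp (f := Prod.fst) (hc u hu) continuousAt_fst
  have h2 : ContinuousAt (fun p : E × E => f p.2) (u, v) :=
    ContinuousAt.comp (f := Prod.snd) (hc v hv) continuousAt_snd
  have hc : ContinuousAt
      (fun p : E × E => ‖f p.2 - f p.1 - L (p.2 - p.1)‖ - ε * ‖p.2 - p.1‖) (u, v) := by fun_prop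
  have hle : ‖f v - f u - L (v - u)‖ - ε * ‖v - u‖ ≤ 0 := by
    refine le_of_tendsto_of_frequently hc (hfr.mono ?_)
    rintro ⟨x, y⟩ ⟨hx, hy⟩
    have := h.norm_sub_sub_le hDU hf hL hx hy
    simp only
    linarith
  linarith

theorem SegmentDense.mono_ball {D U V : Set E} (h : SegmentDense D U) (hV : IsOpen V)
    (hVc : Convex ℝ V) (hVU : V ⊆ U) : SegmentDense (D ∩ V) V := by
  rintro y ⟨hy, hyV⟩ z hz
  have h1 := h y hy (hVU hz)
  have h2 : z ∈ closure (V ∩ {z | z ∈ D ∧ segment ℝ y z ⊆ D}) :=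
    hV.inter_closure ⟨hz, h1⟩
  refine closure_mono ?_ h2
  rintro w ⟨hwV, hwD, hw⟩
  exact ⟨⟨hwD, hwV⟩, fun x hx => ⟨hw hx, hVc.segment_subset hyV hwV hx⟩⟩

/-- A continuous solution of `df = Φ(z, f)` in the complement `D` of a set of codimension two is a
solution across this set: along segments in `D` this is the mean value inequality, and such
segments are dense. -/
theorem SegmentDense.hasFDerivAt {D U : Set E} (h : SegmentDense D U)
    (hD : D.Nonempty) (hU : IsOpen U) {f : E → E'} {f' : E → E →L[ℝ] E'}
    (hf : ∀ z ∈ D, HasFDerivAt f (f' z) z) (hc : ∀ z ∈ U, ContinuousAt f z)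
    {y : E} (hy : y ∈ U) (hf' : ContinuousAt f' y) : HasFDerivAt f (f' y) y := by
  rw [hasFDerivAt_iff_isLittleO_nhds_zero, Asymptotics.isLittleO_iff]
  intro ε hε
  have h1 : ∀ᶠ z in 𝓝 y, ‖f' z - f' y‖ ≤ ε := by
    have := hf'.eventually (Metric.closedBall_mem_nhds _ hε)
    filter_upwards [this] with z hz
    rwa [← dist_eq_norm]
  obtain ⟨δ, hδ, hball⟩ := Metric.eventually_nhds_iff_ball.1 (h1.and (hU.mem_nhds hy))
  have hs := h.mono_ball Metric.isOpen_ball (convex_ball y δ) fun z hz => (hball z hz).2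
  have hne : (D ∩ Metric.ball y δ).Nonempty :=
    (mem_closure_iff.1 (h.subset_closure hD hy) _ Metric.isOpen_ball
      (Metric.mem_ball_self hδ)).imp fun z hz => ⟨hz.2, hz.1⟩
  filter_upwards [Metric.ball_mem_nhds (0 : E) hδ] with v hv
  have := hs.norm_sub_sub_le_of_continuousOn hne Set.inter_subset_right
    (fun z hz => hf z hz.1) (fun z hz => hc z (hball z hz).2) (L := f' y) (ε := ε)
    (fun z hz => (hball z hz.2).1)
    (Metric.mem_ball_self hδ) (v := y + v) (by simpa using hv)
  simpa using this

/-- Solutions of `df = Φ(z, f)`, with `Φ` smooth, are smooth. -/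
theorem contDiffOn_of_hasFDerivAt_eq {U : Set E} (hU : IsOpen U) {U' : Set E'}
    {Φ : E × E' → E →L[ℝ] E'} (hΦ : ContDiffOn ℝ ∞ Φ (U ×ˢ U')) {f : E → E'}
    (hfU : Set.MapsTo f U U') (hf : ∀ z ∈ U, HasFDerivAt f (Φ (z, f z)) z) :
    ContDiffOn ℝ ∞ f U := by
  rw [contDiffOn_infty]
  intro n
  induction n with
  | zero =>
    rw [Nat.cast_zero, contDiffOn_zero]
    exact fun z hz => (hf z hz).continuousAt.continuousWithinAt
  | succ n ih =>
    rw [Nat.cast_succ, contDiffOn_succ_iff_hasFDerivWithinAt_of_uniqueDiffOn hU.uniqueDiffOn]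
    refine ⟨by simp, fun z => Φ (z, f z), ?_, fun z hz => (hf z hz).hasFDerivWithinAt⟩
    exact (hΦ.of_le (by exact_mod_cast le_top)).comp (contDiffOn_id.prodMk ih)
      fun z hz => ⟨hz, hfU hz⟩

/-- Removable singularities for the equation `df = Φ(z, f)`, when `Φ` is bounded along `f`: the
solution is Lipschitz, so it extends continuously. -/
theorem SegmentDense.exists_extension [FiniteDimensional ℝ E'] {D U : Set E} (h : SegmentDense D U)
    (hDU : D ⊆ U) (hD : D.Nonempty) (hU : IsOpen U) {U' K' : Set E'}
    (hU' : IsOpen U') (hK' : IsClosed K') (hKU : K' ⊆ U')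
    {Φ : E × E' → E →L[ℝ] E'} (hΦ : ContDiffOn ℝ ∞ Φ (U ×ˢ U')) {C : NNReal}
    (hC : ∀ z ∈ U, ∀ x ∈ K', ‖Φ (z, x)‖ ≤ C) {f : E → E'} (hfK : Set.MapsTo f D K')
    (hf : ∀ z ∈ D, HasFDerivAt f (Φ (z, f z)) z) (hDo : IsOpen D) :
    ∃ g : E → E', Set.EqOn g f D ∧ Set.MapsTo g U K' ∧ Continuous g ∧ ContDiffOn ℝ ∞ g U ∧
      ∀ z ∈ U, HasFDerivAt g (Φ (z, g z)) z := by
  have hlip : LipschitzOnWith C f D := by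
    refine LipschitzOnWith.of_dist_le_mul fun x hx y hy => ?_
    have := h.norm_sub_sub_le hDU hf (L := 0) (ε := C)
      (fun z hz => by simpa using hC z (hDU hz) _ (hfK hz)) hy hx
    simpa [dist_eq_norm] using this
  obtain ⟨g, hg, hgf⟩ := hlip.extend_finite_dimension
  have hgK : Set.MapsTo g U K' := by
    intro z hz
    have h1 : z ∈ closure D := h.subset_closure hD hz
    have h2 : g z ∈ closure K' := map_mem_closure hg.continuous h1 fun x hx => by
      rw [← hgf hx]
      exact hfK hx
    rwa [hK'.closure_eq] at h2
  have hgd : ∀ z ∈ D, HasFDerivAt g (Φ (z, g z)) z := fun z hz => by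
    rw [← hgf hz]
    refine (hf z hz).congr_of_eventuallyEq ?_
    filter_upwards [hDo.mem_nhds hz] with x hx using (hgf hx).symm
  have hgd' : ∀ z ∈ U, HasFDerivAt g (Φ (z, g z)) z := fun z hz =>
    h.hasFDerivAt hD hU (f' := fun z => Φ (z, g z)) hgd
      (fun z _ => hg.continuous.continuousAt) hz
      (ContinuousAt.comp (f := fun z => (z, g z)) (hΦ.continuousOn.continuousAt
        ((hU.prod hU').mem_nhds ⟨hz, hKU (hgK hz)⟩))
        (continuousAt_id.prodMk hg.continuous.continuousAt))
  exact ⟨g, hgf.symm, hgK, hg.continuous,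
    contDiffOn_of_hasFDerivAt_eq hU hΦ (fun z hz => hKU (hgK hz)) hgd', hgd'⟩

end SegmentDense

/-! ### Parallelisms and maps which preserve them -/

section CoordForm

variable {V : Type*} [NormedAddCommGroup V] [NormedSpace ℝ V]
  {EN : Type*} [NormedAddCommGroup EN] [NormedSpace ℝ EN]
  {N : Type*} [TopologicalSpace N] [ChartedSpace EN N]
  {EN' : Type*} [NormedAddCommGroup EN'] [NormedSpace ℝ EN']
  {N' : Type*} [TopologicalSpace N'] [ChartedSpace EN' N']
  {EN'' : Type*} [NormedAddCommGroup EN''] [NormedSpace ℝ EN'']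
  {N'' : Type*} [TopologicalSpace N''] [ChartedSpace EN'' N'']

/-- A `1`-form on `N` with values in `V`, read in the chart at `x₀`. -/
def coordForm (θ : (x : N) → TangentSpace 𝓘(ℝ, EN) x →L[ℝ] V) (x₀ : N) (u : EN) : EN →L[ℝ] V :=
  (θ ((chartAt EN x₀).symm u) : EN →L[ℝ] V).comp
    (mfderiv 𝓘(ℝ, EN) 𝓘(ℝ, EN) (chartAt EN x₀).symm u : EN →L[ℝ] EN)

/-- A parallelism on `N`: a smooth `1`-form with values in `V` which is an isomorphism at each
point. Smoothness is expressed in charts. -/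
structure IsParallelism (θ : (x : N) → TangentSpace 𝓘(ℝ, EN) x →L[ℝ] V) : Prop where
  contDiffOn : ∀ x₀, ContDiffOn ℝ ∞ (coordForm θ x₀) (chartAt EN x₀).target
  bijective : ∀ x, Function.Bijective (θ x)

/-- The differential of `h` at `x` exists and carries the form `θ` to the form `θ'`. -/
def PreservesFormAt (θ : (x : N) → TangentSpace 𝓘(ℝ, EN) x →L[ℝ] V)
    (θ' : (x : N') → TangentSpace 𝓘(ℝ, EN') x →L[ℝ] V) (h : N → N') (x : N) : Prop :=
  MDifferentiableAt 𝓘(ℝ, EN) 𝓘(ℝ, EN') h x ∧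
    ∀ v : EN, (θ' (h x) : EN' →L[ℝ] V) ((mfderiv 𝓘(ℝ, EN) 𝓘(ℝ, EN') h x : EN →L[ℝ] EN') v) =
      (θ x : EN →L[ℝ] V) v

variable {θ : (x : N) → TangentSpace 𝓘(ℝ, EN) x →L[ℝ] V}
  {θ' : (x : N') → TangentSpace 𝓘(ℝ, EN') x →L[ℝ] V}
  {θ'' : (x : N'') → TangentSpace 𝓘(ℝ, EN'') x →L[ℝ] V}

theorem PreservesFormAt.comp {h : N → N'} {k : N' → N''} {x : N}
    (hk : PreservesFormAt θ' θ'' k (h x)) (hh : PreservesFormAt θ θ' h x) :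
    PreservesFormAt θ θ'' (k ∘ h) x := by
  refine ⟨hk.1.comp x hh.1, fun v => ?_⟩
  rw [mfderiv_comp x hk.1 hh.1]
  exact (hk.2 _).trans (hh.2 v)

theorem PreservesFormAt.congr {h k : N → N'} {x : N} (hh : PreservesFormAt θ θ' h x)
    (e : k =ᶠ[𝓝 x] h) : PreservesFormAt θ θ' k x := by
  refine ⟨hh.1.congr_of_eventuallyEq e, fun v => ?_⟩
  rw [e.mfderiv_eq]
  have := hh.2 v
  rw [← e.eq_of_nhds] at this
  exact this

variable [IsManifold 𝓘(ℝ, EN) ∞ N] [IsManifold 𝓘(ℝ, EN') ∞ N']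

theorem mdifferentiable_chart' (x₀ : N) :
    (chartAt EN x₀).MDifferentiable 𝓘(ℝ, EN) 𝓘(ℝ, EN) := by
  have : IsManifold 𝓘(ℝ, EN) 1 N := IsManifold.of_le (n := ∞) (by simp)
  exact mdifferentiable_chart x₀

theorem coordForm_mfderiv {x₀ x : N} (hx : x ∈ (chartAt EN x₀).source) (v : EN) :
    coordForm θ x₀ (chartAt EN x₀ x)
      ((mfderiv 𝓘(ℝ, EN) 𝓘(ℝ, EN) (chartAt EN x₀) x : EN →L[ℝ] EN) v) =
      (θ x : EN →L[ℝ] V) v := by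
  have h1 := (mdifferentiable_chart' (EN := EN) x₀).symm_comp_deriv hx
  have h2 : (mfderiv 𝓘(ℝ, EN) 𝓘(ℝ, EN) (chartAt EN x₀).symm (chartAt EN x₀ x) : EN →L[ℝ] EN)
      ((mfderiv 𝓘(ℝ, EN) 𝓘(ℝ, EN) (chartAt EN x₀) x : EN →L[ℝ] EN) v) = v :=
    congrArg (fun T : EN →L[ℝ] EN => T v) h1
  refine (congrArg (θ ((chartAt EN x₀).symm (chartAt EN x₀ x)) : EN →L[ℝ] V) h2).trans ?_
  rw [(chartAt EN x₀).left_inv hx]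

theorem IsParallelism.bijective_coordForm (hθ : IsParallelism θ) {x₀ : N} {u : EN}
    (hu : u ∈ (chartAt EN x₀).target) : Function.Bijective (coordForm θ x₀ u) := by
  have h1 := (mdifferentiable_chart' (EN := EN) x₀).symm.mfderiv_bijective hu
  exact (hθ.bijective _).comp h1

/-- The isomorphism `coordForm θ x₀ u`, for `u` in the range of the chart. -/
theorem IsParallelism.isInvertible_coordForm [FiniteDimensional ℝ EN] (hθ : IsParallelism θ)
    {x₀ : N} {u : EN} (hu : u ∈ (chartAt EN x₀).target) : (coordForm θ x₀ u).IsInvertible := by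
  have hb := hθ.bijective_coordForm hu
  exact ⟨(LinearEquiv.ofBijective (coordForm θ x₀ u).toLinearMap hb).toContinuousLinearEquiv,
    by ext; rfl⟩

theorem IsParallelism.contDiffOn_inverse [FiniteDimensional ℝ EN] (hθ : IsParallelism θ) (x₀ : N) :
    ContDiffOn ℝ ∞ (fun u => (coordForm θ x₀ u).inverse) (chartAt EN x₀).target := by
  intro u hu
  obtain ⟨e, he⟩ := hθ.isInvertible_coordForm hu
  have h1 : ContDiffAt ℝ ∞ (ContinuousLinearMap.inverse : (EN →L[ℝ] V) → V →L[ℝ] EN)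
      (coordForm θ x₀ u) := by
    rw [← he]
    exact contDiffAt_map_inverse e
  exact h1.comp_contDiffWithinAt u (hθ.contDiffOn x₀ u hu)

theorem IsParallelism.inverse_coordForm [FiniteDimensional ℝ EN] (hθ : IsParallelism θ)
    {x₀ : N} {u : EN} (hu : u ∈ (chartAt EN x₀).target) (v : EN) :
    (coordForm θ x₀ u).inverse (coordForm θ x₀ u v) = v := by
  obtain ⟨e, he⟩ := hθ.isInvertible_coordForm hu
  rw [← he]
  simp

theorem IsParallelism.coordForm_inverse [FiniteDimensional ℝ EN] (hθ : IsParallelism θ)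
    {x₀ : N} {u : EN} (hu : u ∈ (chartAt EN x₀).target) (v : V) :
    coordForm θ x₀ u ((coordForm θ x₀ u).inverse v) = v := by
  obtain ⟨e, he⟩ := hθ.isInvertible_coordForm hu
  rw [← he]
  simp

/-- The equation `θ' ∘ dh = θ` in charts: `dh = (θ'_h)⁻¹ ∘ θ`. -/
theorem PreservesFormAt.hasFDerivAt [FiniteDimensional ℝ EN'] (hθ' : IsParallelism θ') {h : N → N'}
    {x x₀ : N} {y₀ : N'} (hh : PreservesFormAt θ θ' h x) (hx : x ∈ (chartAt EN x₀).source)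
    (hy : h x ∈ (chartAt EN' y₀).source) :
    HasFDerivAt (fun u => chartAt EN' y₀ (h ((chartAt EN x₀).symm u)))
      ((coordForm θ' y₀ (chartAt EN' y₀ (h x))).inverse.comp
        (coordForm θ x₀ (chartAt EN x₀ x))) (chartAt EN x₀ x) := by
  have hxt := (chartAt EN x₀).map_source hx
  have d1 := ((mdifferentiable_chart' (EN := EN) x₀).mdifferentiableAt_symm hxt).hasMFDerivAt
  have d2 := hh.1.hasMFDerivAt
  have d3 := ((mdifferentiable_chart' (EN := EN') y₀).mdifferentiableAt hy).hasMFDerivAt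
  have e := (chartAt EN x₀).left_inv hx
  have d4 := HasMFDerivAt.comp (chartAt EN x₀ x)
    (g := fun z => chartAt EN' y₀ (h z)) (f := (chartAt EN x₀).symm)
    (by rw [e]; exact d3.comp x d2) d1
  rw [hasMFDerivAt_iff_hasFDerivAt] at d4
  refine HasFDerivAt.congr_fderiv d4 ?_
  refine ContinuousLinearMap.ext fun v => ?_
  obtain ⟨w, rfl⟩ := ((mdifferentiable_chart' (EN := EN) x₀).mfderiv_bijective hx).2 v
  have h1 : (mfderiv 𝓘(ℝ, EN) 𝓘(ℝ, EN) (chartAt EN x₀).symm (chartAt EN x₀ x) : EN →L[ℝ] EN)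
      ((mfderiv 𝓘(ℝ, EN) 𝓘(ℝ, EN) (chartAt EN x₀) x : EN →L[ℝ] EN) w) = w :=
    congrArg (fun T : EN →L[ℝ] EN => T w)
      ((mdifferentiable_chart' (EN := EN) x₀).symm_comp_deriv hx)
  have h2 := coordForm_mfderiv (θ := θ) hx w
  have h3 := hh.2 w
  have h4 := coordForm_mfderiv (θ := θ') hy
    ((mfderiv 𝓘(ℝ, EN) 𝓘(ℝ, EN') h x : EN →L[ℝ] EN') w)
  refine Eq.trans ?_ (congrArg (coordForm θ' y₀ (chartAt EN' y₀ (h x))).inverse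
    (h4.trans (h3.trans h2.symm)))
  refine Eq.trans ?_ (hθ'.inverse_coordForm ((chartAt EN' y₀).map_source hy) _).symm
  exact congrArg (fun z => (mfderiv 𝓘(ℝ, EN') 𝓘(ℝ, EN') (chartAt EN' y₀) (h x) : EN' →L[ℝ] EN')
    ((mfderiv 𝓘(ℝ, EN) 𝓘(ℝ, EN') h x : EN →L[ℝ] EN') z)) h1

/-- A solution of `df = (θ'_f)⁻¹ ∘ θ` in charts defines a map preserving the forms. -/
theorem preservesFormAt_of_hasFDerivAt [FiniteDimensional ℝ EN'] (hθ' : IsParallelism θ')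
    {f : EN → EN'} {x x₀ : N} {y₀ : N'} (hx : x ∈ (chartAt EN x₀).source)
    (hy : f (chartAt EN x₀ x) ∈ (chartAt EN' y₀).target)
    (hf : HasFDerivAt f ((coordForm θ' y₀ (f (chartAt EN x₀ x))).inverse.comp
      (coordForm θ x₀ (chartAt EN x₀ x))) (chartAt EN x₀ x)) :
    PreservesFormAt θ θ' (fun z => (chartAt EN' y₀).symm (f (chartAt EN x₀ z))) x := by
  have d1 := ((mdifferentiable_chart' (EN := EN) x₀).mdifferentiableAt hx).hasMFDerivAt
  have d3 := ((mdifferentiable_chart' (EN := EN') y₀).mdifferentiableAt_symm hy).hasMFDerivAt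
  have d4 := d3.comp x (hf.hasMFDerivAt.comp x d1)
  refine ⟨d4.mdifferentiableAt, fun v => ?_⟩
  have h1 := d4.mfderiv
  have h2 := coordForm_mfderiv (θ := θ) hx v
  set w := (mfderiv 𝓘(ℝ, EN) 𝓘(ℝ, EN) (chartAt EN x₀) x : EN →L[ℝ] EN) v with hw
  have h3 := hθ'.coordForm_inverse hy (coordForm θ x₀ (chartAt EN x₀ x) w)
  rw [← h2]
  refine Eq.trans ?_ h3
  have h5 : (mfderiv 𝓘(ℝ, EN) 𝓘(ℝ, EN') (fun z => (chartAt EN' y₀).symm (f (chartAt EN x₀ z))) x :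
      EN →L[ℝ] EN') v = (mfderiv 𝓘(ℝ, EN') 𝓘(ℝ, EN') (chartAt EN' y₀).symm
        (f (chartAt EN x₀ x)) : EN' →L[ℝ] EN')
          ((coordForm θ' y₀ (f (chartAt EN x₀ x))).inverse (coordForm θ x₀ (chartAt EN x₀ x) w)) :=
    congrArg (fun T : EN →L[ℝ] EN' => T v) h1
  rw [h5]
  rfl

/-- Smoothness on the tangent bundle implies smoothness in charts. -/
theorem contDiffOn_coordForm_of_contMDiff [FiniteDimensional ℝ EN]
    (hθ : ContMDiff 𝓘(ℝ, EN).tangent 𝓘(ℝ, V) ∞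
      (fun v : TangentBundle 𝓘(ℝ, EN) N => (θ v.proj v.snd : V))) (x₀ : N) :
    ContDiffOn ℝ ∞ (coordForm θ x₀) (chartAt EN x₀).target := by
  rw [contDiffOn_clm_apply]
  intro v
  rw [← contMDiffOn_iff_contDiffOn]
  have h1 : ContMDiffOn 𝓘(ℝ, EN) 𝓘(ℝ, EN) ∞ (chartAt EN x₀).symm (chartAt EN x₀).target :=
    contMDiffOn_chart_symm
  have h2 := h1.contMDiffOn_tangentMapWithin (m := ∞) (by simp)
    (chartAt EN x₀).open_target.uniqueMDiffOn
  have h3 : ContMDiffOn 𝓘(ℝ, EN) 𝓘(ℝ, EN).tangent ∞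
      (fun u : EN => (⟨u, v⟩ : TangentBundle 𝓘(ℝ, EN) EN)) (chartAt EN x₀).target := by
    have : ContMDiff 𝓘(ℝ, EN) 𝓘(ℝ, EN).tangent ∞
        (fun u : EN => (⟨u, v⟩ : TangentBundle 𝓘(ℝ, EN) EN)) :=
      contMDiff_vectorSpace_iff_contDiff.2 contDiff_const
    exact this.contMDiffOn
  have h4 := hθ.comp_contMDiffOn (h2.comp h3 (fun u hu => hu))
  refine h4.congr fun u hu => ?_
  simp only [Function.comp_apply, tangentMapWithin, coordForm,
    mfderivWithin_of_isOpen (chartAt EN x₀).open_target hu]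
  rfl

end CoordForm

/-! ### The Maurer-Cartan form as a parallelism -/

section MaurerCartan

variable {E : Type*} [NormedAddCommGroup E] [NormedSpace ℝ E]
  {G : Type*} [TopologicalSpace G] [ChartedSpace E G] [Group G]

/-- The Maurer-Cartan form, with its values regarded as elements of the model space `E`. -/
def mcForm (g : G) : TangentSpace 𝓘(ℝ, E) g →L[ℝ] E := maurerCartan g

variable [LieGroup 𝓘(ℝ, E) ∞ G]

theorem mdifferentiableAt_mul_left' (g x : G) :
    MDifferentiableAt 𝓘(ℝ, E) 𝓘(ℝ, E) (fun y : G => g * y) x :=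
  (contMDiff_mul_left (I := 𝓘(ℝ, E)) (n := ∞) (a := g)).mdifferentiable (by simp) x

/-- The differentials of two inverse left translations are inverse to each other. -/
theorem mfderiv_mul_left_comp {a b x z : G} (hz : b * x = z) (hab : a * b = 1) :
    (mfderiv 𝓘(ℝ, E) 𝓘(ℝ, E) (fun y : G => a * y) z : E →L[ℝ] E).comp
      (mfderiv 𝓘(ℝ, E) 𝓘(ℝ, E) (fun y : G => b * y) x : E →L[ℝ] E) =
      ContinuousLinearMap.id ℝ E := by
  subst hz
  have h := mfderiv_comp x (mdifferentiableAt_mul_left' (E := E) a (b * x))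
    (mdifferentiableAt_mul_left' (E := E) b x)
  have e : (fun y : G => a * y) ∘ (fun y : G => b * y) = id := by
    funext y
    simp [← mul_assoc, hab]
  rw [e, mfderiv_id] at h
  exact h.symm

theorem bijective_mcForm (g : G) : Function.Bijective (mcForm (E := E) g) := by
  have h1 := mfderiv_mul_left_comp (E := E) (inv_mul_cancel g) (mul_inv_cancel g)
  have h2 := mfderiv_mul_left_comp (E := E) (mul_one g) (inv_mul_cancel g)
  exact Function.bijective_iff_has_inverse.2
    ⟨(mfderiv 𝓘(ℝ, E) 𝓘(ℝ, E) (fun x : G => g * x) 1 : E →L[ℝ] E),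
      fun v => congrArg (fun T : E →L[ℝ] E => T v) h1,
      fun v => congrArg (fun T : E →L[ℝ] E => T v) h2⟩

/-- The Maurer-Cartan form is left invariant. -/
theorem preservesFormAt_mul_left (g x : G) :
    PreservesFormAt (mcForm (E := E) (G := G)) mcForm (fun y : G => g * y) x := by
  refine ⟨mdifferentiableAt_mul_left' g x, fun v => ?_⟩
  have h := mfderiv_comp x (mdifferentiableAt_mul_left' (E := E) (g * x)⁻¹ (g * x))
    (mdifferentiableAt_mul_left' (E := E) g x)
  have e : (fun y : G => (g * x)⁻¹ * y) ∘ (fun y : G => g * y) = fun y => x⁻¹ * y := by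
    funext y
    simp only [Function.comp_apply]
    group
  rw [e] at h
  exact (congrArg (fun T : E →L[ℝ] E => T v) h).symm

theorem mfderiv_chartAt_self {EN : Type*} [NormedAddCommGroup EN] [NormedSpace ℝ EN]
    {N : Type*} [TopologicalSpace N] [ChartedSpace EN N] [IsManifold 𝓘(ℝ, EN) ∞ N] (x : N) :
    (mfderiv 𝓘(ℝ, EN) 𝓘(ℝ, EN) (chartAt EN x) x : EN →L[ℝ] EN) = ContinuousLinearMap.id ℝ EN := by
  have : IsManifold 𝓘(ℝ, EN) 1 N := IsManifold.of_le (n := ∞) (by simp)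
  have h := mfderiv_extChartAt_self (I := 𝓘(ℝ, EN)) (x := x)
  simpa only [mfld_simps] using! h

/-- The Maurer-Cartan form is smooth: in charts, it is the partial differential of
`(v, w) ↦ v⁻¹ w` on the diagonal, followed by the chart at the identity. -/
theorem isParallelism_mcForm [FiniteDimensional ℝ E] :
    IsParallelism (mcForm (E := E) (G := G)) := by
  refine ⟨fun x₀ u hu => ContDiffAt.contDiffWithinAt ?_, bijective_mcForm⟩
  have hsymm : ∀ w ∈ (chartAt E x₀).target,
      ContMDiffAt 𝓘(ℝ, E) 𝓘(ℝ, E) ∞ (chartAt E x₀).symm w := fun w hw =>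
    contMDiffOn_chart_symm.contMDiffAt ((chartAt E x₀).open_target.mem_nhds hw)
  have hone : ContMDiffAt 𝓘(ℝ, E) 𝓘(ℝ, E) ∞ (chartAt E (1 : G)) 1 :=
    contMDiffOn_chart.contMDiffAt ((chartAt E (1 : G)).open_source.mem_nhds (mem_chart_source E 1))
  have hdiv : ContDiffAt ℝ ∞ (Function.uncurry fun v w : E => chartAt E (1 : G)
      (((chartAt E x₀).symm v)⁻¹ * (chartAt E x₀).symm w)) (u, u) := by
    rw [← contMDiffAt_iff_contDiffAt]
    have h1 : ContMDiffAt 𝓘(ℝ, E × E) 𝓘(ℝ, E) ∞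
        (fun p : E × E => ((chartAt E x₀).symm p.1)⁻¹ * (chartAt E x₀).symm p.2) (u, u) := by
      have f1 : ContMDiffAt 𝓘(ℝ, E × E) 𝓘(ℝ, E) ∞ (fun p : E × E => p.1) (u, u) :=
        contDiff_fst.contMDiff.contMDiffAt
      have f2 : ContMDiffAt 𝓘(ℝ, E × E) 𝓘(ℝ, E) ∞ (fun p : E × E => p.2) (u, u) :=
        contDiff_snd.contMDiff.contMDiffAt
      exact (((hsymm u hu).comp (u, u) f1).inv).mul ((hsymm u hu).comp (u, u) f2)
    refine ContMDiffAt.comp (u, u) (g := chartAt E (1 : G)) ?_ h1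
    simpa using hone
  have h := ContDiffAt.fderiv (f := fun v w : E => chartAt E (1 : G)
      (((chartAt E x₀).symm v)⁻¹ * (chartAt E x₀).symm w)) (m := ∞) hdiv
      (contDiffAt_id (x := u)) (by simp)
  refine h.congr_of_eventuallyEq ?_
  filter_upwards [(chartAt E x₀).open_target.mem_nhds hu] with w hw
  set g := (chartAt E x₀).symm w with hg
  have d1 := ((hsymm w hw).mdifferentiableAt (by simp)).hasMFDerivAt
  have d2 := (mdifferentiableAt_mul_left' (E := E) g⁻¹ g).hasMFDerivAt
  have d3 := (hone.mdifferentiableAt (by simp)).hasMFDerivAt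
  have d4 := HasMFDerivAt.comp w (g := fun z => chartAt E (1 : G) (g⁻¹ * z))
    (f := (chartAt E x₀).symm)
    (HasMFDerivAt.comp g (g := chartAt E (1 : G)) (by rw [inv_mul_cancel]; exact d3) d2) d1
  rw [hasMFDerivAt_iff_hasFDerivAt] at d4
  have d5 : fderiv ℝ (fun v : E => chartAt E (1 : G) (g⁻¹ * (chartAt E x₀).symm v)) w =
      ((mfderiv 𝓘(ℝ, E) 𝓘(ℝ, E) (chartAt E (1 : G)) 1 : E →L[ℝ] E).comp
        (mfderiv 𝓘(ℝ, E) 𝓘(ℝ, E) (fun y : G => g⁻¹ * y) g : E →L[ℝ] E)).comp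
        (mfderiv 𝓘(ℝ, E) 𝓘(ℝ, E) (chartAt E x₀).symm w : E →L[ℝ] E) := HasFDerivAt.fderiv d4
  refine ContinuousLinearMap.ext fun v => ?_
  refine Eq.trans ?_ (congrArg (fun T : E →L[ℝ] E => T v) d5).symm
  have h5 := mfderiv_chartAt_self (EN := E) (1 : G)
  exact (congrArg (fun T : E →L[ℝ] E =>
    T (coordForm (mcForm (E := E) (G := G)) x₀ w v)) h5).symm

end MaurerCartan

/-! ### The inverse function theorem for parallelisms -/

section InverseFunction

variable {V : Type*} [NormedAddCommGroup V] [NormedSpace ℝ V]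
  {EN : Type*} [NormedAddCommGroup EN] [NormedSpace ℝ EN] [FiniteDimensional ℝ EN]
  {N : Type*} [TopologicalSpace N] [ChartedSpace EN N] [IsManifold 𝓘(ℝ, EN) ∞ N]
  {EN' : Type*} [NormedAddCommGroup EN'] [NormedSpace ℝ EN'] [FiniteDimensional ℝ EN']
  {N' : Type*} [TopologicalSpace N'] [ChartedSpace EN' N'] [IsManifold 𝓘(ℝ, EN') ∞ N']
  {θ : (x : N) → TangentSpace 𝓘(ℝ, EN) x →L[ℝ] V}
  {θ' : (x : N') → TangentSpace 𝓘(ℝ, EN') x →L[ℝ] V}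

/-- The inverse function theorem for smooth maps which preserve a parallelism, in charts. -/
theorem PreservesFormAt.exists_localInverse (hθ : IsParallelism θ) (hθ' : IsParallelism θ')
    {h : N → N'} {x : N} (hh : PreservesFormAt θ θ' h x)
    (hs : ContMDiffAt 𝓘(ℝ, EN) 𝓘(ℝ, EN') ∞ h x) :
    ∃ k : N' → N, k (h x) = x ∧ ContMDiffAt 𝓘(ℝ, EN') 𝓘(ℝ, EN) ∞ k (h x) ∧
      ∀ᶠ y in 𝓝 (h x), h (k y) = y := by
  set χ := chartAt EN x with hχ
  set χ' := chartAt EN' (h x) with hχ'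
  set f : EN → EN' := fun u => χ' (h (χ.symm u)) with hf
  have hx : x ∈ χ.source := mem_chart_source EN x
  have hy : h x ∈ χ'.source := mem_chart_source EN' (h x)
  have hxx : χ.symm (χ x) = x := χ.left_inv hx
  have hfx : f (χ x) = χ' (h x) := by rw [hf]; simp only [hxx]
  have hsymm : ContMDiffAt 𝓘(ℝ, EN) 𝓘(ℝ, EN) ∞ χ.symm (χ x) :=
    contMDiffOn_chart_symm.contMDiffAt (χ.open_target.mem_nhds (χ.map_source hx))
  have hch' : ContMDiffAt 𝓘(ℝ, EN') 𝓘(ℝ, EN') ∞ χ' (h x) :=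
    contMDiffOn_chart.contMDiffAt (χ'.open_source.mem_nhds hy)
  have hcd : ContDiffAt ℝ ∞ f (χ x) := by
    rw [← contMDiffAt_iff_contDiffAt]
    exact ContMDiffAt.comp (χ x) (g := fun z => χ' (h z)) (f := χ.symm)
      (by rw [hxx]; exact hch'.comp x hs) hsymm
  have hfd := hh.hasFDerivAt hθ' hx hy
  obtain ⟨e, he⟩ := hθ.isInvertible_coordForm (χ.map_source hx)
  obtain ⟨e', he'⟩ := hθ'.isInvertible_coordForm (χ'.map_source hy)
  have hfd' : HasFDerivAt f ((e.trans e'.symm : EN ≃L[ℝ] EN') : EN →L[ℝ] EN') (χ x) := by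
    refine HasFDerivAt.congr_fderiv hfd ?_
    rw [← he, ← he']
    ext v
    simp
  set j := hcd.localInverse hfd' (by simp) with hj
  have hjx : j (χ' (h x)) = χ x := by
    rw [← hfx]
    exact hcd.localInverse_apply_image hfd' (by simp)
  have hjc : ContMDiffAt 𝓘(ℝ, EN') 𝓘(ℝ, EN) ∞ j (χ' (h x)) := by
    rw [contMDiffAt_iff_contDiffAt, ← hfx]
    exact hcd.to_localInverse hfd' (by simp)
  have hr : ∀ᶠ w in 𝓝 (χ' (h x)), f (j w) = w := by
    rw [← hfx]
    exact (hcd.hasStrictFDerivAt' hfd' (by simp)).eventually_right_inverse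
  have hk : ContMDiffAt 𝓘(ℝ, EN') 𝓘(ℝ, EN) ∞ (fun y => χ.symm (j (χ' y))) (h x) := by
    refine ContMDiffAt.comp (h x) (g := χ.symm) (f := fun y => j (χ' y)) ?_ (hjc.comp (h x) hch')
    simp only [hjx]
    exact hsymm
  have hkx : χ.symm (j (χ' (h x))) = x := by rw [hjx, hxx]
  refine ⟨fun y => χ.symm (j (χ' y)), hkx, hk, ?_⟩
  have h1 : ∀ᶠ y in 𝓝 (h x), h (χ.symm (j (χ' y))) ∈ χ'.source := by
    have hc : ContinuousAt (fun y => h (χ.symm (j (χ' y)))) (h x) :=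
      ContinuousAt.comp (g := h) (f := fun y => χ.symm (j (χ' y)))
        (by simp only [hkx]; exact hs.continuousAt) hk.continuousAt
    refine hc.eventually_mem (χ'.open_source.mem_nhds ?_)
    simp only [hkx]
    exact hy
  filter_upwards [h1, χ'.open_source.mem_nhds hy, hch'.continuousAt.eventually hr] with y hy1 hy2 hy3
  exact χ'.injOn hy1 hy2 hy3

theorem PreservesFormAt.nhds_le_map (hθ : IsParallelism θ) (hθ' : IsParallelism θ')
    {h : N → N'} {x : N} (hh : PreservesFormAt θ θ' h x)
    (hs : ContMDiffAt 𝓘(ℝ, EN) 𝓘(ℝ, EN') ∞ h x) : 𝓝 (h x) ≤ Filter.map h (𝓝 x) := by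
  obtain ⟨k, hkx, hk, hr⟩ := hh.exists_localInverse hθ hθ' hs
  have h1 : Filter.Tendsto k (𝓝 (h x)) (𝓝 x) := by
    have := hk.continuousAt.tendsto
    rwa [hkx] at this
  have h2 : Filter.map (h ∘ k) (𝓝 (h x)) = 𝓝 (h x) :=
    (Filter.map_congr (m₁ := h ∘ k) (m₂ := id) hr).trans Filter.map_id
  rw [← h2, ← Filter.map_map]
  exact Filter.map_mono h1

theorem PreservesFormAt.contMDiffAt_leftInverse (hθ : IsParallelism θ) (hθ' : IsParallelism θ')
    {h : N → N'} {x : N} (hh : PreservesFormAt θ θ' h x)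
    (hs : ContMDiffAt 𝓘(ℝ, EN) 𝓘(ℝ, EN') ∞ h x) {k : N' → N} (hk : Function.LeftInverse k h) :
    ContMDiffAt 𝓘(ℝ, EN') 𝓘(ℝ, EN) ∞ k (h x) := by
  obtain ⟨j, -, hj, hr⟩ := hh.exists_localInverse hθ hθ' hs
  refine hj.congr_of_eventuallyEq ?_
  filter_upwards [hr] with y hy
  rw [← hk (j y), hy]

end InverseFunction

/-! ### Development of curves -/

section Development

open Set

/-- The Picard-Lindelöf theorem, with the information that the solution stays in the ball. -/
theorem IsPicardLindelof.exists_mem_closedBall {E : Type*} [NormedAddCommGroup E]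
    [NormedSpace ℝ E] [CompleteSpace E] {f : ℝ → E → E} {tmin tmax : ℝ} {t₀ : Icc tmin tmax}
    {x₀ : E} {a L K : NNReal} (hf : IsPicardLindelof f t₀ x₀ a 0 L K) :
    ∃ α : ℝ → E, α t₀ = x₀ ∧ ∀ t ∈ Icc tmin tmax, α t ∈ Metric.closedBall x₀ a ∧
      HasDerivWithinAt α (f t (α t)) (Icc tmin tmax) t := by
  obtain ⟨α, hα⟩ := ODE.FunSpace.exists_isFixedPt_next hf (Metric.mem_closedBall_self le_rfl)
  refine ⟨α.compProj, by rw [ODE.FunSpace.compProj_val, ← hα, ODE.FunSpace.next_apply₀],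
    fun t ht => ⟨α.compProj_mem_closedBall hf.mul_max_le, ?_⟩⟩
  apply ODE.hasDerivWithinAt_picard_Icc t₀.2 hf.continuousOn_uncurry
    α.continuous_compProj.continuousOn (fun _ ht' => α.compProj_mem_closedBall hf.mul_max_le)
    x₀ ht |>.congr_of_mem _ ht
  intro t' ht'
  nth_rw 1 [← hα]
  rw [ODE.FunSpace.compProj_of_mem ht', ODE.FunSpace.next_apply]

variable {E : Type*} [NormedAddCommGroup E] [NormedSpace ℝ E] [FiniteDimensional ℝ E]
  {G : Type*} [TopologicalSpace G] [ChartedSpace E G] [Group G] [LieGroup 𝓘(ℝ, E) ∞ G]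
  {EN : Type*} [NormedAddCommGroup EN] [NormedSpace ℝ EN] [FiniteDimensional ℝ EN]
  {N : Type*} [TopologicalSpace N] [ChartedSpace EN N] [IsManifold 𝓘(ℝ, EN) ∞ N] [T2Space N]
  {θ : (x : N) → TangentSpace 𝓘(ℝ, EN) x →L[ℝ] E}

/-- Development of curves. Let `h` be a map from a subset `W` of `G` to a manifold with a
parallelism which, at the points of `W`, pulls the parallelism back to the Maurer-Cartan form. A
short segment `β` which starts in the image of `h` and ends at a given point `b₁` of the closure of
the image is developed on a curve `γ` in the whole of `G`, and `h` maps `γ` to `β` as long as `γ`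
stays in `W`. The length of the segments for which this works is uniform because `G` acts on itself
by left translations, which preserve the Maurer-Cartan form. -/
theorem exists_development (hθ : IsParallelism θ) {W : Set G} {h : G → N}
    (hh : ∀ g ∈ W, PreservesFormAt mcForm θ h g) {b₁ : N} (hb₁ : b₁ ∈ closure (h '' W)) :
    ∃ (γ : ℝ → G) (β : ℝ → N), ContinuousOn γ (Icc 0 1) ∧ ContinuousOn β (Icc 0 1) ∧
      γ 0 ∈ W ∧ β 1 = b₁ ∧
      ∀ T ∈ Icc (0 : ℝ) 1, (∀ t ∈ Icc 0 T, γ t ∈ W) → h (γ T) = β T := by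
  have hG := topologicalGroup_of_lieGroup 𝓘(ℝ, E) ∞ (G := G)
  have hmc := isParallelism_mcForm (E := E) (G := G)
  set χ := chartAt E (1 : G) with hχ
  set ψ := chartAt EN b₁ with hψ
  have h1s : (1 : G) ∈ χ.source := mem_chart_source E 1
  have hbs : b₁ ∈ ψ.source := mem_chart_source EN b₁
  set A₁ : E → E →L[ℝ] E := coordForm mcForm (1 : G) with hA₁
  set A₂ : EN → EN →L[ℝ] E := coordForm θ b₁ with hA₂
  set Ψ : EN × E → EN →L[ℝ] E := fun p => (A₁ p.2).inverse.comp (A₂ p.1) with hΨ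
  have hΨs : ContDiffOn ℝ ∞ Ψ (ψ.target ×ˢ χ.target) := by
    refine ContDiffOn.clm_comp ?_ ?_
    · exact (hmc.contDiffOn_inverse 1).comp contDiffOn_snd fun p hp => hp.2
    · exact (hθ.contDiffOn b₁).comp contDiffOn_fst fun p hp => hp.1
  have htgt : ψ.target ×ˢ χ.target ∈ 𝓝 (ψ b₁, χ 1) :=
    (ψ.open_target.prod χ.open_target).mem_nhds ⟨ψ.map_source hbs, χ.map_source h1s⟩
  have hΨ1 : ContDiffAt ℝ ∞ Ψ (ψ b₁, χ 1) := hΨs.contDiffAt htgt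
  obtain ⟨K, s, hs, hK⟩ := (hΨ1.of_le (m := 1) (by simp)).exists_lipschitzOnWith
  set C : ℝ := ‖Ψ (ψ b₁, χ 1)‖ + 1 with hC
  have hC0 : 0 < C := by positivity
  have hbd : ∀ᶠ p in 𝓝 (ψ b₁, χ 1), ‖Ψ p‖ < C :=
    hΨ1.continuousAt.norm.eventually_lt continuousAt_const (by simp [hC])
  obtain ⟨r, hr, hball⟩ := Metric.nhds_basis_closedBall.eventually_iff.1
    ((Filter.eventually_mem_set.2 hs).and (hbd.and (Filter.eventually_mem_set.2 htgt)))
  rw [← closedBall_prod_same] at hball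
  -- a point of the image which is close to `b₁`
  obtain ⟨b₀, ⟨hb₀s, hb₀r⟩, g₀, hg₀, rfl⟩ : ∃ b₀, (b₀ ∈ ψ.source ∧
      dist (ψ b₀) (ψ b₁) < min r (r / C)) ∧ b₀ ∈ h '' W := by
    have h1 : ψ.source ∩ {b | dist (ψ b) (ψ b₁) < min r (r / C)} ∈ 𝓝 b₁ := by
      refine Filter.inter_mem (ψ.open_source.mem_nhds hbs) ?_
      exact (ψ.continuousAt hbs).eventually (Metric.ball_mem_nhds _ (by positivity))
    obtain ⟨b, hb, hb'⟩ := mem_closure_iff_nhds.1 hb₁ _ h1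
    exact ⟨b, hb, hb'⟩
  set x₀ := ψ (h g₀) with hx₀
  set w := ψ b₁ - x₀ with hw
  have hwr : ‖w‖ ≤ r := by
    rw [hw, ← dist_eq_norm, dist_comm]
    exact (hb₀r.trans_le (min_le_left _ _)).le
  have hwC : C * ‖w‖ ≤ r := by
    have : ‖w‖ ≤ r / C := by
      rw [hw, ← dist_eq_norm, dist_comm]
      exact (hb₀r.trans_le (min_le_right _ _)).le
    rw [le_div_iff₀ hC0] at this
    linarith
  set c : ℝ → EN := fun t => x₀ + t • w with hc
  have hcc : Continuous c := by fun_prop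
  have hc1 : c 1 = ψ b₁ := by simp [hc, hw]
  have hcr : ∀ t ∈ Icc (0 : ℝ) 1, c t ∈ Metric.closedBall (ψ b₁) r := by
    intro t ht
    rw [Metric.mem_closedBall, ← hc1, dist_eq_norm]
    have : c t - c 1 = (t - 1) • w := by simp only [hc]; module
    rw [this, norm_smul, Real.norm_eq_abs]
    have h2 : |t - 1| ≤ 1 := by rw [abs_le]; constructor <;> linarith [ht.1, ht.2]
    nlinarith [norm_nonneg w]
  have hct : ∀ t ∈ Icc (0 : ℝ) 1, c t ∈ ψ.target := fun t ht =>
    (hball (x := (c t, χ 1)) ⟨hcr t ht, Metric.mem_closedBall_self hr.le⟩).2.2.1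
  -- the equation for the development of the segment `c`
  have hPL : IsPicardLindelof (fun t y => Ψ (c t, y) w) (tmin := 0) (tmax := 1)
      ⟨0, by simp⟩ (χ 1) r.toNNReal 0 (C * ‖w‖).toNNReal (K * ‖w‖₊) := by
    have hrr : (r.toNNReal : ℝ) = r := Real.coe_toNNReal r hr.le
    have hCw : ((C * ‖w‖).toNNReal : ℝ) = C * ‖w‖ := Real.coe_toNNReal _ (by positivity)
    refine ⟨fun t ht => ?_, fun y hy => ?_, fun t ht y hy => ?_, ?_⟩ <;> rw [hrr] at *
    · refine LipschitzOnWith.of_dist_le_mul fun y hy z hz => ?_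
      have h1 := hK.dist_le_mul _ (hball (x := (c t, y)) ⟨hcr t ht, hy⟩).1 _
        (hball (x := (c t, z)) ⟨hcr t ht, hz⟩).1
      rw [dist_prod_same_left, dist_eq_norm] at h1
      rw [dist_eq_norm, ← sub_apply]
      calc ‖(Ψ (c t, y) - Ψ (c t, z)) w‖ ≤ ‖Ψ (c t, y) - Ψ (c t, z)‖ * ‖w‖ :=
            ContinuousLinearMap.le_opNorm _ _
        _ ≤ (K * dist y z) * ‖w‖ := by gcongr
        _ = _ := by push_cast; ring
    · have h1 : ContinuousOn (fun t => Ψ (c t, y)) (Icc 0 1) :=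
        hΨs.continuousOn.comp (hcc.prodMk continuous_const).continuousOn fun t ht =>
          (hball (x := (c t, y)) ⟨hcr t ht, hy⟩).2.2
      exact h1.clm_apply continuousOn_const
    · refine (ContinuousLinearMap.le_opNorm _ _).trans ?_
      have := (hball (x := (c t, y)) ⟨hcr t ht, hy⟩).2.1.le
      rw [hCw]
      gcongr
    · rw [hCw]
      simpa using hwC
  obtain ⟨α, hα0, hα⟩ := hPL.exists_mem_closedBall
  rw [Real.coe_toNNReal r hr.le] at hα
  have hαt : ∀ t ∈ Icc (0 : ℝ) 1, α t ∈ χ.target := fun t ht =>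
    (hball (x := (c t, α t)) ⟨hcr t ht, (hα t ht).1⟩).2.2.2
  have hαc : ContinuousOn α (Icc 0 1) := fun t ht => (hα t ht).2.continuousWithinAt
  set γ : ℝ → G := fun t => g₀ * χ.symm (α t) with hγ
  have hγc : ContinuousOn γ (Icc 0 1) :=
    continuousOn_const.mul (χ.continuousOn_symm.comp hαc hαt)
  have hγ0 : γ 0 = g₀ := by
    simp only [hγ, hα0, χ.left_inv h1s, mul_one]
  have hβc : ContinuousOn (fun t => ψ.symm (c t)) (Icc 0 1) :=
    ψ.continuousOn_symm.comp hcc.continuousOn hct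
  refine ⟨γ, fun t => ψ.symm (c t), hγc, hβc, by rwa [hγ0], ?_, ?_⟩
  · simp only [hc1, ψ.left_inv hbs]
  intro T hT hTW
  have hsub : Icc 0 T ⊆ Icc (0 : ℝ) 1 := Icc_subset_Icc_right hT.2
  have hhγ : ContinuousOn (fun t => h (γ t)) (Icc 0 T) := fun t ht =>
    ContinuousAt.comp_continuousWithinAt (hh _ (hTW t ht)).1.continuousAt
      ((hγc.mono hsub) t ht)
  have hclosed : IsClosed ({t | h (γ t) = ψ.symm (c t)} ∩ Icc 0 T) := by
    rw [inter_comm]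
    exact isClosed_Icc.isClosed_eq hhγ (hβc.mono hsub)
  refine hclosed.Icc_subset_of_forall_exists_gt ?_ ?_ (right_mem_Icc.2 hT.1)
  · simp only [mem_ofPred_eq, hγ0]
    simp [hc, hx₀, ψ.left_inv hb₀s]
  rintro t₀ ⟨ht₀, ht₀'⟩ y hy
  have ht₀T : t₀ ∈ Icc 0 T := Ico_subset_Icc_self ht₀'
  have hx₀t : c t₀ ∈ ψ.target := hct _ (hsub ht₀T)
  -- both sides solve, in the chart, the same equation near `t₀`
  obtain ⟨K₂, s₂, hs₂, hK₂⟩ := (((hθ.contDiffOn_inverse b₁).contDiffAt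
    (ψ.open_target.mem_nhds hx₀t)).of_le (m := 1) (by simp)).exists_lipschitzOnWith
  have hA₂c : ContinuousAt A₂ (c t₀) :=
    (hθ.contDiffOn b₁).continuousOn.continuousAt (ψ.open_target.mem_nhds hx₀t)
  have hbd₂ : ∀ᶠ t in 𝓝 t₀, ‖A₂ (c t) w‖ < ‖A₂ (c t₀) w‖ + 1 := by
    have h1 : ContinuousAt (fun t => ‖A₂ (c t) w‖) t₀ :=
      ((hA₂c.comp hcc.continuousAt).clm_apply continuousAt_const).norm
    exact h1.eventually_lt continuousAt_const (by simp)
  have hIcc : Icc 0 T ∈ 𝓝[≥] t₀ := by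
    filter_upwards [Icc_mem_nhdsGE ht₀'.2] with t ht using ⟨ht₀'.1.trans ht.1, ht.2⟩
  have hcg : ContinuousWithinAt (fun t => h (γ t)) (Ici t₀) t₀ :=
    (hhγ t₀ ht₀T).mono_of_mem_nhdsWithin hIcc
  have ht₀e : h (γ t₀) = ψ.symm (c t₀) := ht₀
  have hsrc : h (γ t₀) ∈ ψ.source := by
    rw [ht₀e]
    exact ψ.map_target hx₀t
  have hψh : ψ (h (γ t₀)) = c t₀ := by rw [ht₀e, ψ.right_inv hx₀t]
  have hev1 : ∀ᶠ t in 𝓝[≥] t₀, h (γ t) ∈ ψ.source :=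
    hcg.eventually (ψ.open_source.mem_nhds hsrc)
  have hxc : ContinuousWithinAt (fun t => ψ (h (γ t))) (Ici t₀) t₀ :=
    ContinuousAt.comp_continuousWithinAt (g := ψ) (f := fun t => h (γ t))
      (ψ.continuousAt hsrc) hcg
  have hev2 : ∀ᶠ t in 𝓝[≥] t₀, ψ (h (γ t)) ∈ s₂ := by
    refine hxc.eventually_mem ?_
    simp only [hψh]
    exact hs₂
  have hev3 : ∀ᶠ t in 𝓝[≥] t₀, c t ∈ s₂ :=
    Filter.Eventually.filter_mono nhdsWithin_le_nhds (hcc.continuousAt.eventually_mem hs₂)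
  have hev4 : ∀ᶠ t in 𝓝[≥] t₀, ‖A₂ (c t) w‖ < ‖A₂ (c t₀) w‖ + 1 :=
    Filter.Eventually.filter_mono nhdsWithin_le_nhds hbd₂
  obtain ⟨u, hu, hus⟩ := mem_nhdsGE_iff_exists_Icc_subset.1
    ((hev1.and (hev2.and (hev3.and hev4))).and (Filter.eventually_mem_set.2 hIcc))
  have hu : t₀ < u := hu
  have hy : t₀ < y := hy
  have hequ : EqOn (fun t => ψ (h (γ t))) c (Icc t₀ u) := by
    refine ODE_solution_unique_of_mem_Icc_right (s := fun _ => s₂)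
      (K := K₂ * (‖A₂ (c t₀) w‖ + 1).toNNReal)
      (v := fun t x => (A₂ x).inverse (A₂ (c t) w)) ?_ ?_ ?_ ?_ ?_ ?_ ?_ hψh
    · intro t ht
      have h4 := (hus (Ico_subset_Icc_self ht)).1.2.2.2.le
      refine LipschitzOnWith.of_dist_le_mul fun x hx z hz => ?_
      have h1 := hK₂.dist_le_mul _ hx _ hz
      rw [dist_eq_norm] at h1
      rw [dist_eq_norm, ← sub_apply]
      calc _ ≤ ‖(A₂ x).inverse - (A₂ z).inverse‖ * ‖A₂ (c t) w‖ :=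
            ContinuousLinearMap.le_opNorm _ _
        _ ≤ (K₂ * dist x z) * (‖A₂ (c t₀) w‖ + 1) := by gcongr
        _ = _ := by
          rw [NNReal.coe_mul, Real.coe_toNNReal _ (by positivity)]
          ring
    · intro t ht
      have h1 := hus ht
      exact ContinuousAt.comp_continuousWithinAt (g := ψ) (f := fun t => h (γ t))
        (ψ.continuousAt h1.1.1) ((hhγ t h1.2).mono fun z hz => (hus hz).2)
    · intro t ht
      have h1 := hus (Ico_subset_Icc_self ht)
      have h0t : t ∈ Icc (0 : ℝ) 1 := hsub h1.2
      have ht1 : t < 1 :=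
        ht.2.trans_le (((hus (right_mem_Icc.2 hu.le)).2.2).trans hT.2)
      have hd : HasDerivWithinAt α (Ψ (c t, α t) w) (Ici t) t := by
        refine (hα t h0t).2.mono_of_mem_nhdsWithin ?_
        filter_upwards [Icc_mem_nhdsGE ht1] with z hz using ⟨h0t.1.trans hz.1, hz.2⟩
      have hp : PreservesFormAt mcForm θ (fun z => h (g₀ * z)) (χ.symm (α t)) :=
        PreservesFormAt.comp (h := fun z => g₀ * z) (k := h) (hh _ (hTW t h1.2))
          (preservesFormAt_mul_left g₀ _)
      have hf := hp.hasFDerivAt hθ (x₀ := 1) (y₀ := b₁) (χ.map_target (hαt t h0t)) h1.1.1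
      rw [← hχ, χ.right_inv (hαt t h0t)] at hf
      have hd2 := hf.comp_hasDerivWithinAt t hd
      refine hd2.congr_deriv ?_
      have := hmc.coordForm_inverse (hαt t h0t) (A₂ (c t) w)
      exact congrArg (A₂ (ψ (h (γ t)))).inverse this
    · exact fun t ht => (hus (Ico_subset_Icc_self ht)).1.2.1
    · exact hcc.continuousOn
    · intro t ht
      have h0t : t ∈ Icc (0 : ℝ) 1 := hsub (hus (Ico_subset_Icc_self ht)).2
      rw [hθ.inverse_coordForm (hct t h0t)]
      have : HasDerivAt c w t := by
        have h1 := ((hasDerivAt_id t).smul_const w).const_add x₀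
        rwa [one_smul] at h1
      exact this.hasDerivWithinAt
    · exact fun t ht => (hus (Ico_subset_Icc_self ht)).1.2.2.1
  refine ⟨min y u, ?_, lt_min hy hu, min_le_left _ _⟩
  have hm : min y u ∈ Icc t₀ u := ⟨(lt_min hy hu).le, min_le_right _ _⟩
  have h1 := hus hm
  have h2 : ψ (h (γ (min y u))) = c (min y u) := hequ hm
  show h (γ (min y u)) = ψ.symm (c (min y u))
  rw [← h2, ψ.left_inv h1.1.1]

end Development

/-! ### Extension across a subgroup of codimension two -/

section APriori

open Set

variable {E : Type*} [NormedAddCommGroup E] [NormedSpace ℝ E]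
  {EN : Type*} [NormedAddCommGroup EN] [NormedSpace ℝ EN] [FiniteDimensional ℝ EN]
  {N : Type*} [TopologicalSpace N] [T2Space N]

/-- A priori bound: along a short segment in the domain, a solution `ψ ∘ H` of `df = Φ(u, f)` stays
in the range of the chart `ψ`. -/
theorem mem_image_closedBall_of_segment {H : E → N} {ψ : OpenPartialHomeomorph N EN}
    {Φ : E × EN → E →L[ℝ] EN} {D : Set E} (hHc : ∀ u ∈ D, ContinuousAt H u)
    (hH : ∀ u ∈ D, H u ∈ ψ.source → HasFDerivAt (fun u => ψ (H u)) (Φ (u, ψ (H u))) u)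
    {x₁ : EN} {ρ C : ℝ} (hC0 : 0 ≤ C) (hρt : Metric.closedBall x₁ ρ ⊆ ψ.target)
    (hC : ∀ u ∈ D, ∀ x ∈ Metric.closedBall x₁ ρ, ‖Φ (u, x)‖ ≤ C)
    {y z : E} (hyz : segment ℝ y z ⊆ D) (hys : H y ∈ ψ.source)
    (hy : dist (ψ (H y)) x₁ + C * ‖z - y‖ < ρ) :
    H z ∈ ψ.symm '' Metric.closedBall x₁ ρ := by
  set c : ℝ → E := fun t => y + t • (z - y) with hc
  have hcc : Continuous c := by fun_prop
  have hcD : ∀ t ∈ Icc (0 : ℝ) 1, c t ∈ D := fun t ht =>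
    hyz (by rw [segment_eq_image']; exact ⟨t, ht, rfl⟩)
  have hc0 : c 0 = y := by simp [hc]
  have hc1 : c 1 = z := by simp [hc]
  have hcd : ∀ t, HasDerivAt c (z - y) t := fun t => by
    have h1 := ((hasDerivAt_id t).smul_const (z - y)).const_add y
    rwa [one_smul] at h1
  set Kb := ψ.symm '' Metric.closedBall x₁ ρ with hKb
  have hKb : IsClosed Kb :=
    ((isCompact_closedBall x₁ ρ).image_of_continuousOn
      (ψ.continuousOn_symm.mono hρt)).isClosed
  have hKs : ∀ b ∈ Kb, b ∈ ψ.source ∧ ψ b ∈ Metric.closedBall x₁ ρ := by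
    rintro _ ⟨x, hx, rfl⟩
    exact ⟨ψ.map_target (hρt hx), by rwa [ψ.right_inv (hρt hx)]⟩
  have hHc' : ContinuousOn (fun t => H (c t)) (Icc 0 1) := fun t ht =>
    (ContinuousAt.comp (g := H) (hHc _ (hcD t ht)) hcc.continuousAt).continuousWithinAt
  set T₀ := Icc (0 : ℝ) 1 ∩ (fun t => H (c t)) ⁻¹' Kb with hT₀
  have hT₀c : IsClosed T₀ := hHc'.preimage_isClosed_of_isClosed isClosed_Icc hKb
  have hψc : ContinuousOn (fun t => ψ (H (c t))) T₀ := fun t ht =>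
    ContinuousAt.comp_continuousWithinAt (g := ψ) (f := fun t => H (c t))
      (ψ.continuousAt (hKs _ ht.2).1) ((hHc' t ht.1).mono inter_subset_left)
  set S := {t ∈ T₀ | dist (ψ (H (c t))) (ψ (H y)) ≤ C * ‖z - y‖ * t} with hS
  have hSc : IsClosed S := by
    refine hT₀c.isClosed_le (fun t ht => ?_) (by fun_prop)
    exact Filter.Tendsto.dist (hψc t ht) tendsto_const_nhds
  have hfin : Icc (0 : ℝ) 1 ⊆ S := by
    refine IsClosed.Icc_subset_of_forall_exists_gt
      (by rwa [inter_eq_left.2 fun t ht => ht.1.1]) ?_ ?_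
    · refine ⟨⟨⟨le_rfl, zero_le_one⟩, ?_⟩, by simp [hc0]⟩
      simp only [mem_preimage, hc0]
      refine ⟨ψ (H y), ?_, ψ.left_inv hys⟩
      have : 0 ≤ C * ‖z - y‖ := by positivity
      rw [Metric.mem_closedBall]
      linarith
    rintro t₀ ⟨⟨⟨ht₀, ht₀K⟩, ht₀d⟩, ht₀'⟩ t₁ ht₁
    have ht₁ : t₀ < t₁ := ht₁
    have hsrc := (hKs _ ht₀K).1
    have hlt : dist (ψ (H (c t₀))) x₁ < ρ := by
      have h2 := dist_triangle (ψ (H (c t₀))) (ψ (H y)) x₁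
      have h3 : C * ‖z - y‖ * t₀ ≤ C * ‖z - y‖ := mul_le_of_le_one_right (by positivity) ht₀.2
      linarith
    have hcHt : ContinuousAt (fun t => H (c t)) t₀ :=
      ContinuousAt.comp (g := H) (hHc _ (hcD t₀ ht₀)) hcc.continuousAt
    have hψHt : ContinuousAt (fun t => ψ (H (c t))) t₀ :=
      ContinuousAt.comp (g := ψ) (f := fun t => H (c t)) (ψ.continuousAt hsrc) hcHt
    have hev : ∀ᶠ t in 𝓝 t₀, H (c t) ∈ ψ.source ∧ dist (ψ (H (c t))) x₁ < ρ :=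
      (hcHt.eventually_mem (ψ.open_source.mem_nhds hsrc)).and
        ((hψHt.dist continuousAt_const).eventually_lt continuousAt_const hlt)
    obtain ⟨u, hu, hus⟩ := mem_nhdsGE_iff_exists_Icc_subset.1
      (Filter.Eventually.filter_mono (nhdsWithin_le_nhds (s := Ici t₀)) hev)
    have hu : t₀ < u := hu
    set t₂ := min (min t₁ u) 1 with ht₂
    have h02 : t₀ < t₂ := lt_min (lt_min ht₁ hu) ht₀'.2
    have h2u : t₂ ≤ u := (min_le_left _ _).trans (min_le_right _ _)
    have h21 : t₂ ≤ 1 := min_le_right _ _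
    have hI : ∀ t ∈ Icc t₀ t₂, t ∈ Icc (0 : ℝ) 1 ∧ H (c t) ∈ ψ.source ∧
        dist (ψ (H (c t))) x₁ < ρ := fun t ht =>
      ⟨⟨ht₀.1.trans ht.1, ht.2.trans h21⟩, hus ⟨ht.1, ht.2.trans h2u⟩⟩
    have hmv : ‖ψ (H (c t₂)) - ψ (H (c t₀))‖ ≤ C * ‖z - y‖ * ‖t₂ - t₀‖ := by
      refine (convex_Icc t₀ t₂).norm_image_sub_le_of_norm_hasDerivWithin_le
        (f := fun t => ψ (H (c t))) (f' := fun t => Φ (c t, ψ (H (c t))) (z - y))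
        (fun t ht => ?_) (fun t ht => ?_) (left_mem_Icc.2 h02.le) (right_mem_Icc.2 h02.le)
      · exact ((hH _ (hcD t (hI t ht).1) (hI t ht).2.1).comp_hasDerivAt t
          (hcd t)).hasDerivWithinAt
      · refine (ContinuousLinearMap.le_opNorm _ _).trans ?_
        gcongr
        exact hC _ (hcD t (hI t ht).1) _ (hI t ht).2.2.le
    refine ⟨t₂, ⟨⟨(hI t₂ (right_mem_Icc.2 h02.le)).1, ?_⟩, ?_⟩, h02,
      (min_le_left _ _).trans (min_le_left _ _)⟩
    · have := hI t₂ (right_mem_Icc.2 h02.le)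
      exact ⟨ψ (H (c t₂)), this.2.2.le, ψ.left_inv this.2.1⟩
    · rw [← dist_eq_norm, Real.norm_eq_abs, abs_of_pos (by linarith)] at hmv
      have := dist_triangle (ψ (H (c t₂))) (ψ (H (c t₀))) (ψ (H y))
      linarith
  have := (hfin (right_mem_Icc.2 zero_le_one)).1.2
  simpa only [mem_preimage, hc1] using this

end APriori

section Extension

open Set Module

variable {E : Type*} [NormedAddCommGroup E] [NormedSpace ℝ E]
  {G : Type*} [TopologicalSpace G] [ChartedSpace E G] [Group G] [LieGroup 𝓘(ℝ, E) ∞ G]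
  {F : Type*} [NormedAddCommGroup F] [NormedSpace ℝ F]
  {P : Subgroup G} [ChartedSpace F P] [LieGroup 𝓘(ℝ, F) ∞ P] [IsClosedLieSubgroup E F P]
  {EN : Type*} [NormedAddCommGroup EN] [NormedSpace ℝ EN] [FiniteDimensional ℝ EN]
  {N : Type*} [TopologicalSpace N] [ChartedSpace EN N] [IsManifold 𝓘(ℝ, EN) ∞ N] [T2Space N]
  {θ : (x : N) → TangentSpace 𝓘(ℝ, EN) x →L[ℝ] E}

/-- The inclusion of a Lie subgroup, read in the charts at a point. -/
theorem contDiffAt_subgroup_chart (p : P) :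
    ContDiffAt ℝ ∞ (fun q : F => chartAt E (p : G) ((chartAt F p).symm q : P))
      (chartAt F p p) := by
  rw [← contMDiffAt_iff_contDiffAt]
  have h1 : ContMDiffAt 𝓘(ℝ, F) 𝓘(ℝ, F) ∞ (chartAt F p).symm (chartAt F p p) :=
    contMDiffOn_chart_symm.contMDiffAt ((chartAt F p).open_target.mem_nhds
      (mem_chart_target F p))
  have h2 : ContMDiffAt 𝓘(ℝ, F) 𝓘(ℝ, E) ∞ (Subtype.val : P → G) p :=
    IsClosedLieSubgroup.contMDiff_val.contMDiffAt
  have h3 : ContMDiffAt 𝓘(ℝ, E) 𝓘(ℝ, E) ∞ (chartAt E (p : G)) (p : G) :=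
    contMDiffOn_chart.contMDiffAt ((chartAt E (p : G)).open_source.mem_nhds
      (mem_chart_source E _))
  have hp : (chartAt F p).symm (chartAt F p p) = p :=
    (chartAt F p).left_inv (mem_chart_source F p)
  refine ContMDiffAt.comp (chartAt F p p) (g := fun z : P => chartAt E (p : G) (z : G))
    (f := (chartAt F p).symm) ?_ h1
  rw [hp]
  exact h3.comp p h2

variable [FiniteDimensional ℝ E] [FiniteDimensional ℝ F]

/-- In a small chart ball, the complement of a Lie subgroup of codimension at least two is segment
dense: the segments from a given point which meet the subgroup have their endpoints in the image of
a smooth map defined on a space of smaller dimension. -/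
theorem eventually_segmentDense (hdim : finrank ℝ F + 2 ≤ finrank ℝ E) (p : P) :
    ∀ᶠ r in 𝓝[>] (0 : ℝ), SegmentDense
      {u | u ∈ Metric.ball (chartAt E (p : G) p) r ∧ (chartAt E (p : G)).symm u ∉ P}
      (Metric.ball (chartAt E (p : G) p) r) := by
  set χ := chartAt E (p : G) with hχ
  set η := chartAt F p with hη
  set κ : F → E := fun q => χ (η.symm q : P) with hκ
  have hκ1 : ∀ᶠ q in 𝓝 (η p), ContDiffAt ℝ 1 κ q :=
    ((contDiffAt_subgroup_chart (E := E) p).of_le (m := 1) (by simp)).eventually (by simp)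
  obtain ⟨ε, hε, hQ⟩ := Metric.eventually_nhds_iff_ball.1 hκ1
  have hpη : p ∈ η.source := mem_chart_source F p
  have hN : η.source ∩ η ⁻¹' Metric.ball (η p) ε ∈ 𝓝 p :=
    Filter.inter_mem (η.open_source.mem_nhds hpη)
      ((η.continuousAt hpη).preimage_mem_nhds (Metric.ball_mem_nhds _ hε))
  rw [nhds_induced, Filter.mem_comap] at hN
  obtain ⟨O, hO, hOsub⟩ := hN
  have hpχ : (p : G) ∈ χ.source := mem_chart_source E _
  have h1 : ∀ᶠ u in 𝓝 (χ p), u ∈ χ.target ∧ χ.symm u ∈ O := by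
    refine (χ.open_target.eventually_mem (χ.map_source hpχ)).and ?_
    refine (χ.continuousAt_symm (χ.map_source hpχ)).eventually ?_
    rw [χ.left_inv hpχ]
    exact hO
  obtain ⟨ρ, hρ, hball⟩ := Metric.eventually_nhds_iff_ball.1 h1
  filter_upwards [Ioo_mem_nhdsGT hρ] with r hr
  rintro y ⟨hy, hyP⟩
  -- the endpoints of the segments from `y` which meet `P` are in the image of `Θ`
  set Θ : F × ℝ → E := fun a => y + a.2 • (κ a.1 - y) with hΘ
  have hΘs : ContDiffOn ℝ 1 Θ (Metric.ball (η p) ε ×ˢ univ) := by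
    have hκs : ContDiffOn ℝ 1 κ (Metric.ball (η p) ε) := fun q hq =>
      (hQ q hq).contDiffWithinAt
    have hκ2 : ContDiffOn ℝ 1 (fun a : F × ℝ => κ a.1) (Metric.ball (η p) ε ×ˢ univ) :=
      hκs.comp contDiffOn_fst fun a ha => ha.1
    exact contDiffOn_const.add (contDiffOn_snd.smul (hκ2.sub contDiffOn_const))
  have hdense : Dense (Θ '' (Metric.ball (η p) ε ×ˢ univ))ᶜ := by
    refine hΘs.dense_compl_image_of_dimH_lt_finrank ((convex_ball _ _).prod convex_univ)
      Subset.rfl ?_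
    refine (dimH_mono (subset_univ _)).trans_lt ?_
    rw [Real.dimH_univ_eq_finrank, finrank_prod, finrank_self]
    exact_mod_cast (by omega : finrank ℝ F + 1 < finrank ℝ E)
  refine (hdense.open_subset_closure_inter Metric.isOpen_ball).trans (closure_mono ?_)
  rintro z ⟨hz, hzΘ⟩
  have hseg : segment ℝ y z ⊆
      {u | u ∈ Metric.ball (χ p) r ∧ χ.symm u ∉ P} := by
    intro u hu
    have hub : u ∈ Metric.ball (χ p) r := (convex_ball _ _).segment_subset hy hz hu
    refine ⟨hub, fun huP => ?_⟩
    have hub' := hball u (Metric.ball_subset_ball hr.2.le hub)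
    have hq : (⟨χ.symm u, huP⟩ : P) ∈ η.source ∩ η ⁻¹' Metric.ball (η p) ε := hOsub hub'.2
    have hκq : κ (η ⟨χ.symm u, huP⟩) = u := by
      simp only [hκ, η.left_inv hq.1, χ.right_inv hub'.1]
    rw [segment_eq_image'] at hu
    obtain ⟨t, -, rfl⟩ := hu
    have ht : t ≠ 0 := by
      rintro rfl
      simp only [zero_smul, add_zero] at huP
      exact hyP huP
    refine hzΘ ⟨(η ⟨_, huP⟩, t⁻¹), ⟨hq.2, mem_univ _⟩, ?_⟩
    simp only [hΘ, hκq, add_sub_cancel_left, smul_smul, inv_mul_cancel₀ ht, one_smul,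
      add_sub_cancel]
  exact ⟨hseg (right_mem_segment ℝ y z), hseg⟩

/-- Removable singularities: a map which preserves the parallelisms in the complement of a subgroup
of codimension at least two extends across each point of the subgroup where it has a limit along
some filter. -/
theorem exists_extension_at_subgroup (hdim : finrank ℝ F + 2 ≤ finrank ℝ E)
    (hθ : IsParallelism θ) {h : G → N}
    (hh : ∀ g : G, g ∉ P → PreservesFormAt mcForm θ h g) (p : P) {b : N}
    {l : Filter G} [l.NeBot] (hl : l ≤ 𝓝 (p : G)) (hlP : ∀ᶠ g in l, g ∉ P)
    (hlb : Filter.Tendsto h l (𝓝 b)) :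
    ∃ (f : G → N) (O : Set G), IsOpen O ∧ (p : G) ∈ O ∧ ContMDiffOn 𝓘(ℝ, E) 𝓘(ℝ, EN) ∞ f O ∧
      (∀ g ∈ O, PreservesFormAt mcForm θ f g) ∧ (∀ g ∈ O, g ∉ P → f g = h g) ∧ f p = b := by
  have hmc := isParallelism_mcForm (E := E) (G := G)
  set χ := chartAt E (p : G) with hχ
  set ψ := chartAt EN b with hψ
  have hpχ : (p : G) ∈ χ.source := mem_chart_source E _
  have hbs : b ∈ ψ.source := mem_chart_source EN b
  set Φ : E × EN → E →L[ℝ] EN := fun a =>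
    (coordForm θ b a.2).inverse.comp (coordForm mcForm (p : G) a.1) with hΦ
  have hΦs : ContDiffOn ℝ ∞ Φ (χ.target ×ˢ ψ.target) := by
    refine ContDiffOn.clm_comp ?_ ?_
    · exact (hθ.contDiffOn_inverse b).comp contDiffOn_snd fun a ha => ha.2
    · exact (hmc.contDiffOn (p : G)).comp contDiffOn_fst fun a ha => ha.1
  have htgt : χ.target ×ˢ ψ.target ∈ 𝓝 (χ p, ψ b) :=
    (χ.open_target.prod ψ.open_target).mem_nhds ⟨χ.map_source hpχ, ψ.map_source hbs⟩
  set C : ℝ := ‖Φ (χ p, ψ b)‖ + 1 with hC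
  have hC0 : 0 < C := by positivity
  have hbd : ∀ᶠ a in 𝓝 (χ p, ψ b), ‖Φ a‖ < C :=
    (hΦs.continuousOn.continuousAt htgt).norm.eventually_lt continuousAt_const (by simp [hC])
  obtain ⟨ρ, hρ, hball⟩ := Metric.nhds_basis_closedBall.eventually_iff.1
    (hbd.and (Filter.eventually_mem_set.2 htgt))
  rw [← closedBall_prod_same] at hball
  have hρt : Metric.closedBall (ψ b) ρ ⊆ ψ.target := fun x hx =>
    (hball (x := (χ p, x)) ⟨Metric.mem_closedBall_self hρ.le, hx⟩).2.2
  -- the radius is such that a segment in the ball has its image in half the chart ball at `b`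
  obtain ⟨δ, hseg, hδ0, hδ⟩ : ∃ δ, SegmentDense
      {u | u ∈ Metric.ball (χ p) δ ∧ χ.symm u ∉ P} (Metric.ball (χ p) δ) ∧ 0 < δ ∧
      δ < min ρ (ρ / (4 * C)) :=
    ((eventually_segmentDense hdim p).and (Ioo_mem_nhdsGT (by positivity))).exists.imp
      fun δ hδ => ⟨hδ.1, hδ.2.1, hδ.2.2⟩
  set U := Metric.ball (χ p) δ with hU
  set D := {u | u ∈ U ∧ χ.symm u ∉ P} with hD
  have hUt : U ⊆ χ.target := fun u hu =>
    (hball (x := (u, ψ b)) ⟨Metric.ball_subset_closedBall (Metric.ball_subset_ball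
      (hδ.le.trans (min_le_left _ _)) hu), Metric.mem_closedBall_self hρ.le⟩).2.1
  have hUC : ∀ u ∈ U, ∀ x ∈ Metric.closedBall (ψ b) ρ, ‖Φ (u, x)‖ ≤ C := fun u hu x hx =>
    (hball (x := (u, x)) ⟨Metric.ball_subset_closedBall (Metric.ball_subset_ball
      (hδ.le.trans (min_le_left _ _)) hu), hx⟩).1.le
  have hDo : IsOpen D :=
    (χ.continuousOn_symm.mono hUt).isOpen_inter_preimage Metric.isOpen_ball
      (IsClosedLieSubgroup.isClosed E F (P := P)).isOpen_compl
  set H : E → N := fun u => h (χ.symm u) with hH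
  have hHc : ∀ u ∈ D, ContinuousAt H u := fun u hu =>
    ContinuousAt.comp (g := h) (hh _ hu.2).1.continuousAt (χ.continuousAt_symm (hUt hu.1))
  have hHd : ∀ u ∈ D, H u ∈ ψ.source →
      HasFDerivAt (fun u => ψ (H u)) (Φ (u, ψ (H u))) u := by
    intro u hu hus
    have := (hh _ hu.2).hasFDerivAt hθ (x₀ := (p : G)) (y₀ := b) (χ.map_target (hUt hu.1)) hus
    rwa [← hχ, χ.right_inv (hUt hu.1)] at this
  have hlev : ∀ᶠ g in l, g ∈ χ.source ∧ χ g ∈ U :=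
    hl ((χ.open_source.eventually_mem hpχ).and
      ((χ.continuousAt hpχ).eventually_mem (Metric.ball_mem_nhds _ hδ0)))
  have hlev' : ∀ᶠ g in l, h g ∈ ψ.source ∧ dist (ψ (h g)) (ψ b) < ρ / 2 :=
    hlb ((ψ.open_source.eventually_mem hbs).and
      ((ψ.continuousAt hbs).eventually (Metric.ball_mem_nhds _ (by positivity))))
  obtain ⟨g₀, ⟨hg₀s, hg₀U⟩, hg₀P, hg₀b, hg₀d⟩ := (hlev.and (hlP.and hlev')).exists
  have hy₀ : χ g₀ ∈ D := ⟨hg₀U, by rwa [χ.left_inv hg₀s]⟩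
  have hHy₀ : H (χ g₀) = h g₀ := by simp only [hH, χ.left_inv hg₀s]
  have hKb : IsClosed (ψ.symm '' Metric.closedBall (ψ b) ρ) :=
    ((isCompact_closedBall _ ρ).image_of_continuousOn
      (ψ.continuousOn_symm.mono hρt)).isClosed
  have hmem : ∀ z ∈ D, H z ∈ ψ.symm '' Metric.closedBall (ψ b) ρ := by
    intro z hz
    have h1 : ∀ z' ∈ {z' | z' ∈ D ∧ segment ℝ (χ g₀) z' ⊆ D},
        H z' ∈ ψ.symm '' Metric.closedBall (ψ b) ρ := by
      rintro z' ⟨hz', hs⟩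
      refine mem_image_closedBall_of_segment hHc hHd hC0.le hρt (fun u hu => hUC u hu.1) hs
        (by rwa [hHy₀]) ?_
      rw [hHy₀]
      have h2 : ‖z' - χ g₀‖ < 2 * δ := by
        rw [← dist_eq_norm]
        have := dist_triangle_right z' (χ g₀) (χ p)
        have h3 : dist z' (χ p) < δ := hz'.1
        have h4 : dist (χ g₀) (χ p) < δ := hg₀U
        linarith
      have h5 : δ < ρ / (4 * C) := hδ.trans_le (min_le_right _ _)
      rw [lt_div_iff₀ (by positivity)] at h5
      nlinarith
    have h2 := mem_closure_iff_frequently.1 (hseg _ hy₀ hz.1)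
    exact hKb.mem_of_frequently_of_tendsto (h2.mono h1) (hHc z hz)
  have hKs : ∀ b' ∈ ψ.symm '' Metric.closedBall (ψ b) ρ,
      b' ∈ ψ.source ∧ ψ b' ∈ Metric.closedBall (ψ b) ρ := by
    rintro _ ⟨x, hx, rfl⟩
    exact ⟨ψ.map_target (hρt hx), by rwa [ψ.right_inv (hρt hx)]⟩
  obtain ⟨f, hfD, hfK, hfc, hfs, hfd⟩ := hseg.exists_extension (fun u hu => hu.1) ⟨_, hy₀⟩
    Metric.isOpen_ball ψ.open_target Metric.isClosed_closedBall hρt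
    (hΦs.mono (prod_mono_left hUt)) (C := ⟨C, hC0.le⟩) hUC (f := fun u => ψ (H u))
    (fun z hz => (hKs _ (hmem z hz)).2) (fun z hz => hHd z hz (hKs _ (hmem z hz)).1) hDo
  set O := χ.source ∩ χ ⁻¹' U with hO
  have hOo : IsOpen O := χ.isOpen_inter_preimage Metric.isOpen_ball
  have hpO : (p : G) ∈ O := ⟨hpχ, Metric.mem_ball_self hδ0⟩
  have hfs' : ContMDiffOn 𝓘(ℝ, E) 𝓘(ℝ, EN) ∞ (fun g => ψ.symm (f (χ g))) O := by
    have h1 : ContMDiffOn 𝓘(ℝ, E) 𝓘(ℝ, EN) ∞ (fun g => f (χ g)) O :=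
      hfs.contMDiffOn.comp (contMDiffOn_chart.mono inter_subset_left) fun g hg => hg.2
    exact contMDiffOn_chart_symm.comp h1 fun g hg => hρt (hfK hg.2)
  have hfh : ∀ g ∈ O, g ∉ P → ψ.symm (f (χ g)) = h g := by
    intro g hg hgP
    have hgD : χ g ∈ D := ⟨hg.2, by rwa [χ.left_inv hg.1]⟩
    rw [hfD hgD]
    simp only
    rw [ψ.left_inv (hKs _ (hmem _ hgD)).1]
    simp only [hH, χ.left_inv hg.1]
  refine ⟨fun g => ψ.symm (f (χ g)), O, hOo, hpO, hfs', fun g hg => ?_, hfh, ?_⟩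
  · exact preservesFormAt_of_hasFDerivAt hθ hg.1 (hρt (hfK hg.2)) (hfd _ hg.2)
  · have h1 : Filter.Tendsto (fun g => ψ.symm (f (χ g))) l (𝓝 (ψ.symm (f (χ p)))) :=
      (hfs'.continuousOn.continuousAt (hOo.mem_nhds hpO)).tendsto.mono_left hl
    refine tendsto_nhds_unique (h1.congr' ?_) hlb
    filter_upwards [hlev, hlP] with g hg hgP using hfh g hg hgP

end Extension

/-! ### The codimension of a subgroup -/

section Codimension

open Set Module

variable {E : Type*} [NormedAddCommGroup E] [NormedSpace ℝ E]
  {G : Type*} [TopologicalSpace G] [ChartedSpace E G] [Group G] [LieGroup 𝓘(ℝ, E) ∞ G]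
  {F : Type*} [NormedAddCommGroup F] [NormedSpace ℝ F]
  {P : Subgroup G} [ChartedSpace F P] [LieGroup 𝓘(ℝ, F) ∞ P] [IsClosedLieSubgroup E F P]

theorem injective_fderiv_subgroup_chart (p : P) :
    Function.Injective (fderiv ℝ
      (fun q : F => chartAt E (p : G) ((chartAt F p).symm q : P)) (chartAt F p p)) := by
  have hp : (chartAt F p).symm (chartAt F p p) = p :=
    (chartAt F p).left_inv (mem_chart_source F p)
  have d1 := ((mdifferentiable_chart' (EN := F) p).mdifferentiableAt_symm
    (mem_chart_target F p)).hasMFDerivAt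
  have d2 : HasMFDerivAt 𝓘(ℝ, F) 𝓘(ℝ, E) (Subtype.val : P → G) p
      (mfderiv 𝓘(ℝ, F) 𝓘(ℝ, E) (Subtype.val : P → G) p) :=
    ((IsClosedLieSubgroup.contMDiff_val.mdifferentiable (by simp)) p).hasMFDerivAt
  have d3 := ((mdifferentiable_chart' (EN := E) (p : G)).mdifferentiableAt
    (mem_chart_source E (p : G))).hasMFDerivAt
  have d4 := HasMFDerivAt.comp (chartAt F p p)
    (g := fun z : P => chartAt E (p : G) (z : G)) (f := (chartAt F p).symm)
    (by rw [hp]; exact d3.comp p d2) d1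
  rw [hasMFDerivAt_iff_hasFDerivAt] at d4
  have d5 : fderiv ℝ (fun q : F => chartAt E (p : G) ((chartAt F p).symm q : P))
      (chartAt F p p) =
      ((mfderiv 𝓘(ℝ, E) 𝓘(ℝ, E) (chartAt E (p : G)) p : E →L[ℝ] E).comp
        (mfderiv 𝓘(ℝ, F) 𝓘(ℝ, E) (Subtype.val : P → G) p : F →L[ℝ] E)).comp
        (mfderiv 𝓘(ℝ, F) 𝓘(ℝ, F) (chartAt F p).symm (chartAt F p p) : F →L[ℝ] F) :=
    HasFDerivAt.fderiv d4
  rw [d5]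
  exact ((((mdifferentiable_chart' (EN := E) (p : G)).mfderiv_injective
    (mem_chart_source E (p : G))).comp
      (IsClosedLieSubgroup.injective_mfderiv (E := E) p)).comp
    ((mdifferentiable_chart' (EN := F) p).symm.mfderiv_injective (mem_chart_target F p)))

variable [FiniteDimensional ℝ E] [FiniteDimensional ℝ F]

/-- Local slices: near the identity, the cosets of a Lie subgroup `P` are separated by a continuous
map with values in a vector space of dimension `dim G - dim P`. -/
theorem exists_coset_slice : ∃ (W : Submodule ℝ E) (O : Set G) (τ : G → W),
    finrank ℝ W + finrank ℝ F = finrank ℝ E ∧ O ∈ 𝓝 1 ∧ ContinuousOn τ O ∧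
      ∀ g ∈ O, ∀ g' ∈ O, τ g = τ g' → g⁻¹ * g' ∈ P := by
  have hG := topologicalGroup_of_lieGroup 𝓘(ℝ, E) ∞ (G := G)
  set χ := chartAt E ((1 : P) : G) with hχ
  set η := chartAt F (1 : P) with hη
  have h1χ : (1 : G) ∈ χ.source := mem_chart_source E ((1 : P) : G)
  have h1η : (1 : P) ∈ η.source := mem_chart_source F (1 : P)
  set κ : F → E := fun q => χ (η.symm q : P) with hκ
  have hκs : ContDiffAt ℝ ∞ κ (η 1) := contDiffAt_subgroup_chart (E := E) (1 : P)
  set ι : F →L[ℝ] E := fderiv ℝ κ (η 1) with hι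
  have hιi : Function.Injective ι := injective_fderiv_subgroup_chart (E := E) (1 : P)
  obtain ⟨W, hW⟩ := Submodule.exists_isCompl ι.range
  set e : (F × W) ≃ₗ[ℝ] E :=
    ((LinearEquiv.ofInjective ι.toLinearMap hιi).prodCongr (LinearEquiv.refl ℝ W)).trans
      (Submodule.prodEquivOfIsCompl _ W hW) with he
  have hev : ∀ v w, e (v, w) = ι v + w := fun v w => by simp [he]
  have hfr : finrank ℝ W + finrank ℝ F = finrank ℝ E := by
    rw [← e.finrank_eq, finrank_prod, add_comm]
  -- the product of a slice and of `P`, in charts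
  set Ψ : F × W → E := fun a => χ (χ.symm (χ 1 + a.2) * (η.symm a.1 : P)) with hΨ
  set a₀ : F × W := (η 1, 0) with ha₀
  have hη1 : η.symm (η 1) = 1 := η.left_inv h1η
  have hχ1 : χ.symm (χ 1) = 1 := χ.left_inv h1χ
  have hprod : ContMDiffAt 𝓘(ℝ, F × W) 𝓘(ℝ, E) ∞
      (fun a : F × W => χ.symm (χ 1 + a.2) * ((η.symm a.1 : P) : G)) a₀ := by
    refine ContMDiffAt.mul ?_ ?_
    · have h1 : ContMDiffAt 𝓘(ℝ, F × W) 𝓘(ℝ, E) ∞ (fun a : F × W => χ 1 + (a.2 : E)) a₀ :=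
        (contDiff_const.add (W.subtypeL.contDiff.comp contDiff_snd)).contMDiff.contMDiffAt
      refine ContMDiffAt.comp a₀ (g := χ.symm) ?_ h1
      simp only [ha₀, ZeroMemClass.coe_zero, add_zero]
      exact contMDiffOn_chart_symm.contMDiffAt (χ.open_target.mem_nhds (χ.map_source h1χ))
    · have h1 : ContMDiffAt 𝓘(ℝ, F × W) 𝓘(ℝ, F) ∞ (fun a : F × W => a.1) a₀ :=
        contDiff_fst.contMDiff.contMDiffAt
      have h2 : ContMDiffAt 𝓘(ℝ, F) 𝓘(ℝ, F) ∞ η.symm (η 1) :=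
        contMDiffOn_chart_symm.contMDiffAt (η.open_target.mem_nhds (η.map_source h1η))
      exact (IsClosedLieSubgroup.contMDiff_val.contMDiffAt).comp a₀
        (ContMDiffAt.comp a₀ (g := η.symm) h2 h1)
  have hprod0 : χ.symm (χ 1 + a₀.2) * ((η.symm a₀.1 : P) : G) = 1 := by
    simp [ha₀, hη1, hχ1]
  have hΨs : ContDiffAt ℝ ∞ Ψ a₀ := by
    rw [← contMDiffAt_iff_contDiffAt]
    refine ContMDiffAt.comp a₀ (g := χ) ?_ hprod
    rw [hprod0]
    exact contMDiffOn_chart.contMDiffAt (χ.open_source.mem_nhds h1χ)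
  have hΨd := (hΨs.differentiableAt (by simp)).hasFDerivAt
  have hd1 : ∀ v, fderiv ℝ Ψ a₀ (v, 0) = ι v := by
    have h1 : HasFDerivAt (fun q : F => ((q, 0) : F × W)) (ContinuousLinearMap.inl ℝ F W) (η 1) :=
      hasFDerivAt_prodMk_left _ _
    have h2 := hΨd.comp (η 1) h1
    have h3 : Ψ ∘ (fun q : F => ((q, 0) : F × W)) = κ := by
      funext q
      simp [hΨ, hκ, hχ1]
    rw [h3] at h2
    intro v
    rw [hι, h2.fderiv]
    simp
  have hd2 : ∀ w : W, fderiv ℝ Ψ a₀ (0, w) = w := by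
    have h1 : HasFDerivAt (fun w : W => ((η 1, w) : F × W)) (ContinuousLinearMap.inr ℝ F W) 0 :=
      hasFDerivAt_prodMk_right _ _
    have h2 := hΨd.comp (0 : W) h1
    have h4 : HasFDerivAt (fun w : W => χ 1 + (w : E)) W.subtypeL 0 :=
      W.subtypeL.hasFDerivAt.const_add (χ 1)
    have h3 : Ψ ∘ (fun w : W => ((η 1, w) : F × W)) =ᶠ[𝓝 0] fun w : W => χ 1 + (w : E) := by
      have h5 : ∀ᶠ w : W in 𝓝 0, χ 1 + (w : E) ∈ χ.target := by
        refine h4.continuousAt.eventually_mem (χ.open_target.mem_nhds ?_)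
        simpa using χ.map_source h1χ
      filter_upwards [h5] with w hw
      simp [hΨ, hη1, χ.right_inv hw]
    intro w
    have h6 := (h4.congr_of_eventuallyEq h3).unique h2
    have h7 := congrArg (fun T : W →L[ℝ] E => T w) h6
    simpa using h7.symm
  have hΨe : HasFDerivAt Ψ (e.toContinuousLinearEquiv : F × W →L[ℝ] E) a₀ := by
    refine hΨd.congr_fderiv (ContinuousLinearMap.ext fun a => ?_)
    obtain ⟨v, w⟩ := a
    have h1 : ((v, w) : F × W) = (v, 0) + (0, w) := by simp
    calc fderiv ℝ Ψ a₀ (v, w) = ι v + w := by rw [h1, map_add, hd1, hd2]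
      _ = _ := (hev v w).symm
  set Λ := hΨs.toOpenPartialHomeomorph Ψ hΨe (by simp) with hΛ
  have ha₀s : a₀ ∈ Λ.source := hΨs.mem_toOpenPartialHomeomorph_source hΨe (by simp)
  have hΨa₀ : Ψ a₀ = χ 1 := by simp only [hΨ, hprod0]
  have ha₀t : χ 1 ∈ Λ.target := by
    rw [← hΨa₀]
    exact Λ.map_source ha₀s
  have hΛs : Λ.symm (χ 1) = a₀ := by
    rw [← hΨa₀]
    exact Λ.left_inv ha₀s
  have hev1 : ∀ᶠ g in 𝓝 (1 : G), g ∈ χ.source ∧ χ g ∈ Λ.target :=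
    (χ.open_source.eventually_mem h1χ).and
      ((χ.continuousAt h1χ).eventually_mem (Λ.open_target.mem_nhds ha₀t))
  have hev2 : ∀ᶠ g in 𝓝 (1 : G), χ.symm (χ 1 + (Λ.symm (χ g)).2) *
      ((η.symm (Λ.symm (χ g)).1 : P) : G) ∈ χ.source := by
    have h1 : Filter.Tendsto (fun g => Λ.symm (χ g)) (𝓝 1) (𝓝 a₀) := by
      have := (Λ.continuousAt_symm ha₀t).tendsto.comp (χ.continuousAt h1χ).tendsto
      rwa [hΛs] at this
    have h2 := hprod.continuousAt.tendsto.comp h1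
    rw [hprod0] at h2
    exact h2.eventually_mem (χ.open_source.mem_nhds h1χ)
  refine ⟨W, _, fun g => (Λ.symm (χ g)).2, hfr, hev1.and hev2, ?_, ?_⟩
  · rintro g ⟨⟨hg, hg'⟩, -⟩
    have h1 : ContinuousAt (fun g => Λ.symm (χ g)) g :=
      ContinuousAt.comp (g := Λ.symm) (Λ.continuousAt_symm hg') (χ.continuousAt hg)
    exact h1.snd.continuousWithinAt
  · have key : ∀ g : G, (g ∈ χ.source ∧ χ g ∈ Λ.target) ∧ χ.symm (χ 1 + (Λ.symm (χ g)).2) *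
        ((η.symm (Λ.symm (χ g)).1 : P) : G) ∈ χ.source →
        χ.symm (χ 1 + (Λ.symm (χ g)).2) * ((η.symm (Λ.symm (χ g)).1 : P) : G) = g := by
      rintro g ⟨⟨hg1, hg2⟩, hg3⟩
      exact χ.injOn hg3 hg1 (Λ.right_inv hg2)
    intro g hg g' hg' hτ
    have h1 := key g hg
    have h2 := key g' hg'
    simp only at hτ
    rw [← h1, ← h2, hτ]
    have : ∀ s a b : G, (s * a)⁻¹ * (s * b) = a⁻¹ * b := fun s a b => by group
    rw [this]
    exact P.mul_mem (P.inv_mem (η.symm _).2) (η.symm _).2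

/-- A Lie subgroup `P` has codimension at least two in `G` as soon as `G / P` contains the image of
a plane under a continuous injective map which lifts to `G`: otherwise a small circle of the plane
would embed into a line. -/
theorem finrank_add_two_le {c : ℝ × ℝ → G} (hc : Continuous c)
    (hinj : ∀ x y, (c x)⁻¹ * c y ∈ P → x = y) : finrank ℝ F + 2 ≤ finrank ℝ E := by
  have hG := topologicalGroup_of_lieGroup 𝓘(ℝ, E) ∞ (G := G)
  obtain ⟨W, O, τ, hW, hO, hτ, hτP⟩ := exists_coset_slice (E := E) (F := F) (P := P)
  by_contra hlt
  have hW1 : finrank ℝ W ≤ 1 := by omega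
  obtain ⟨ℓ, hℓ⟩ : ∃ ℓ : W →ₗ[ℝ] ℝ, Function.Injective ℓ := by
    obtain ⟨v, hv⟩ := finrank_le_one_iff.1 hW1
    obtain ⟨ℓ, hℓ⟩ := (LinearMap.toSpanSingleton ℝ W v).exists_rightInverse_of_surjective
      (LinearMap.range_eq_top.2 fun w => (hv w).imp fun a ha => ha)
    exact ⟨ℓ, Function.LeftInverse.injective (g := LinearMap.toSpanSingleton ℝ W v)
      fun w => LinearMap.congr_fun hℓ w⟩
  set k : ℝ × ℝ → G := fun x => (c 0)⁻¹ * c x with hk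
  have hkc : Continuous k := continuous_const.mul hc
  have hk0 : k ⁻¹' O ∈ 𝓝 0 := by
    refine hkc.continuousAt.preimage_mem_nhds ?_
    simpa [hk] using hO
  obtain ⟨r, hr, hball⟩ := Metric.nhds_basis_closedBall.mem_iff.1 hk0
  have hsO : ∀ x ∈ Metric.sphere (0 : ℝ × ℝ) r, k x ∈ O := fun x hx =>
    hball (Metric.sphere_subset_closedBall hx)
  set f : ℝ × ℝ → ℝ := fun x => ℓ (τ (k x)) with hf
  have hfc : ContinuousOn f (Metric.sphere 0 r) :=
    (LinearMap.continuous_of_finiteDimensional ℓ).comp_continuousOn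
      (hτ.comp hkc.continuousOn hsO)
  have hneg : ∀ x ∈ Metric.sphere (0 : ℝ × ℝ) r, -x ∈ Metric.sphere (0 : ℝ × ℝ) r := fun x hx => by
    simpa using hx
  have hfc' : ContinuousOn (fun x => f (-x)) (Metric.sphere 0 r) :=
    hfc.comp continuous_neg.continuousOn hneg
  have hconn : IsPreconnected (Metric.sphere (0 : ℝ × ℝ) r) :=
    isPreconnected_sphere (by simp [one_add_one_eq_two]) 0 r
  have hx₀ : ((r, 0) : ℝ × ℝ) ∈ Metric.sphere (0 : ℝ × ℝ) r := by
    simp [Prod.norm_def, abs_of_pos hr, hr.le]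
  -- antipodal points at which `f` agrees, by the intermediate value theorem
  obtain ⟨x, hx, hfx⟩ : ∃ x ∈ Metric.sphere (0 : ℝ × ℝ) r, f x = f (-x) := by
    rcases le_total (f (r, 0)) (f (-(r, 0))) with h | h
    · exact hconn.intermediate_value₂ hx₀ (hneg _ hx₀) hfc hfc' h (by simpa using h)
    · exact hconn.intermediate_value₂ (hneg _ hx₀) hx₀ hfc hfc' (by simpa using h) h
  have h1 := hτP _ (hsO x hx) _ (hsO _ (hneg x hx)) (hℓ hfx)
  have h2 : (k x)⁻¹ * k (-x) = (c x)⁻¹ * c (-x) := by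
    simp only [hk]
    group
  rw [h2] at h1
  have h3 : x = 0 := self_eq_neg.1 (hinj _ _ h1)
  subst h3
  simp at hx
  linarith

end Codimension

/-! ### The principal bundle of a Cartan geometry -/

section PrincipalBundle

open Set

variable {E : Type*} [NormedAddCommGroup E] [NormedSpace ℝ E]
  {F : Type*} [NormedAddCommGroup F] [NormedSpace ℝ F]
  {G : Type*} [TopologicalSpace G] [ChartedSpace E G] [Group G]
  {P : Subgroup G} [ChartedSpace F P]
  {EM : Type*} [NormedAddCommGroup EM] [NormedSpace ℝ EM]
  {M : Type*} [TopologicalSpace M] [ChartedSpace EM M]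
  {EB : Type*} [NormedAddCommGroup EB] [NormedSpace ℝ EB]
  {B : Type*} [TopologicalSpace B] [ChartedSpace EB B] [IsManifold 𝓘(ℝ, EB) ∞ B]

namespace CartanGeometry

variable (C : CartanGeometry E F P EM M EB B)

/-- The Cartan connection, with its values regarded as elements of the model space `E`. -/
def connection (b : B) : TangentSpace 𝓘(ℝ, EB) b →L[ℝ] E := C.form b

theorem isParallelism [FiniteDimensional ℝ EB] : IsParallelism C.connection :=
  ⟨contDiffOn_coordForm_of_contMDiff C.contMDiff_form, C.form_bijective⟩

/-- The part of local triviality which does not involve smoothness. -/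
theorem exists_trivialization (x : M) : ∃ e : OpenPartialHomeomorph B (M × P),
    (∀ b, C.proj b = x → b ∈ e.source) ∧ ({x} ×ˢ univ ⊆ e.target) ∧
    (∀ b ∈ e.source, ∀ p, C.act b p ∈ e.source) ∧
    ∀ b ∈ e.source, (e b).1 = C.proj b ∧ ∀ p : P, e (C.act b p) = ((e b).1, (e b).2 * p) := by
  obtain ⟨U, e, -, hx, hs, ht, -, -, he⟩ := C.locally_trivial x
  refine ⟨e, fun b hb => ?_, ?_, fun b hb p => ?_, he⟩
  · rw [hs, mem_preimage, hb]
    exact hx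
  · rw [ht]
    exact prod_mono (singleton_subset_iff.2 hx) subset_rfl
  · rw [hs] at hb ⊢
    rw [mem_preimage, C.proj_act]
    exact hb

theorem proj_surjective : Function.Surjective C.proj := fun x => by
  obtain ⟨e, -, ht, -, he⟩ := C.exists_trivialization x
  have hx : ((x, 1) : M × P) ∈ e.target := ht ⟨rfl, mem_univ _⟩
  refine ⟨e.symm (x, 1), ?_⟩
  rw [← (he _ (e.map_target hx)).1, e.right_inv hx]

theorem nhds_le_map_proj (b : B) : 𝓝 (C.proj b) ≤ Filter.map C.proj (𝓝 b) := by
  obtain ⟨e, hs, -, -, he⟩ := C.exists_trivialization (C.proj b)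
  have hb := hs b rfl
  have h1 : C.proj =ᶠ[𝓝 b] Prod.fst ∘ e := by
    filter_upwards [e.open_source.mem_nhds hb] with a ha
    exact (he a ha).1.symm
  rw [Filter.map_congr h1, ← Filter.map_map, e.map_nhds_eq hb, map_fst_nhds, (he b hb).1]

theorem isOpenMap_proj : IsOpenMap C.proj := IsOpenMap.of_nhds_le C.nhds_le_map_proj

theorem act_eq_self {b : B} {p : P} (h : C.act b p = b) : p = 1 := by
  obtain ⟨e, hs, -, -, he⟩ := C.exists_trivialization (C.proj b)
  have h1 := congrArg Prod.snd ((he b (hs b rfl)).2 p)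
  rw [h] at h1
  exact left_eq_mul.1 h1

theorem exists_act_eq {b b' : B} (h : C.proj b = C.proj b') : ∃ p, C.act b p = b' := by
  obtain ⟨e, hs, -, ha, he⟩ := C.exists_trivialization (C.proj b)
  have hb := hs b rfl
  have hb' := hs b' h.symm
  refine ⟨(e b).2⁻¹ * (e b').2, e.injOn (ha b hb _) hb' ?_⟩
  rw [(he b hb).2, mul_inv_cancel_left, (he b hb).1, h, ← (he b' hb').1]

theorem continuous_act [ContinuousMul P] (p : P) : Continuous fun b => C.act b p := by
  refine continuous_iff_continuousAt.2 fun b => ?_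
  obtain ⟨e, hs, -, ha, he⟩ := C.exists_trivialization (C.proj b)
  have hb := hs b rfl
  have h1 : (fun b => C.act b p) =ᶠ[𝓝 b] fun b => e.symm ((e b).1, (e b).2 * p) := by
    filter_upwards [e.open_source.mem_nhds hb] with a haa
    rw [← (he a haa).2, e.left_inv (ha a haa p)]
  refine ContinuousAt.congr ?_ h1.symm
  have h2 : ((e b).1, (e b).2 * p) ∈ e.target := by
    rw [← (he b hb).2]
    exact e.map_source (ha b hb p)
  have h3 := e.continuousAt hb
  exact ContinuousAt.comp (g := e.symm) (f := fun b => ((e b).1, (e b).2 * p))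
    (e.continuousAt_symm h2) (h3.fst.prodMk (h3.snd.mul_const p))

theorem t2Space (C : CartanGeometry E F P EM M EB B) [T2Space M] [T2Space P] : T2Space B := by
  refine t2Space_iff_disjoint_nhds.2 fun b b' hne => ?_
  by_cases h : C.proj b = C.proj b'
  · obtain ⟨e, hs, -, -, -⟩ := C.exists_trivialization (C.proj b)
    have hb := hs b rfl
    have hb' := hs b' h.symm
    exact (e.continuousAt hb).tendsto.disjoint
      (disjoint_nhds_nhds.2 fun he => hne (e.injOn hb hb' he)) (e.continuousAt hb').tendsto
  · exact (C.contMDiff_proj.continuous.tendsto b).disjoint (disjoint_nhds_nhds.2 h)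
      (C.contMDiff_proj.continuous.tendsto b')

/-- The base being connected, a clopen union of fibres is everything. -/
theorem eq_univ_of_isClopen [ConnectedSpace M] {S : Set B} (hS : IsClopen S) (hne : S.Nonempty)
    (hact : ∀ b ∈ S, ∀ p, C.act b p ∈ S) : S = univ := by
  have hcompl : C.proj '' Sᶜ = (C.proj '' S)ᶜ := by
    ext x
    constructor
    · rintro ⟨b, hb, rfl⟩ ⟨b', hb', h⟩
      obtain ⟨p, rfl⟩ := C.exists_act_eq h
      exact hb (hact b' hb' p)
    · intro hx
      obtain ⟨b, rfl⟩ := C.proj_surjective x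
      exact ⟨b, fun hb => hx ⟨b, hb, rfl⟩, rfl⟩
  have h1 : IsClopen (C.proj '' S) :=
    ⟨⟨hcompl ▸ C.isOpenMap_proj _ hS.compl.isOpen⟩, C.isOpenMap_proj _ hS.isOpen⟩
  have h2 := h1.eq_univ (hne.image _)
  rw [h2, compl_univ, image_eq_empty, compl_empty_iff] at hcompl
  exact hcompl

end CartanGeometry

end PrincipalBundle

/-! ### The Klein geometry, lifted to the group -/

section Opens

variable {E : Type*} [NormedAddCommGroup E] [NormedSpace ℝ E]
  {N : Type*} [TopologicalSpace N] [ChartedSpace E N]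

theorem surjective_mfderiv_subtype_val {U : TopologicalSpace.Opens N} (x : U) :
    Function.Surjective (mfderiv 𝓘(ℝ, E) 𝓘(ℝ, E) (Subtype.val : U → N) x : E →L[ℝ] E) := by
  classical
  set s : N → U := fun y => if hy : y ∈ U then ⟨y, hy⟩ else x with hs
  have hsx : s x = x := by simp [hs]
  have hss : s ∘ Subtype.val = id := by
    funext y
    simp [hs]
  have h1 : ContMDiffAt 𝓘(ℝ, E) 𝓘(ℝ, E) ∞ s (x : N) := by
    rw [← contMDiffAt_subtype_iff]
    exact (contMDiff_id (I := 𝓘(ℝ, E)) (M := U)).contMDiffAt.congr_of_eventuallyEq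
      (Filter.Eventually.of_forall (congrFun hss))
  have h2 : MDifferentiableAt 𝓘(ℝ, E) 𝓘(ℝ, E) (Subtype.val : U → N) x :=
    (contMDiff_subtype_val (n := ∞)).mdifferentiable (by simp) x
  have h3 : Subtype.val ∘ s =ᶠ[𝓝 (x : N)] id := by
    filter_upwards [U.isOpen.mem_nhds x.2] with y hy
    have : y ∈ U := hy
    simp [hs, this]
  have h4 := mfderiv_comp_of_eq (x := (x : N)) (y := x) h2 (h1.mdifferentiableAt (by simp)) hsx
  rw [h3.mfderiv_eq, mfderiv_id, hsx] at h4
  exact fun v => ⟨_, (congrArg (fun T : E →L[ℝ] E => T v) h4).symm⟩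

end Opens

section KleinMap

open Set KleinBundle

variable {E : Type*} [NormedAddCommGroup E] [NormedSpace ℝ E]
  {G : Type*} [TopologicalSpace G] [ChartedSpace E G] [Group G]
  {F : Type*} [NormedAddCommGroup F] [NormedSpace ℝ F]
  {P : Subgroup G} [ChartedSpace F P] [IsClosedLieSubgroup E F P]
  {Γ : Subgroup P}
  {EM : Type*} [NormedAddCommGroup EM] [NormedSpace ℝ EM]
  {M : Type*} [TopologicalSpace M] [ChartedSpace EM M]
  {EB : Type*} [NormedAddCommGroup EB] [NormedSpace ℝ EB]
  {B : Type*} [TopologicalSpace B] [ChartedSpace EB B] [IsManifold 𝓘(ℝ, EB) ∞ B]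

/-- The quotient map `G \ P → Γ \ (G \ P)`, with the junk value `y₀` on `P`. -/
def kleinMap (y₀ : KleinBundle E F Γ) : G → KleinBundle E F Γ :=
  Function.extend (Subtype.val : bundleOmega E F P → G) (mk Γ) fun _ => y₀

variable (y₀ : KleinBundle E F Γ)

theorem kleinMap_val (x : bundleOmega E F P) : kleinMap y₀ (x : G) = mk Γ x :=
  Subtype.val_injective.extend_apply _ _ x

theorem exists_kleinMap_eq (y : KleinBundle E F Γ) : ∃ g ∉ P, kleinMap y₀ g = y := by
  obtain ⟨x, rfl⟩ := mk_surjective Γ y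
  exact ⟨x, x.2, kleinMap_val y₀ x⟩

theorem kleinMap_eq_iff {g g' : G} (hg : g ∉ P) (hg' : g' ∉ P) :
    kleinMap y₀ g = kleinMap y₀ g' ↔ ∃ γ : Γ, ((γ : P) : G) * g' = g := by
  have h1 := kleinMap_val y₀ (⟨g, hg⟩ : bundleOmega E F P)
  have h2 := kleinMap_val y₀ (⟨g', hg'⟩ : bundleOmega E F P)
  dsimp only at h1 h2
  rw [h1, h2, mk_eq_mk]
  exact exists_congr fun γ => Subtype.ext_iff

variable [LieGroup 𝓘(ℝ, E) ∞ G] [DiscreteTopology Γ]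

/-- The form of the Klein geometry, with its values regarded as elements of the model space `E`. -/
def kleinForm (y : KleinBundle E F Γ) : TangentSpace 𝓘(ℝ, E) y →L[ℝ] E :=
  (kleinGeometry (E := E) (F := F) Γ).form y

theorem kleinMap_mul {g : G} (hg : g ∉ P) (p : P) :
    kleinMap y₀ (g * p) = (kleinGeometry (E := E) (F := F) Γ).act (kleinMap y₀ g) p := by
  have h1 := kleinMap_val y₀ (⟨g, hg⟩ : bundleOmega E F P)
  have h2 := kleinMap_val y₀
    (⟨g * p, fun h => hg ((P.mul_mem_cancel_right p.2).1 h)⟩ : bundleOmega E F P)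
  dsimp only at h1 h2
  rw [h1, h2]
  rfl

theorem contMDiffAt_kleinMap {g : G} (hg : g ∉ P) :
    ContMDiffAt 𝓘(ℝ, E) 𝓘(ℝ, E) ∞ (kleinMap y₀) g := by
  refine (contMDiffAt_subtype_iff (U := bundleOmega E F P) (x := ⟨g, hg⟩)).1 ?_
  exact (contMDiff_mk Γ).contMDiffAt.congr_of_eventuallyEq
    (Filter.Eventually.of_forall (kleinMap_val y₀))

theorem preservesFormAt_kleinMap {g : G} (hg : g ∉ P) :
    PreservesFormAt mcForm (kleinForm (Γ := Γ)) (kleinMap y₀) g := by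
  set x : bundleOmega E F P := ⟨g, hg⟩ with hx
  have h1 := (contMDiffAt_kleinMap y₀ hg).mdifferentiableAt (by simp)
  have h2 : MDifferentiableAt 𝓘(ℝ, E) 𝓘(ℝ, E) (Subtype.val : bundleOmega E F P → G) x :=
    (contMDiff_subtype_val (n := ∞)).mdifferentiable (by simp) x
  refine ⟨h1, fun v => ?_⟩
  obtain ⟨w, rfl⟩ := surjective_mfderiv_subtype_val x v
  have h3 := mfderiv_comp x h1 h2
  have h4 : kleinMap y₀ ∘ Subtype.val = mk Γ := funext (kleinMap_val y₀)
  rw [h4] at h3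
  have h5 := kleinGeometry_form_mk Γ x w
  have h6 : kleinMap y₀ g = mk Γ x := kleinMap_val y₀ x
  refine Eq.trans ?_ h5
  rw [h6]
  exact congrArg (fun T : E →L[ℝ] E => (kleinForm (mk Γ x) : E →L[ℝ] E) (T w)) h3.symm

theorem nhds_le_map_kleinMap {g : G} (hg : g ∉ P) :
    𝓝 (kleinMap y₀ g) ≤ Filter.map (kleinMap y₀) (𝓝 g) := by
  set x : bundleOmega E F P := ⟨g, hg⟩ with hx
  have h1 := (isLocalHomeomorph_mk (E := E) (F := F) Γ).isOpenMap.nhds_le x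
  have h4 : mk Γ = kleinMap y₀ ∘ Subtype.val := (funext (kleinMap_val y₀)).symm
  rw [h4, ← Filter.map_map] at h1
  exact h1.trans (Filter.map_mono continuous_subtype_val.continuousAt)

variable {C : CartanGeometry E F P EM M EB B} {σ : KleinBase Γ → M}
  {φ : KleinBundle E F Γ → B}

theorem IsGeometricLift.preservesFormAt
    (hφ : IsGeometricLift (kleinGeometry (E := E) (F := F) Γ) C.toCartanData σ φ)
    {g : G} (hg : g ∉ P) :
    PreservesFormAt mcForm C.connection (φ ∘ kleinMap y₀) g :=
  PreservesFormAt.comp (θ' := kleinForm)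
    ⟨hφ.contMDiff.mdifferentiable (by simp) _, hφ.pullback_form _⟩ (preservesFormAt_kleinMap y₀ hg)

theorem IsGeometricLift.contMDiffAt
    (hφ : IsGeometricLift (kleinGeometry (E := E) (F := F) Γ) C.toCartanData σ φ)
    {g : G} (hg : g ∉ P) : ContMDiffAt 𝓘(ℝ, E) 𝓘(ℝ, EB) ∞ (φ ∘ kleinMap y₀) g :=
  hφ.contMDiff.contMDiffAt.comp g (contMDiffAt_kleinMap y₀ hg)

theorem IsGeometricLift.map_mul
    (hφ : IsGeometricLift (kleinGeometry (E := E) (F := F) Γ) C.toCartanData σ φ)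
    {g : G} (hg : g ∉ P) (p : P) :
    φ (kleinMap y₀ (g * p)) = C.act (φ (kleinMap y₀ g)) p := by
  rw [kleinMap_mul y₀ hg, hφ.map_act]

theorem kleinGeometry_proj_surjective :
    Function.Surjective (kleinGeometry (E := E) (F := F) Γ).proj := by
  rintro ⟨⟨⟨g⟩, hx⟩⟩
  refine ⟨mk Γ ⟨g, fun hg => hx ?_⟩, rfl⟩
  refine (QuotientGroup.eq.2 ?_).symm
  simpa using hg

/-- A geometric embedding with a bijective lift is a geometric isomorphism. -/
theorem IsGeometricLift.isGeometricIso [FiniteDimensional ℝ E] [FiniteDimensional ℝ EB]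
    (hφ : IsGeometricLift (kleinGeometry (E := E) (F := F) Γ) C.toCartanData σ φ)
    (hφb : Function.Bijective φ) :
    IsGeometricIso (kleinGeometry (E := E) (F := F) Γ) C.toCartanData σ := by
  refine ⟨⟨fun n n' hn => ?_, fun x => ?_⟩, ?_⟩
  · obtain ⟨y, rfl⟩ := kleinGeometry_proj_surjective (E := E) (F := F) n
    obtain ⟨y', rfl⟩ := kleinGeometry_proj_surjective (E := E) (F := F) n'
    rw [← hφ.proj_comp, ← hφ.proj_comp] at hn
    obtain ⟨p, hp⟩ := C.exists_act_eq hn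
    rw [← hφ.map_act] at hp
    rw [← hφb.1 hp]
    obtain ⟨x, rfl⟩ := mk_surjective Γ y
    refine congrArg (Quotient.mk _) (Subtype.ext ?_)
    refine QuotientGroup.eq.2 ?_
    simp
  · obtain ⟨b, rfl⟩ := C.proj_surjective x
    obtain ⟨y, rfl⟩ := hφb.2 b
    exact ⟨_, (hφ.proj_comp y).symm⟩
  · refine ⟨⟨Equiv.ofBijective φ hφb, hφ.contMDiff, fun b => ?_⟩, hφ⟩
    obtain ⟨y, rfl⟩ := hφb.2 b
    obtain ⟨g, hg, hgy⟩ := exists_kleinMap_eq y y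
    obtain ⟨k, hk1, hk2, hk3⟩ := (hφ.preservesFormAt y hg).exists_localInverse
      isParallelism_mcForm C.isParallelism (hφ.contMDiffAt y hg)
    have h1 : ContMDiffAt 𝓘(ℝ, EB) 𝓘(ℝ, E) ∞ (kleinMap y ∘ k) ((φ ∘ kleinMap y) g) := by
      refine ContMDiffAt.comp _ (g := kleinMap y) ?_ hk2
      rw [hk1]
      exact contMDiffAt_kleinMap y hg
    have h2 : (φ ∘ kleinMap y) g = φ y := congrArg φ hgy
    rw [h2] at h1 hk3
    refine h1.congr_of_eventuallyEq ?_
    filter_upwards [hk3] with b hb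
    exact (Equiv.symm_apply_eq _).2 hb.symm

end KleinMap

/-! ### Extension of the lift of a geometric embedding -/

section Rigidity

open Set KleinBundle Module Filter

variable {E : Type*} [NormedAddCommGroup E] [NormedSpace ℝ E]
  {G : Type*} [TopologicalSpace G] [ChartedSpace E G] [Group G]
  {F : Type*} [NormedAddCommGroup F] [NormedSpace ℝ F]
  {P : Subgroup G} [ChartedSpace F P] [IsClosedLieSubgroup E F P] {Γ : Subgroup P}
  {EM : Type*} [NormedAddCommGroup EM] [NormedSpace ℝ EM]
  {M : Type*} [TopologicalSpace M] [ChartedSpace EM M]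
  {EB : Type*} [NormedAddCommGroup EB] [NormedSpace ℝ EB]
  {B : Type*} [TopologicalSpace B] [ChartedSpace EB B] [IsManifold 𝓘(ℝ, EB) ∞ B]
  {C : CartanGeometry E F P EM M EB B} {σ : KleinBase Γ → M}
  {φ : KleinBundle E F Γ → B} (y₀ : KleinBundle E F Γ)

open Classical in
/-- The extension of a lift to the whole of `G`, equal to `p ↦ b p` on `P`. -/
def extendedLift (C : CartanGeometry E F P EM M EB B) (φ : KleinBundle E F Γ → B)
    (y₀ : KleinBundle E F Γ) (b : B) (g : G) : B :=
  if hg : g ∈ P then C.act b ⟨g, hg⟩ else φ (kleinMap y₀ g)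

theorem extendedLift_coe (b : B) (p : P) : extendedLift C φ y₀ b p = C.act b p := by
  simp [extendedLift]

theorem extendedLift_of_notMem (b : B) {g : G} (hg : g ∉ P) :
    extendedLift C φ y₀ b g = φ (kleinMap y₀ g) := by
  simp [extendedLift, hg]

variable [LieGroup 𝓘(ℝ, E) ∞ G] [DiscreteTopology Γ]

/-- If a curve `γ` in `G \ P` tends to a point of `P`, then its image in `Γ \ (G \ P)` has no limit,
because `P` is closed and contains `Γ`. -/
theorem not_tendsto_kleinMap {ι : Type*} {l : Filter ι} [l.NeBot] {γ : ι → G} {p : G} (hp : p ∈ P)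
    (hγ : Tendsto γ l (𝓝 p)) (hγP : ∀ᶠ t in l, γ t ∉ P) {g : G} (hg : g ∉ P) :
    ¬ Tendsto (fun t => kleinMap y₀ (γ t)) l (𝓝 (kleinMap y₀ g)) := by
  intro hlim
  have hG := topologicalGroup_of_lieGroup 𝓘(ℝ, E) ∞ (G := G)
  have hcl : IsClosed (P : Set G) := IsClosedLieSubgroup.isClosed E F
  have h1 : Tendsto (fun x : G × G => x.1 * x.2⁻¹) (𝓝 g ×ˢ 𝓝 p) (𝓝 (g * p⁻¹)) := by
    rw [← nhds_prod_eq]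
    exact (continuous_fst.mul continuous_snd.inv).tendsto (g, p)
  have h2 : (P : Set G)ᶜ ∈ 𝓝 (g * p⁻¹) := hcl.isOpen_compl.mem_nhds fun h =>
    hg ((P.mul_mem_cancel_right (P.inv_mem hp)).1 h)
  obtain ⟨U, hU, V, hV, hUV⟩ := mem_prod_iff.1 (h1 h2)
  have h3 : kleinMap y₀ '' (U ∩ (P : Set G)ᶜ) ∈ 𝓝 (kleinMap y₀ g) :=
    nhds_le_map_kleinMap y₀ hg (image_mem_map (inter_mem hU (hcl.isOpen_compl.mem_nhds hg)))
  obtain ⟨t, ⟨u, ⟨hu, huP⟩, hut⟩, htV, htP⟩ :=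
    ((hlim.eventually h3).and ((hγ.eventually hV).and hγP)).exists
  obtain ⟨a, ha⟩ := (kleinMap_eq_iff y₀ huP htP).1 hut
  refine hUV (mk_mem_prod hu htV) ?_
  change u * (γ t)⁻¹ ∈ P
  rw [← ha, mul_inv_cancel_right]
  exact (a : P).2

theorem IsGeometricLift.extendedLift_mul
    (hφ : IsGeometricLift (kleinGeometry (E := E) (F := F) Γ) C.toCartanData σ φ) (b : B) (g : G)
    (p : P) : extendedLift C φ y₀ b (g * p) = C.act (extendedLift C φ y₀ b g) p := by
  by_cases hg : g ∈ P
  · have h1 := extendedLift_coe (C := C) (φ := φ) y₀ b (⟨g, hg⟩ * p)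
    have h2 := extendedLift_coe (C := C) (φ := φ) y₀ b ⟨g, hg⟩
    exact (h1.trans (C.act_mul _ _ _)).trans (congrArg (C.act · p) h2.symm)
  · rw [extendedLift_of_notMem y₀ b hg, ← hφ.map_mul y₀ hg,
      extendedLift_of_notMem y₀ b fun h => hg ((P.mul_mem_cancel_right p.2).1 h)]

theorem IsGeometricLift.injective_extendedLift {b : B}
    (hφ : IsGeometricLift (kleinGeometry (E := E) (F := F) Γ) C.toCartanData σ φ)
    (hφi : Function.Injective φ) (hΓ : Γ = ⊥) (hb : b ∉ range φ) :
    Function.Injective (extendedLift C φ y₀ b) := by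
  have hmix : ∀ (p : P) (g : G), g ∉ P →
      extendedLift C φ y₀ b p ≠ extendedLift C φ y₀ b g := fun p g hg h => by
    rw [extendedLift_coe, extendedLift_of_notMem y₀ b hg] at h
    have h1 := congrArg (fun b => C.act b p⁻¹) h
    simp only [← C.act_mul, mul_inv_cancel, C.act_one] at h1
    exact hb ⟨_, (hφ.map_act _ _).trans h1.symm⟩
  intro g g' h
  by_cases hg : g ∈ P <;> by_cases hg' : g' ∈ P
  · have h1 : C.act b ⟨g, hg⟩ = C.act b ⟨g', hg'⟩ := by
      rw [← extendedLift_coe (φ := φ) y₀, ← extendedLift_coe (φ := φ) y₀]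
      exact h
    have h2 := congrArg (fun b => C.act b (⟨g', hg'⟩⁻¹ : P)) h1
    simp only [← C.act_mul, mul_inv_cancel, C.act_one] at h2
    exact congrArg Subtype.val (mul_inv_eq_one.1 (C.act_eq_self h2))
  · exact absurd h (hmix ⟨g, hg⟩ g' hg')
  · exact absurd h.symm (hmix ⟨g', hg'⟩ g hg)
  · rw [extendedLift_of_notMem y₀ b hg, extendedLift_of_notMem y₀ b hg'] at h
    obtain ⟨γ, hγ⟩ := (kleinMap_eq_iff y₀ hg hg').1 (hφi h)
    have h1 : (γ : P) = 1 := Subgroup.mem_bot.1 (hΓ ▸ γ.2)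
    rw [← hγ, h1, OneMemClass.coe_one, one_mul]

variable [FiniteDimensional ℝ E] [FiniteDimensional ℝ EB] [LieGroup 𝓘(ℝ, F) ∞ P]

/-- If the lift of a geometric embedding is not onto, then it has a limit at the identity along some
filter, outside of its image. A boundary point of its image is reached by a curve in `B` whose
development in `G` cannot stay out of `P`; the limit is found at the first time it hits `P`. -/
theorem IsGeometricLift.exists_tendsto [T2Space B] [ConnectedSpace M]
    (hφ : IsGeometricLift (kleinGeometry (E := E) (F := F) Γ) C.toCartanData σ φ)
    (hφe : Topology.IsEmbedding φ) (hφs : ¬ Function.Surjective φ) :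
    ∃ (b : B) (l : Filter G), l.NeBot ∧ l ≤ 𝓝 1 ∧ (∀ᶠ g in l, g ∉ P) ∧
      Tendsto (φ ∘ kleinMap y₀) l (𝓝 b) ∧ b ∉ range φ := by
  have hG := topologicalGroup_of_lieGroup 𝓘(ℝ, E) ∞ (G := G)
  have hP := topologicalGroup_of_lieGroup 𝓘(ℝ, F) ∞ (G := P)
  have hcl : IsClosed (P : Set G) := IsClosedLieSubgroup.isClosed E F
  have hact : ∀ b ∈ range φ, ∀ p, C.act b p ∈ range φ := by
    rintro _ ⟨y, rfl⟩ p
    exact ⟨_, hφ.map_act y p⟩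
  have hopen : IsOpen (range φ) := by
    refine isOpen_iff_mem_nhds.2 ?_
    rintro _ ⟨y, rfl⟩
    obtain ⟨g, hg, rfl⟩ := exists_kleinMap_eq y₀ y
    have := (hφ.preservesFormAt y₀ hg).nhds_le_map isParallelism_mcForm C.isParallelism
      (hφ.contMDiffAt y₀ hg)
    refine this ?_
    rw [← map_map]
    exact range_mem_map
  obtain ⟨b₁, hb₁, hb₁'⟩ : ∃ b₁ ∈ closure (range φ), b₁ ∉ range φ := by
    by_contra! hcon
    exact hφs (range_eq_univ.1 (C.eq_univ_of_isClopen
      ⟨isClosed_of_closure_subset hcon, hopen⟩ ⟨_, mem_range_self y₀⟩ hact))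
  have hrange : (φ ∘ kleinMap y₀) '' (P : Set G)ᶜ = range φ := by
    ext b
    constructor
    · rintro ⟨g, -, rfl⟩
      exact mem_range_self _
    · rintro ⟨y, rfl⟩
      obtain ⟨g, hg, rfl⟩ := exists_kleinMap_eq y₀ y
      exact ⟨g, hg, rfl⟩
  rw [← hrange] at hb₁
  obtain ⟨γ, β, hγ, hβ, hγ0, hβ1, hdev⟩ := exists_development C.isParallelism
    (fun g hg => hφ.preservesFormAt y₀ hg) hb₁
  -- the set of times at which the development is in `P`
  set Z : Set ℝ := Icc 0 1 ∩ γ ⁻¹' P with hZ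
  have hZc : IsClosed Z := hγ.preimage_isClosed_of_isClosed isClosed_Icc hcl
  have hZbdd : BddBelow Z := ⟨0, fun t ht => ht.1.1⟩
  have hZne : Z.Nonempty := by
    by_contra hcon
    refine hb₁' ?_
    rw [← hβ1, ← hdev 1 (right_mem_Icc.2 zero_le_one) fun t ht htP => hcon ⟨t, ht, htP⟩]
    exact mem_range_self _
  set T : ℝ := sInf Z with hT
  have hTZ : T ∈ Z := hZc.csInf_mem hZne hZbdd
  have hT0 : 0 < T := by
    refine lt_of_le_of_ne hTZ.1.1 fun h => hγ0 ?_
    rw [h]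
    exact hTZ.2
  have hlt : ∀ t ∈ Ico 0 T, γ t ∉ P := fun t ht htP =>
    (csInf_le hZbdd (⟨⟨ht.1, ht.2.le.trans hTZ.1.2⟩, htP⟩ : t ∈ Z)).not_gt ht.2
  have heq : ∀ t ∈ Ico 0 T, φ (kleinMap y₀ (γ t)) = β t := fun t ht =>
    hdev t ⟨ht.1, ht.2.le.trans hTZ.1.2⟩ fun s hs => hlt s ⟨hs.1, hs.2.trans_lt ht.2⟩
  have hsub : Ico 0 T ⊆ Icc 0 1 := fun t ht => ⟨ht.1, ht.2.le.trans hTZ.1.2⟩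
  have hne : (𝓝[Ico 0 T] T).NeBot := by
    rw [← mem_closure_iff_nhdsWithin_neBot, closure_Ico hT0.ne]
    exact right_mem_Icc.2 hT0.le
  have hγT : Tendsto γ (𝓝[Ico 0 T] T) (𝓝 (γ T)) := (hγ T hTZ.1).mono hsub
  have hβT : Tendsto β (𝓝[Ico 0 T] T) (𝓝 (β T)) := (hβ T hTZ.1).mono hsub
  have hev : ∀ᶠ t in 𝓝[Ico 0 T] T, γ t ∉ P := eventually_nhdsWithin_of_forall hlt
  have hφT : Tendsto (fun t => φ (kleinMap y₀ (γ t))) (𝓝[Ico 0 T] T) (𝓝 (β T)) :=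
    hβT.congr' (eventually_nhdsWithin_of_forall fun t ht => (heq t ht).symm)
  have hbT : β T ∉ range φ := by
    rintro ⟨y, hy⟩
    obtain ⟨g, hg, rfl⟩ := exists_kleinMap_eq y₀ y
    rw [← hy] at hφT
    exact not_tendsto_kleinMap y₀ hTZ.2 hγT hev hg (hφe.isInducing.tendsto_nhds_iff.2 hφT)
  -- translation moves the limit `γ T` of the development to the identity
  set p : P := ⟨γ T, hTZ.2⟩ with hp
  refine ⟨C.act (β T) p⁻¹, map (fun t => γ t * ((p⁻¹ : P) : G)) (𝓝[Ico 0 T] T), hne.map _, ?_,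
    ?_, ?_, fun h => hbT ?_⟩
  · have h1 := hγT.mul_const ((p⁻¹ : P) : G)
    have h2 : γ T * ((p⁻¹ : P) : G) = 1 := by simp [hp]
    rwa [h2] at h1
  · refine eventually_map.2 (hev.mono fun t ht h => ht ?_)
    exact (P.mul_mem_cancel_right (p⁻¹).2).1 h
  · refine tendsto_map'_iff.2 ?_
    refine (((C.continuous_act p⁻¹).tendsto (β T)).comp hφT).congr' ?_
    filter_upwards [hev] with t ht
    exact (hφ.map_mul y₀ ht p⁻¹).symm
  · have h1 := hact _ h p
    rwa [← C.act_mul, inv_mul_cancel, C.act_one] at h1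

variable [FiniteDimensional ℝ F] {b : B} {l : Filter G} [l.NeBot]

/-- If the lift has a limit `b` at the identity then it extends smoothly across `P`, with the values
`b p` at the points `p` of `P` because it is equivariant. -/
theorem IsGeometricLift.extendedLift_spec [T2Space B] (hdim : finrank ℝ F + 2 ≤ finrank ℝ E)
    (hφ : IsGeometricLift (kleinGeometry (E := E) (F := F) Γ) C.toCartanData σ φ)
    (hl : l ≤ 𝓝 1) (hlP : ∀ᶠ g in l, g ∉ P) (hlb : Tendsto (φ ∘ kleinMap y₀) l (𝓝 b)) (g : G) :
    ContMDiffAt 𝓘(ℝ, E) 𝓘(ℝ, EB) ∞ (extendedLift C φ y₀ b) g ∧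
      PreservesFormAt mcForm C.connection (extendedLift C φ y₀ b) g := by
  have hG := topologicalGroup_of_lieGroup 𝓘(ℝ, E) ∞ (G := G)
  have hP := topologicalGroup_of_lieGroup 𝓘(ℝ, F) ∞ (G := P)
  have hcl : IsClosed (P : Set G) := IsClosedLieSubgroup.isClosed E F
  by_cases hg : g ∈ P
  · have key : ∀ p : P, Tendsto (· * (p : G)) l (𝓝 p) ∧
        Tendsto (fun g => φ (kleinMap y₀ (g * p))) l (𝓝 (C.act b p)) := fun p => by
      constructor
      · have h1 : Tendsto (· * (p : G)) (𝓝 1) (𝓝 (1 * p)) :=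
          (continuous_mul_const (p : G)).tendsto 1
        rw [one_mul] at h1
        exact h1.mono_left hl
      · refine (((C.continuous_act p).tendsto b).comp hlb).congr' ?_
        filter_upwards [hlP] with g hg
        exact (hφ.map_mul y₀ hg p).symm
    have hlP' : ∀ p : P, ∀ᶠ g in l, g * (p : G) ∉ P := fun p => hlP.mono fun g hg h =>
      hg ((P.mul_mem_cancel_right p.2).1 h)
    obtain ⟨f, O, hO, hgO, hf, hfp, hfh, -⟩ := exists_extension_at_subgroup hdim C.isParallelism
      (fun g hg => hφ.preservesFormAt y₀ hg) ⟨g, hg⟩ (l := map (· * (g : G)) l)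
      (key ⟨g, hg⟩).1 (eventually_map.2 (hlP' ⟨g, hg⟩)) (tendsto_map'_iff.2 (key ⟨g, hg⟩).2)
    have heq : ∀ q ∈ O, extendedLift C φ y₀ b q = f q := fun q hq => by
      by_cases hqP : q ∈ P
      · have h1 : Tendsto (fun g => f (g * q)) l (𝓝 (f q)) :=
          ((hf.continuousOn.continuousAt (hO.mem_nhds hq)).tendsto).comp (key ⟨q, hqP⟩).1
        have h2 : Tendsto (fun g => f (g * q)) l (𝓝 (C.act b ⟨q, hqP⟩)) := by
          refine (key ⟨q, hqP⟩).2.congr' ?_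
          filter_upwards [hlP' ⟨q, hqP⟩, (key ⟨q, hqP⟩).1 (hO.mem_nhds hq)] with g h3 h4
          exact (hfh _ h4 h3).symm
        exact (extendedLift_coe y₀ b ⟨q, hqP⟩).trans (tendsto_nhds_unique h2 h1)
      · exact (extendedLift_of_notMem y₀ b hqP).trans (hfh q hq hqP).symm
    have hev : extendedLift C φ y₀ b =ᶠ[𝓝 g] f := by
      filter_upwards [hO.mem_nhds hgO] with q hq using heq q hq
    exact ⟨(hf.contMDiffAt (hO.mem_nhds hgO)).congr_of_eventuallyEq hev, (hfp g hgO).congr hev⟩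
  · have hev : extendedLift C φ y₀ b =ᶠ[𝓝 g] φ ∘ kleinMap y₀ := by
      filter_upwards [hcl.isOpen_compl.mem_nhds hg] with q hq
      exact extendedLift_of_notMem y₀ b hq
    exact ⟨(hφ.contMDiffAt y₀ hg).congr_of_eventuallyEq hev, (hφ.preservesFormAt y₀ hg).congr hev⟩

/-- The lift, which is invariant under `Γ`, can only have a limit at the identity if `Γ` is
trivial, because the action of `P` on `B` is free. -/
theorem IsGeometricLift.eq_bot [T2Space B] (hdim : finrank ℝ F + 2 ≤ finrank ℝ E)
    (hφ : IsGeometricLift (kleinGeometry (E := E) (F := F) Γ) C.toCartanData σ φ)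
    (hl : l ≤ 𝓝 1) (hlP : ∀ᶠ g in l, g ∉ P) (hlb : Tendsto (φ ∘ kleinMap y₀) l (𝓝 b)) :
    Γ = ⊥ := by
  have hG := topologicalGroup_of_lieGroup 𝓘(ℝ, E) ∞ (G := G)
  refine (Subgroup.eq_bot_iff_forall _).2 fun γ hγ => C.act_eq_self (b := b) ?_
  have h1 : Tendsto (fun g => extendedLift C φ y₀ b (γ * g)) l
      (𝓝 (extendedLift C φ y₀ b (γ : G))) := by
    have h2 : Tendsto (fun g : G => (γ : G) * g) (𝓝 1) (𝓝 ((γ : G) * 1)) :=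
      (continuous_const_mul (γ : G)).tendsto 1
    rw [mul_one] at h2
    exact (hφ.extendedLift_spec y₀ hdim hl hlP hlb γ).1.continuousAt.tendsto.comp (h2.mono_left hl)
  rw [extendedLift_coe] at h1
  refine tendsto_nhds_unique (h1.congr' ?_) hlb
  filter_upwards [hlP] with g hg
  have h3 : (γ : G) * g ∉ P := fun h => hg ((P.mul_mem_cancel_left γ.2).1 h)
  rw [extendedLift_of_notMem y₀ b h3, Function.comp_apply]
  exact congrArg φ ((kleinMap_eq_iff y₀ h3 hg).2 ⟨⟨γ, hγ⟩, rfl⟩)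

/-- The image of the extended lift is open by the inverse function theorem and closed by
development of curves, which meets no obstruction in `G`. -/
theorem IsGeometricLift.surjective_extendedLift [T2Space B] [ConnectedSpace M]
    (hdim : finrank ℝ F + 2 ≤ finrank ℝ E)
    (hφ : IsGeometricLift (kleinGeometry (E := E) (F := F) Γ) C.toCartanData σ φ)
    (hl : l ≤ 𝓝 1) (hlP : ∀ᶠ g in l, g ∉ P) (hlb : Tendsto (φ ∘ kleinMap y₀) l (𝓝 b)) :
    Function.Surjective (extendedLift C φ y₀ b) := by
  have hspec := hφ.extendedLift_spec y₀ hdim hl hlP hlb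
  refine range_eq_univ.1 (C.eq_univ_of_isClopen ⟨?_, ?_⟩ ⟨_, mem_range_self 1⟩ ?_)
  · refine isClosed_of_closure_subset fun b₁ hb₁ => ?_
    rw [← image_univ] at hb₁
    obtain ⟨γ, β, -, -, -, hβ1, hdev⟩ := exists_development C.isParallelism
      (fun g _ => (hspec g).2) hb₁
    exact ⟨γ 1, (hdev 1 (right_mem_Icc.2 zero_le_one) fun _ _ => mem_univ _).trans hβ1⟩
  · refine isOpen_iff_mem_nhds.2 ?_
    rintro _ ⟨g, rfl⟩
    exact (hspec g).2.nhds_le_map isParallelism_mcForm C.isParallelism (hspec g).1 range_mem_map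
  · rintro _ ⟨g, rfl⟩ p
    exact ⟨_, hφ.extendedLift_mul y₀ b g p⟩

end Rigidity

section Model

variable {E : Type*} [NormedAddCommGroup E] [NormedSpace ℝ E] [FiniteDimensional ℝ E]
  {G : Type*} [TopologicalSpace G] [ChartedSpace E G] [Group G] [LieGroup 𝓘(ℝ, E) ∞ G]
  {F : Type*} [NormedAddCommGroup F] [NormedSpace ℝ F]
  {P : Subgroup G} [ChartedSpace F P]
  {EM : Type*} [NormedAddCommGroup EM] [NormedSpace ℝ EM]
  {M : Type*} [TopologicalSpace M] [ChartedSpace EM M]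
  {EB : Type*} [NormedAddCommGroup EB] [NormedSpace ℝ EB] [FiniteDimensional ℝ EB]
  {B : Type*} [TopologicalSpace B] [ChartedSpace EB B] [IsManifold 𝓘(ℝ, EB) ∞ B]

/-- A Cartan geometry whose bundle is equivalent to `G` is geometrically isomorphic to `G / P`. -/
theorem CartanGeometry.geometricallyIsomorphic_modelGeometry
    (C : CartanGeometry E F P EM M EB B) {f : G → B} (hf : Function.Bijective f)
    (hs : ContMDiff 𝓘(ℝ, E) 𝓘(ℝ, EB) ∞ f) (hform : ∀ g, PreservesFormAt mcForm C.connection f g)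
    (hmul : ∀ g (p : P), f (g * p) = C.act (f g) p) :
    GeometricallyIsomorphic C.toCartanData (modelGeometry E P) := by
  set e : G ≃ B := Equiv.ofBijective f hf with he
  have hes : ∀ b, ContMDiffAt 𝓘(ℝ, EB) 𝓘(ℝ, E) ∞ e.symm b := fun b => by
    obtain ⟨g, rfl⟩ := hf.2 b
    exact (hform g).contMDiffAt_leftInverse isParallelism_mcForm C.isParallelism hs.contMDiffAt
      e.symm_apply_apply
  have hact : ∀ b p, e.symm (C.act b p) = e.symm b * p := fun b p => by
    rw [Equiv.symm_apply_eq]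
    refine Eq.trans ?_ (hmul _ _).symm
    exact congrArg (C.act · p) (e.apply_symm_apply b).symm
  have hfibre : ∀ b b', C.proj b = C.proj b' ↔ (e.symm b : G ⧸ P) = e.symm b' := fun b b' => by
    rw [QuotientGroup.eq]
    constructor
    · intro h
      obtain ⟨p, rfl⟩ := C.exists_act_eq h
      rw [hact, inv_mul_cancel_left]
      exact p.2
    · intro h
      have h1 : C.act b ⟨_, h⟩ = b' := by
        refine e.symm.injective ?_
        rw [hact, mul_inv_cancel_left]
      rw [← h1, C.proj_act]
  obtain ⟨s, hsec⟩ := C.proj_surjective.hasRightInverse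
  refine ⟨fun x => (e.symm (s x) : G ⧸ P), ⟨fun x x' h => ?_, fun x => ?_⟩,
    ⟨e.symm, hes, ?_⟩, hes, fun b => ?_, hact, fun b v => ?_⟩
  · rw [← hsec x, ← hsec x']
    exact (hfibre _ _).2 h
  · obtain ⟨g, rfl⟩ := QuotientGroup.mk_surjective x
    refine ⟨C.proj (e g), ((hfibre _ _).1 (hsec _)).trans ?_⟩
    rw [e.symm_apply_apply]
  · exact hs
  · exact (hfibre _ _).1 (hsec _).symm
  · obtain ⟨g, rfl⟩ := e.surjective b
    have h1 : MDifferentiableAt 𝓘(ℝ, EB) 𝓘(ℝ, E) e.symm (e g) :=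
      (hes _).mdifferentiableAt (by simp)
    have h2 : f ∘ e.symm = id := funext e.apply_symm_apply
    have h3 := mfderiv_comp_of_eq (x := e g) (y := g) (hform g).1 h1 (e.symm_apply_apply g)
    have h4 : e.symm (e g) = g := e.symm_apply_apply g
    rw [h2, mfderiv_id, h4] at h3
    have h5 := (hform g).2 ((mfderiv 𝓘(ℝ, EB) 𝓘(ℝ, E) e.symm (e g) : EB →L[ℝ] E) v)
    refine Eq.trans ?_ (h5.symm.trans ?_)
    · change (mcForm (e.symm (e g)) : E →L[ℝ] E) _ = _
      rw [h4]
      rfl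
    · exact congrArg (fun T : EB →L[ℝ] EB => (C.connection (f g) : EB →L[ℝ] E) (T v)) h3.symm

end Model

/-! ### Rigidity for general model spaces -/

section Main

open Set KleinBundle Module Filter

variable {E : Type*} [NormedAddCommGroup E] [NormedSpace ℝ E] [FiniteDimensional ℝ E]
  {G : Type*} [TopologicalSpace G] [ChartedSpace E G] [Group G] [LieGroup 𝓘(ℝ, E) ∞ G]
  {F : Type*} [NormedAddCommGroup F] [NormedSpace ℝ F] [FiniteDimensional ℝ F]
  {P : Subgroup G} [ChartedSpace F P] [LieGroup 𝓘(ℝ, F) ∞ P] [IsClosedLieSubgroup E F P]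
  {Γ : Subgroup P} [DiscreteTopology Γ]
  {EM : Type*} [NormedAddCommGroup EM] [NormedSpace ℝ EM]
  {M : Type*} [TopologicalSpace M] [ChartedSpace EM M]
  {EB : Type*} [NormedAddCommGroup EB] [NormedSpace ℝ EB] [FiniteDimensional ℝ EB]
  {B : Type*} [TopologicalSpace B] [ChartedSpace EB B] [IsManifold 𝓘(ℝ, EB) ∞ B]

/-- Rigidity of geometric embeddings of `Γ \ Ω_o` for an arbitrary model space `G / P` which
contains a plane, given with a lift `c` to `G`. -/
theorem rigidity_of_plane [T2Space G] [T2Space M] [ConnectedSpace M]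
    (C : CartanGeometry E F P EM M EB B) {σ : KleinBase Γ → M}
    (hσ : IsGeometricEmbedding (kleinGeometry (E := E) (F := F) Γ) C.toCartanData σ)
    {c : ℝ × ℝ → G} (hc : Continuous c) (hinj : ∀ x y, (c x)⁻¹ * c y ∈ P → x = y) :
    (GeometricallyIsomorphic C.toCartanData (modelGeometry E P) ∧
      Γ = ⊥ ∧ ∃ κ : M, Set.range σ = {κ}ᶜ) ∨
    IsGeometricIso (kleinGeometry (E := E) (F := F) Γ) C.toCartanData σ := by
  have hdim := finrank_add_two_le (E := E) (F := F) hc hinj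
  have hB : T2Space B := C.t2Space
  obtain ⟨φ, hφ, hφe⟩ := hσ
  by_cases hs : Function.Surjective φ
  · exact Or.inr (hφ.isGeometricIso ⟨hφe.injective, hs⟩)
  left
  have hcP : (c 0)⁻¹ * c (1, 1) ∉ P := fun h => by
    have := congrArg Prod.fst (hinj _ _ h)
    simp at this
  set y₀ : KleinBundle E F Γ := mk Γ ⟨_, hcP⟩
  obtain ⟨b, l, hlne, hl, hlP, hlb, hb⟩ := hφ.exists_tendsto y₀ hφe hs
  have hspec := hφ.extendedLift_spec y₀ hdim hl hlP hlb
  have hΓ := hφ.eq_bot y₀ hdim hl hlP hlb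
  have hsurj := hφ.surjective_extendedLift y₀ hdim hl hlP hlb
  refine ⟨C.geometricallyIsomorphic_modelGeometry
    ⟨hφ.injective_extendedLift y₀ hφe.injective hΓ hb, hsurj⟩ (fun g => (hspec g).1)
    (fun g => (hspec g).2) (hφ.extendedLift_mul y₀ b), hΓ, C.proj b, ?_⟩
  ext x
  rw [mem_compl_singleton_iff]
  constructor
  · rintro ⟨n, rfl⟩ hn
    obtain ⟨y, rfl⟩ := kleinGeometry_proj_surjective (E := E) (F := F) n
    rw [← hφ.proj_comp] at hn
    obtain ⟨p, rfl⟩ := C.exists_act_eq hn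
    exact hb ⟨_, hφ.map_act y p⟩
  · intro hx
    obtain ⟨b', rfl⟩ := C.proj_surjective x
    obtain ⟨g, rfl⟩ := hsurj b'
    by_cases hg : g ∈ P
    · refine absurd ?_ hx
      rw [← C.proj_act b ⟨g, hg⟩]
      exact congrArg C.proj (extendedLift_coe y₀ b ⟨g, hg⟩)
    · rw [extendedLift_of_notMem y₀ b hg, hφ.proj_comp]
      exact mem_range_self _

end Main

/-! ### Isometries of hyperbolic spaces -/

section HypTopology

open Set Filter

namespace Octonion

/-- The octonion with given quaternionic coordinates. -/
def mk (a b : ℍ[ℝ]) : Octonion := (a, b)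

/-- The first quaternionic coordinate. -/
def left (x : Octonion) : ℍ[ℝ] := x.1

/-- The second quaternionic coordinate. -/
def right (x : Octonion) : ℍ[ℝ] := x.2

@[ext] theorem ext {x y : Octonion} (h1 : x.left = y.left) (h2 : x.right = y.right) : x = y :=
  Prod.ext h1 h2

@[simp] theorem left_mk (a b : ℍ[ℝ]) : (mk a b).left = a := rfl

@[simp] theorem right_mk (a b : ℍ[ℝ]) : (mk a b).right = b := rfl

@[simp] theorem left_mul (x y : Octonion) :
    (x * y).left = x.left * y.left - star y.right * x.right := rfl

@[simp] theorem right_mul (x y : Octonion) :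
    (x * y).right = y.right * x.left + x.right * star y.left := rfl

@[simp] theorem left_conj (x : Octonion) : x.conj.left = star x.left := rfl

@[simp] theorem right_conj (x : Octonion) : x.conj.right = -x.right := rfl

@[simp] theorem left_rsmul (t : ℝ) (x : Octonion) : (x.rsmul t).left = t • x.left := rfl

@[simp] theorem right_rsmul (t : ℝ) (x : Octonion) : (x.rsmul t).right = t • x.right := rfl

theorem re_eq (x : Octonion) : x.re = x.left.re := rfl

theorem normSq_eq (x : Octonion) :
    x.normSq = Quaternion.normSq x.left + Quaternion.normSq x.right := rfl

instance : T2Space Octonion := inferInstanceAs (T2Space (ℍ[ℝ] × ℍ[ℝ]))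

theorem continuous_left : Continuous left := continuous_fst

theorem continuous_right : Continuous right := continuous_snd

theorem continuous_mk {X : Type*} [TopologicalSpace X] {a b : X → ℍ[ℝ]} (ha : Continuous a)
    (hb : Continuous b) : Continuous fun x => mk (a x) (b x) := ha.prodMk hb

end Octonion

variable {K : DivAlg} {d : ℕ}

instance : T2Space (HypSpace K d) :=
  T2Space.of_injective_continuous Subtype.val_injective continuous_induced_dom

instance : T2Space (HypIso K d) :=
  T2Space.of_injective_continuous (f := HypIso.toFun)
    (fun _ _ h => Subtype.ext (Equiv.coe_fn_injective h)) continuous_induced_dom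

theorem DivAlg.mem_carrier_real {x : Octonion} : x ∈ DivAlg.real.carrier ↔
    x.right = 0 ∧ x.left.imI = 0 ∧ x.left.imJ = 0 ∧ x.left.imK = 0 := Iff.rfl

theorem DivAlg.mem_carrier_complex {x : Octonion} : x ∈ DivAlg.complex.carrier ↔
    x.right = 0 ∧ x.left.imJ = 0 ∧ x.left.imK = 0 := Iff.rfl

theorem DivAlg.mem_carrier_quaternion {x : Octonion} : x ∈ DivAlg.quaternion.carrier ↔
    x.right = 0 := Iff.rfl

theorem DivAlg.rsmul_mem_carrier (t : ℝ) {x : Octonion} (hx : x ∈ K.carrier) :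
    x.rsmul t ∈ K.carrier := by
  cases K
  · simp_all [DivAlg.mem_carrier_real]
  · simp_all [DivAlg.mem_carrier_complex]
  · simp_all [DivAlg.mem_carrier_quaternion]
  · trivial

theorem Octonion.normSq_rsmul (t : ℝ) (x : Octonion) : (x.rsmul t).normSq = t ^ 2 * x.normSq := by
  simp [Octonion.normSq_eq, Quaternion.normSq_smul, mul_add]

theorem HypIso.nhdsBoundary_neBot (o : HypBoundary K d) : (HypIso.nhdsBoundary o).NeBot := by
  refine mem_closure_iff_comap_neBot.1 ?_
  have h1 : Continuous fun t : ℝ => fun i => (o.1 i).rsmul t :=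
    continuous_pi fun i => Octonion.continuous_mk (a := fun t : ℝ => t • (o.1 i).left)
      (b := fun t : ℝ => t • (o.1 i).right) (by fun_prop) (by fun_prop)
  have h2 : (fun i => (o.1 i).rsmul 1) = o.1 := by
    funext i
    ext1 <;> simp
  refine mem_closure_of_tendsto (b := 𝓝[<] (1 : ℝ)) (f := fun t : ℝ => fun i => (o.1 i).rsmul t)
    ?_ ?_
  · have := h1.tendsto 1
    rw [h2] at this
    exact this.mono_left nhdsWithin_le_nhds
  · filter_upwards [Ioo_mem_nhdsLT (zero_lt_one' ℝ)] with t ht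
    refine ⟨fun i => DivAlg.rsmul_mem_carrier t (o.2.1 i), ?_⟩
    simp only [Octonion.normSq_rsmul, ← Finset.mul_sum, o.2.2]
    nlinarith [ht.1, ht.2]

/-- A map of `𝕂^d` into itself which preserves the unit ball and its hyperbolic distance. -/
structure IsBallIsometry (K : DivAlg) {d : ℕ} (L : (Fin d → Octonion) → Fin d → Octonion) :
    Prop where
  mem : ∀ x, (∀ i, x i ∈ K.carrier) → ∀ i, L x i ∈ K.carrier
  normSq : ∀ x, (∀ i, x i ∈ K.carrier) → ∑ i, (L x i).normSq = ∑ i, (x i).normSq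
  pairing : ∀ x y, (∀ i, x i ∈ K.carrier) → (∀ i, y i ∈ K.carrier) →
    HypSpace.pairing (L x) (L y) = HypSpace.pairing x y

/-- The restriction of a map to the unit ball. -/
def IsBallIsometry.restrict {L : (Fin d → Octonion) → Fin d → Octonion} (h : IsBallIsometry K L)
    (x : HypSpace K d) : HypSpace K d :=
  ⟨L x.1, h.mem _ x.2.1, (h.normSq _ x.2.1).trans_lt x.2.2⟩

/-- The isometry of the hyperbolic space defined by a map of `𝕂^d` and its inverse. -/
def IsBallIsometry.toHypIso {L L' : (Fin d → Octonion) → Fin d → Octonion}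
    (h : IsBallIsometry K L) (h' : IsBallIsometry K L')
    (hl : ∀ x, (∀ i, x i ∈ K.carrier) → L' (L x) = x)
    (hr : ∀ x, (∀ i, x i ∈ K.carrier) → L (L' x) = x) : HypIso K d :=
  ⟨⟨h.restrict, h'.restrict, fun x => Subtype.ext (hl _ x.2.1), fun x => Subtype.ext (hr _ x.2.1)⟩,
    fun x y => by
      change Real.arcosh (Real.sqrt (HypSpace.pairing (L x.1) (L y.1) /
        ((1 - ∑ i, (L x.1 i).normSq) * (1 - ∑ i, (L y.1 i).normSq)))) = _
      rw [h.pairing _ _ x.2.1 y.2.1, h.normSq _ x.2.1, h.normSq _ y.2.1]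
      rfl⟩

/-- A continuous family of isometries, given by continuous maps of `𝕂^d`, which moves `o`
injectively: its members are in different cosets of the stabilizer of `o`, since the image of `o`
can be read from the isometry as a limit. -/
theorem exists_plane_of_isBallIsometry (o : HypBoundary K d)
    {L L' : ℝ × ℝ → (Fin d → Octonion) → Fin d → Octonion}
    (h : ∀ s, IsBallIsometry K (L s)) (h' : ∀ s, IsBallIsometry K (L' s))
    (hl : ∀ s x, (∀ i, x i ∈ K.carrier) → L' s (L s x) = x)
    (hr : ∀ s x, (∀ i, x i ∈ K.carrier) → L s (L' s x) = x)
    (hc : Continuous (Function.uncurry L)) (ho : Function.Injective fun s => L s o.1) :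
    ∃ c : ℝ × ℝ → HypIso K d, Continuous c ∧
      ∀ s t, (c s)⁻¹ * c t ∈ HypIso.boundaryStabilizer o → s = t := by
  set c : ℝ × ℝ → HypIso K d := fun s => (h s).toHypIso (h' s) (hl s) (hr s) with hcdef
  refine ⟨c, ?_, fun s t hst => ho ?_⟩
  · refine continuous_induced_rng.2 (continuous_pi fun x => continuous_induced_rng.2 ?_)
    exact hc.comp (continuous_id.prodMk continuous_const)
  · have hne := HypIso.nhdsBoundary_neBot o
    have hlim : ∀ s, Tendsto (fun x => ((c s).toFun x).1) (HypIso.nhdsBoundary o)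
        (𝓝 (L s o.1)) := fun s =>
      ((hc.comp (continuous_const.prodMk continuous_id)).tendsto o.1).comp tendsto_comap
    have h1 : map ((c s)⁻¹ * c t).toFun (HypIso.nhdsBoundary o) = HypIso.nhdsBoundary o := hst
    have h2 : (c s).toFun ∘ ((c s)⁻¹ * c t).toFun = (c t).toFun := by
      funext x
      exact Equiv.apply_symm_apply (c s).1 _
    have h3 := hlim s
    rw [← h1, tendsto_map'_iff] at h3
    have h4 : (fun x => ((c s).toFun x).1) ∘ ((c s)⁻¹ * c t).toFun =
        fun x => ((c t).toFun x).1 := funext fun x => congrArg Subtype.val (congrFun h2 x)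
    rw [h4] at h3
    exact tendsto_nhds_unique h3 (hlim t)

end HypTopology

/-! ### A plane in the boundary of the octonionic hyperbolic plane -/

section Unit

/-- The quaternion `i`. -/
def quatI : ℍ[ℝ] := ⟨0, 1, 0, 0⟩

/-- The quaternion `j`. -/
def quatJ : ℍ[ℝ] := ⟨0, 0, 1, 0⟩

@[simp] theorem re_quatI : quatI.re = 0 := rfl
@[simp] theorem imI_quatI : quatI.imI = 1 := rfl
@[simp] theorem imJ_quatI : quatI.imJ = 0 := rfl
@[simp] theorem imK_quatI : quatI.imK = 0 := rfl
@[simp] theorem re_quatJ : quatJ.re = 0 := rfl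
@[simp] theorem imI_quatJ : quatJ.imI = 0 := rfl
@[simp] theorem imJ_quatJ : quatJ.imJ = 1 := rfl
@[simp] theorem imK_quatJ : quatJ.imK = 0 := rfl

/-- A plane of unit quaternions. -/
def unitQuaternion (s : ℝ × ℝ) : ℍ[ℝ] :=
  (Real.sqrt (1 + s.1 ^ 2 + s.2 ^ 2))⁻¹ • (1 + s.1 • quatI + s.2 • quatJ)

theorem continuous_unitQuaternion : Continuous unitQuaternion := by
  have h3 : Continuous fun s : ℝ × ℝ => (Real.sqrt (1 + s.1 ^ 2 + s.2 ^ 2))⁻¹ :=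
    Continuous.inv₀ (by fun_prop) fun s => by positivity
  exact h3.smul (by fun_prop)

theorem star_mul_unitQuaternion (s : ℝ × ℝ) : star (unitQuaternion s) * unitQuaternion s = 1 := by
  have h0 : (0 : ℝ) < 1 + s.1 ^ 2 + s.2 ^ 2 := by positivity
  rw [Quaternion.star_mul_self, unitQuaternion, Quaternion.normSq_smul, inv_pow,
    Real.sq_sqrt h0.le, Quaternion.normSq_def']
  have h1 : (1 + s.1 ^ 2 + s.2 ^ 2)⁻¹ * (1 + s.1 ^ 2 + s.2 ^ 2) = 1 := inv_mul_cancel₀ h0.ne'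
  simp [h1]

theorem unitQuaternion_mul_star (s : ℝ × ℝ) : unitQuaternion s * star (unitQuaternion s) = 1 := by
  rw [Quaternion.self_mul_star, ← Quaternion.star_mul_self, star_mul_unitQuaternion]

theorem injective_unitQuaternion : Function.Injective unitQuaternion := by
  intro s t h
  have h0 : ∀ s : ℝ × ℝ, (0 : ℝ) < Real.sqrt (1 + s.1 ^ 2 + s.2 ^ 2) := fun s => by positivity
  have h1 := congrArg (fun q : ℍ[ℝ] => q.re) h
  have h2 := congrArg (fun q : ℍ[ℝ] => q.imI) h
  have h3 := congrArg (fun q : ℍ[ℝ] => q.imJ) h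
  simp [unitQuaternion] at h1 h2 h3
  rw [h1] at h2 h3
  exact Prod.ext (mul_left_cancel₀ (inv_pos.2 (h0 t)).ne' h2)
    (mul_left_cancel₀ (inv_pos.2 (h0 t)).ne' h3)

end Unit

section OctonionPlane

theorem quaternion_re_mul_comm (x y : ℍ[ℝ]) : (x * y).re = (y * x).re := by
  simp only [Quaternion.re_mul]
  ring

namespace Octonion

/-- Left multiplication by a quaternion. -/
def quatMul (q : ℍ[ℝ]) (x : Octonion) : Octonion := mk (q * x.left) (x.right * q)

@[simp] theorem left_quatMul (q : ℍ[ℝ]) (x : Octonion) : (x.quatMul q).left = q * x.left := rfl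

@[simp] theorem right_quatMul (q : ℍ[ℝ]) (x : Octonion) : (x.quatMul q).right = x.right * q := rfl

variable {q : ℍ[ℝ]}

theorem quatMul_star_quatMul (h : star q * q = 1) (h' : q * star q = 1) (x : Octonion) :
    quatMul (star q) (quatMul q x) = x := by
  ext1
  · simp [← mul_assoc, h]
  · simp [mul_assoc, h']

theorem normSq_quatMul (h : star q * q = 1) (x : Octonion) : (quatMul q x).normSq = x.normSq := by
  have hq : Quaternion.normSq q = 1 := by
    have := congrArg (fun q : ℍ[ℝ] => q.re) h
    simpa [Quaternion.star_mul_self] using this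
  simp [normSq_eq, hq]

theorem re_conj_quatMul_mul_quatMul (h : star q * q = 1) (h' : q * star q = 1) (x y : Octonion) :
    ((quatMul q x).conj * quatMul q y).re = (x.conj * y).re := by
  have h1 : star (q * x.left) * (q * y.left) = star x.left * y.left := by
    rw [star_mul, mul_assoc, ← mul_assoc (star q), h, one_mul]
  have h2 : (star (y.right * q) * (x.right * q)).re = (star y.right * x.right).re := by
    rw [star_mul, quaternion_re_mul_comm, mul_assoc, ← mul_assoc q, h', one_mul,
      quaternion_re_mul_comm]
  simp only [re_eq, left_mul, left_conj, right_conj, left_quatMul, right_quatMul, h1, mul_neg,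
    sub_neg_eq_add, Quaternion.re_add, h2]

theorem re_mul_conj_mul (x y : Octonion) :
    ((x * x.conj) * (y * y.conj)).re = x.normSq * y.normSq := by
  have h : ∀ x : Octonion, x * x.conj = mk (x.normSq : ℍ[ℝ]) 0 := fun x => by
    ext1
    · simp [normSq_eq, Quaternion.self_mul_star, Quaternion.star_mul_self]
    · simp
  rw [h, h]
  simp [re_eq]

theorem quatMul_mul_conj_quatMul (h : star q * q = 1) (h' : q * star q = 1) (x y : Octonion) :
    quatMul q x * (quatMul (star q) y).conj =
      mk (q * (x * y.conj).left * q) (x * y.conj).right := by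
  ext1
  · simp [mul_add, add_mul, mul_assoc]
  · simp only [right_mul, right_conj, left_conj, left_quatMul, right_quatMul, right_mk, star_mul,
      star_star, neg_mul]
    rw [mul_assoc y.right, ← mul_assoc (star q), h, one_mul, mul_assoc x.right, ← mul_assoc q, h',
      one_mul]

/-- Conjugate transformations of the first coordinates preserve the trace form. -/
theorem re_mul_sandwich (h : star q * q = 1) (h' : q * star q = 1) (x y : Octonion) :
    (mk (q * x.left * q) x.right * mk (star q * y.left * star q) y.right).re = (x * y).re := by
  have h1 : (q * x.left * q * (star q * y.left * star q)).re = (x.left * y.left).re := by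
    have h2 : q * x.left * q * (star q * y.left * star q) =
        q * (x.left * ((q * star q) * y.left)) * star q := by
      simp only [mul_assoc]
    rw [h2, h', one_mul, quaternion_re_mul_comm, ← mul_assoc, h, one_mul]
  simp only [re_eq, left_mul, Quaternion.re_sub, left_mk, right_mk, h1]

end Octonion

/-- The isometry `(x, y) ↦ (q x, q̄ y)` of the octonionic hyperbolic plane. -/
def octonionRotation (q : ℍ[ℝ]) (x : Fin 2 → Octonion) : Fin 2 → Octonion :=
  ![(x 0).quatMul q, (x 1).quatMul (star q)]

theorem isBallIsometry_octonionRotation {q : ℍ[ℝ]} (h : star q * q = 1) (h' : q * star q = 1) :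
    IsBallIsometry .octonion (octonionRotation q) := by
  have hs : star (star q) * star q = 1 := by rwa [star_star]
  have hs' : star q * star (star q) = 1 := by rwa [star_star]
  refine ⟨fun _ _ _ => trivial, fun x _ => ?_, fun x y _ _ => ?_⟩
  · simp [Fin.sum_univ_two, octonionRotation, Octonion.normSq_quatMul h,
      Octonion.normSq_quatMul hs]
  · have e1 := fun x y : Octonion => Octonion.quatMul_mul_conj_quatMul h h' x y
    have e2 := fun x y : Octonion => Octonion.quatMul_mul_conj_quatMul hs hs' x y
    simp only [star_star] at e2
    have e3 := Octonion.re_mul_sandwich h h' (x 0 * (x 1).conj) (y 1 * (y 0).conj)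
    have e4 := Octonion.re_mul_sandwich hs hs' (x 1 * (x 0).conj) (y 0 * (y 1).conj)
    simp only [star_star] at e4
    simp only [HypSpace.pairing, Fin.sum_univ_two, octonionRotation, Matrix.cons_val_zero,
      Matrix.cons_val_one, Octonion.re_mul_conj_mul, Octonion.normSq_quatMul h,
      Octonion.normSq_quatMul hs, Octonion.re_conj_quatMul_mul_quatMul h h',
      Octonion.re_conj_quatMul_mul_quatMul hs hs', e1, e2]
    rw [← e3, ← e4]

theorem octonionRotation_star {q : ℍ[ℝ]} (h : star q * q = 1) (h' : q * star q = 1)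
    (x : Fin 2 → Octonion) : octonionRotation (star q) (octonionRotation q x) = x := by
  have h0 := Octonion.quatMul_star_quatMul h h' (x 0)
  have h1 := Octonion.quatMul_star_quatMul (q := star q) (by rwa [star_star]) (by rwa [star_star])
    (x 1)
  funext i
  fin_cases i
  · exact h0
  · exact h1

theorem exists_plane_octonion (o : HypBoundary .octonion 2) :
    ∃ c : ℝ × ℝ → HypIso .octonion 2, Continuous c ∧
      ∀ s t, (c s)⁻¹ * c t ∈ HypIso.boundaryStabilizer o → s = t := by
  have hu := star_mul_unitQuaternion
  have hu' := unitQuaternion_mul_star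
  refine exists_plane_of_isBallIsometry o (L := fun s => octonionRotation (unitQuaternion s))
    (L' := fun s => octonionRotation (star (unitQuaternion s)))
    (fun s => isBallIsometry_octonionRotation (hu s) (hu' s))
    (fun s => isBallIsometry_octonionRotation (by rw [star_star, hu']) (by rw [star_star, hu]))
    (fun s x _ => octonionRotation_star (hu s) (hu' s) x) (fun s x _ => ?_) ?_ fun s t hst => ?_
  · have := octonionRotation_star (q := star (unitQuaternion s)) (by rw [star_star, hu'])
      (by rw [star_star, hu]) x
    rwa [star_star] at this
  · have hq : Continuous fun a : (ℝ × ℝ) × (Fin 2 → Octonion) => unitQuaternion a.1 :=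
      continuous_unitQuaternion.comp continuous_fst
    have hl : ∀ i, Continuous fun a : (ℝ × ℝ) × (Fin 2 → Octonion) => (a.2 i).left := fun i =>
      Octonion.continuous_left.comp ((continuous_apply i).comp continuous_snd)
    have hr : ∀ i, Continuous fun a : (ℝ × ℝ) × (Fin 2 → Octonion) => (a.2 i).right := fun i =>
      Octonion.continuous_right.comp ((continuous_apply i).comp continuous_snd)
    refine continuous_pi fun i => ?_
    fin_cases i
    · exact Octonion.continuous_mk (hq.mul (hl 0)) ((hr 0).mul hq)
    · exact Octonion.continuous_mk (hq.star.mul (hl 1)) ((hr 1).mul hq.star)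
  · have h0 : (o.1 0).quatMul (unitQuaternion s) = (o.1 0).quatMul (unitQuaternion t) :=
      congrFun hst 0
    have h1 : (o.1 1).quatMul (star (unitQuaternion s)) =
      (o.1 1).quatMul (star (unitQuaternion t)) := congrFun hst 1
    have h2 := congrArg Octonion.left h0
    have h3 := congrArg Octonion.right h0
    have h4 := congrArg Octonion.left h1
    have h5 := congrArg Octonion.right h1
    simp only [Octonion.left_quatMul, Octonion.right_quatMul] at h2 h3 h4 h5
    by_contra hne
    have hq : unitQuaternion s ≠ unitQuaternion t := fun h => hne (injective_unitQuaternion h)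
    have hq' : star (unitQuaternion s) ≠ star (unitQuaternion t) := fun h => hq (star_injective h)
    have e2 : (o.1 0).left = 0 := by_contra fun h => hq (mul_right_cancel₀ h h2)
    have e3 : (o.1 0).right = 0 := by_contra fun h => hq (mul_left_cancel₀ h h3)
    have e4 : (o.1 1).left = 0 := by_contra fun h => hq' (mul_right_cancel₀ h h4)
    have e5 : (o.1 1).right = 0 := by_contra fun h => hq' (mul_left_cancel₀ h h5)
    have ho := o.2.2
    simp [Fin.sum_univ_two, Octonion.normSq_eq, e2, e3, e4, e5] at ho

end OctonionPlane

/-! ### Planes in the boundary of the other hyperbolic spaces -/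

section AssociativeModel

variable {d : ℕ}

/-- The Hermitian product of `ℍ^d`, linear on the right in the second argument. -/
def herm (a b : Fin d → ℍ[ℝ]) : ℍ[ℝ] := ∑ i, star (a i) * b i

theorem star_herm (a b : Fin d → ℍ[ℝ]) : star (herm a b) = herm b a := by
  simp [herm, star_sum]

theorem herm_add (a b c : Fin d → ℍ[ℝ]) : herm a (b + c) = herm a b + herm a c := by
  simp [herm, mul_add, Finset.sum_add_distrib]

theorem herm_sub (a b c : Fin d → ℍ[ℝ]) : herm a (b - c) = herm a b - herm a c := by
  simp [herm, mul_sub, Finset.sum_sub_distrib]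

theorem sub_herm (a b c : Fin d → ℍ[ℝ]) : herm (a - b) c = herm a c - herm b c := by
  simp [herm, sub_mul, Finset.sum_sub_distrib]

theorem herm_mul (a b : Fin d → ℍ[ℝ]) (c : ℍ[ℝ]) : herm a (fun i => b i * c) = herm a b * c := by
  simp [herm, Finset.sum_mul, mul_assoc]

theorem mul_herm (a b : Fin d → ℍ[ℝ]) (c : ℍ[ℝ]) :
    herm (fun i => a i * c) b = star c * herm a b := by
  simp [herm, Finset.mul_sum, mul_assoc]

theorem herm_self (a : Fin d → ℍ[ℝ]) :
    herm a a = ((∑ i, Quaternion.normSq (a i) : ℝ) : ℍ[ℝ]) := by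
  refine (Finset.sum_congr rfl fun i _ => Quaternion.star_mul_self (a i)).trans ?_
  exact (map_sum (algebraMap ℝ ℍ[ℝ]) _ _).symm

theorem quaternion_re_sum {ι : Type*} (s : Finset ι) (f : ι → ℍ[ℝ]) :
    (∑ i ∈ s, f i).re = ∑ i ∈ s, (f i).re :=
  map_sum (⟨⟨fun q => q.re, rfl⟩, Quaternion.re_add⟩ : ℍ[ℝ] →+ ℝ) f s

/-- Vectors with quaternionic coordinates, as vectors with octonionic coordinates. -/
def ofQuat (a : Fin d → ℍ[ℝ]) (i : Fin d) : Octonion := Octonion.mk (a i) 0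

/-- Over the associative algebras, the pairing is the squared modulus of the Hermitian product. -/
theorem pairing_ofQuat (a b : Fin d → ℍ[ℝ]) :
    HypSpace.pairing (ofQuat a) (ofQuat b) = Quaternion.normSq (1 - herm a b) := by
  have h1 : ∀ i, ((ofQuat a i).conj * ofQuat b i).re = (star (a i) * b i).re := fun i => by
    simp [ofQuat, Octonion.re_eq, -Quaternion.re_mul]
  have h2 : ∀ i j, ((ofQuat a i * (ofQuat a j).conj) * (ofQuat b j * (ofQuat b i).conj)).re =
      ((star (a j) * b j) * (star (b i) * a i)).re := fun i j => by
    have h3 : a i * star (a j) * (b j * star (b i)) =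
        a i * (star (a j) * b j * star (b i)) := by
      simp only [mul_assoc]
    simp only [ofQuat, Octonion.re_eq, Octonion.left_mul, Octonion.left_mk, Octonion.left_conj,
      Octonion.right_mul, Octonion.right_mk, Octonion.right_conj, neg_zero, star_zero, zero_mul,
      sub_zero, mul_zero, add_zero]
    rw [h3, quaternion_re_mul_comm]
    simp only [mul_assoc]
  have h4 : (∑ i, ∑ j, ((star (a j) * b j) * (star (b i) * a i)).re : ℝ) =
      (herm a b * herm b a).re := by
    simp only [herm, Finset.sum_mul_sum, quaternion_re_sum]
    exact Finset.sum_comm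
  have h5 : (∑ i, (star (a i) * b i).re : ℝ) = (herm a b).re := by
    simp only [herm, quaternion_re_sum]
  have h6 : ∀ q : ℍ[ℝ], Quaternion.normSq (1 - q) = 1 - 2 * q.re + (q * star q).re := fun q => by
    simp [Quaternion.normSq_def']
    ring
  simp only [HypSpace.pairing, h1, h2, h4, h5, h6, star_herm]

/-- The real subalgebra of the quaternions to which the coordinates of points of `H^d_𝕂` belong. Its
value at the octonions is junk. -/
def DivAlg.toSubalgebra : DivAlg → Subalgebra ℝ ℍ[ℝ]
  | .real =>
    { carrier := {x | x.imI = 0 ∧ x.imJ = 0 ∧ x.imK = 0}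
      mul_mem' := by
        rintro a b ⟨h1, h2, h3⟩ ⟨h4, h5, h6⟩
        simp [h1, h2, h3, h4, h5, h6]
      add_mem' := by
        rintro a b ⟨h1, h2, h3⟩ ⟨h4, h5, h6⟩
        simp [h1, h2, h3, h4, h5, h6]
      algebraMap_mem' := fun r => ⟨rfl, rfl, rfl⟩ }
  | .complex =>
    { carrier := {x | x.imJ = 0 ∧ x.imK = 0}
      mul_mem' := by
        rintro a b ⟨h2, h3⟩ ⟨h5, h6⟩
        simp [h2, h3, h5, h6]
      add_mem' := by
        rintro a b ⟨h2, h3⟩ ⟨h5, h6⟩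
        simp [h2, h3, h5, h6]
      algebraMap_mem' := fun r => ⟨rfl, rfl⟩ }
  | _ => ⊤

theorem DivAlg.mem_real {x : ℍ[ℝ]} :
    x ∈ DivAlg.real.toSubalgebra ↔ x.imI = 0 ∧ x.imJ = 0 ∧ x.imK = 0 := Iff.rfl

theorem DivAlg.mem_complex {x : ℍ[ℝ]} :
    x ∈ DivAlg.complex.toSubalgebra ↔ x.imJ = 0 ∧ x.imK = 0 := Iff.rfl

theorem DivAlg.mem_carrier_iff {K : DivAlg} (hK : K ≠ .octonion) {x : Octonion} :
    x ∈ K.carrier ↔ x.right = 0 ∧ x.left ∈ K.toSubalgebra := by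
  cases K
  · exact Iff.rfl
  · exact Iff.rfl
  · exact (and_iff_left trivial).symm
  · exact absurd rfl hK

theorem DivAlg.star_mem {K : DivAlg} {x : ℍ[ℝ]} (hx : x ∈ K.toSubalgebra) :
    star x ∈ K.toSubalgebra := by
  cases K
  · simp_all [DivAlg.mem_real]
  · simp_all [DivAlg.mem_complex]
  · trivial
  · trivial

theorem DivAlg.herm_mem {K : DivAlg} {a b : Fin d → ℍ[ℝ]} (ha : ∀ i, a i ∈ K.toSubalgebra)
    (hb : ∀ i, b i ∈ K.toSubalgebra) : herm a b ∈ K.toSubalgebra :=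
  Subalgebra.sum_mem _ fun i _ => K.toSubalgebra.mul_mem (DivAlg.star_mem (ha i)) (hb i)

/-- The coordinates of a vector, when they are quaternions; in general their first quaternionic
coordinates. -/
def toQuat (x : Fin d → Octonion) (i : Fin d) : ℍ[ℝ] := (x i).left

theorem ofQuat_toQuat {K : DivAlg} (hK : K ≠ .octonion) {x : Fin d → Octonion}
    (hx : ∀ i, x i ∈ K.carrier) : ofQuat (toQuat x) = x := by
  funext i
  ext1
  · rfl
  · exact ((DivAlg.mem_carrier_iff hK).1 (hx i)).1.symm

theorem normSq_eq_re_herm {K : DivAlg} (hK : K ≠ .octonion) {x : Fin d → Octonion}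
    (hx : ∀ i, x i ∈ K.carrier) :
    ((∑ i, (x i).normSq : ℝ) : ℍ[ℝ]) = herm (toQuat x) (toQuat x) := by
  rw [herm_self]
  congr 1
  refine Finset.sum_congr rfl fun i _ => ?_
  simp [Octonion.normSq_eq, ((DivAlg.mem_carrier_iff hK).1 (hx i)).1, toQuat]

/-- A unitary map of `𝕂^d` preserves the hyperbolic distance. -/
theorem isBallIsometry_of_herm {K : DivAlg} (hK : K ≠ .octonion)
    {T : (Fin d → ℍ[ℝ]) → Fin d → ℍ[ℝ]}
    (hT : ∀ a, (∀ i, a i ∈ K.toSubalgebra) → ∀ i, T a i ∈ K.toSubalgebra)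
    (hherm : ∀ a b, herm (T a) (T b) = herm a b) :
    IsBallIsometry K fun x : Fin d → Octonion => ofQuat (T (toQuat x)) := by
  have hmem : ∀ x : Fin d → Octonion, (∀ i, x i ∈ K.carrier) →
      ∀ i, ofQuat (T (toQuat x)) i ∈ K.carrier := fun x hx i =>
    (DivAlg.mem_carrier_iff hK).2
      ⟨rfl, hT _ (fun j => ((DivAlg.mem_carrier_iff hK).1 (hx j)).2) i⟩
  refine ⟨hmem, fun x hx => ?_, fun x y hx hy => ?_⟩
  · have h1 := normSq_eq_re_herm hK (hmem x hx)
    have h2 : toQuat (ofQuat (T (toQuat x))) = T (toQuat x) := rfl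
    rw [h2, hherm, ← normSq_eq_re_herm hK hx] at h1
    exact Quaternion.coe_injective h1
  · rw [pairing_ofQuat, hherm, ← pairing_ofQuat, ofQuat_toQuat hK hx, ofQuat_toQuat hK hy]

/-- A continuous family of unitary maps which moves `o` injectively. -/
theorem exists_plane_of_herm {K : DivAlg} (hK : K ≠ .octonion) (o : HypBoundary K d)
    {T T' : ℝ × ℝ → (Fin d → ℍ[ℝ]) → Fin d → ℍ[ℝ]}
    (hT : ∀ s a, (∀ i, a i ∈ K.toSubalgebra) → ∀ i, T s a i ∈ K.toSubalgebra)
    (hT' : ∀ s a, (∀ i, a i ∈ K.toSubalgebra) → ∀ i, T' s a i ∈ K.toSubalgebra)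
    (hherm : ∀ s a b, herm (T s a) (T s b) = herm a b)
    (hl : ∀ s a, T' s (T s a) = a) (hr : ∀ s a, T s (T' s a) = a)
    (hc : Continuous (Function.uncurry T)) (ho : Function.Injective fun s => T s (toQuat o.1)) :
    ∃ c : ℝ × ℝ → HypIso K d, Continuous c ∧
      ∀ s t, (c s)⁻¹ * c t ∈ HypIso.boundaryStabilizer o → s = t := by
  have htq : ∀ a : Fin d → ℍ[ℝ], toQuat (ofQuat a) = a := fun _ => rfl
  refine exists_plane_of_isBallIsometry o (L := fun s x => ofQuat (T s (toQuat x)))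
    (L' := fun s x => ofQuat (T' s (toQuat x)))
    (fun s => isBallIsometry_of_herm hK (hT s) (hherm s))
    (fun s => isBallIsometry_of_herm hK (hT' s) fun a b => by rw [← hherm s, hr, hr])
    (fun s x hx => ?_) (fun s x hx => ?_) ?_ fun s t hst => ho ?_
  · rw [htq, hl, ofQuat_toQuat hK hx]
  · rw [htq, hr, ofQuat_toQuat hK hx]
  · have h1 : Continuous fun a : (ℝ × ℝ) × (Fin d → Octonion) => T a.1 (toQuat a.2) :=
      hc.comp (continuous_fst.prodMk (continuous_pi fun i =>
        Octonion.continuous_left.comp ((continuous_apply i).comp continuous_snd)))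
    exact continuous_pi fun i =>
      Octonion.continuous_mk ((continuous_apply i).comp h1) continuous_const
  · exact congrArg toQuat hst

end AssociativeModel

section Planes

variable {d : ℕ}

/-- Left multiplication by unit quaternions is unitary for the right Hermitian product. -/
theorem exists_plane_quaternion (o : HypBoundary .quaternion d) :
    ∃ c : ℝ × ℝ → HypIso .quaternion d, Continuous c ∧
      ∀ s t, (c s)⁻¹ * c t ∈ HypIso.boundaryStabilizer o → s = t := by
  have hu := star_mul_unitQuaternion
  have hu' := unitQuaternion_mul_star
  refine exists_plane_of_herm (by simp) o (T := fun s a i => unitQuaternion s * a i)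
    (T' := fun s a i => star (unitQuaternion s) * a i) (fun _ _ _ _ => trivial)
    (fun _ _ _ _ => trivial) (fun s a b => Finset.sum_congr rfl fun i _ => ?_)
    (fun s a => funext fun i => ?_) (fun s a => funext fun i => ?_) ?_ fun s t hst => ?_
  · rw [star_mul, mul_assoc, ← mul_assoc (star (unitQuaternion s)), hu, one_mul]
  · rw [← mul_assoc, hu, one_mul]
  · rw [← mul_assoc, hu', one_mul]
  · refine continuous_pi fun i => ?_
    exact (continuous_unitQuaternion.comp continuous_fst).mul
      ((continuous_apply i).comp continuous_snd)
  · by_contra hne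
    have hq : unitQuaternion s ≠ unitQuaternion t := fun h => hne (injective_unitQuaternion h)
    have h0 : toQuat o.1 = 0 := funext fun i =>
      by_contra fun h => hq (mul_right_cancel₀ h (congrFun hst i))
    have h1 := normSq_eq_re_herm (by simp) o.2.1
    rw [h0, o.2.2] at h1
    simp [herm] at h1

/-- The Hermitian reflection of `ℍ^d` in the hyperplane orthogonal to `w`. -/
def hermReflection (w a : Fin d → ℍ[ℝ]) : Fin d → ℍ[ℝ] :=
  a - fun i => w i * ((2 / (herm w w).re) • herm w a)

theorem re_herm_self_pos {w : Fin d → ℍ[ℝ]} (hw : w ≠ 0) : 0 < (herm w w).re := by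
  obtain ⟨i, hi⟩ := Function.ne_iff.1 hw
  rw [herm_self, Quaternion.re_coe]
  exact Finset.sum_pos' (fun j _ => Quaternion.normSq_nonneg)
    ⟨i, Finset.mem_univ i, Quaternion.normSq_nonneg.lt_of_ne' (Quaternion.normSq_ne_zero.2 hi)⟩

theorem herm_self_eq_coe (w : Fin d → ℍ[ℝ]) : herm w w = ((herm w w).re : ℍ[ℝ]) := by
  rw [herm_self, Quaternion.re_coe]

theorem herm_hermReflection {w : Fin d → ℍ[ℝ]} (hw : w ≠ 0) (a : Fin d → ℍ[ℝ]) :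
    herm w (hermReflection w a) = -herm w a := by
  have h0 := (re_herm_self_pos hw).ne'
  rw [hermReflection, herm_sub, herm_mul, herm_self_eq_coe w, Quaternion.coe_mul_eq_smul, smul_smul,
    Quaternion.re_coe, mul_div_cancel₀ _ h0, two_smul]
  abel

theorem hermReflection_hermReflection {w : Fin d → ℍ[ℝ]} (hw : w ≠ 0) (a : Fin d → ℍ[ℝ]) :
    hermReflection w (hermReflection w a) = a := by
  rw [hermReflection, herm_hermReflection hw, hermReflection]
  funext i
  simp

theorem herm_hermReflection_hermReflection {w : Fin d → ℍ[ℝ]} (hw : w ≠ 0)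
    (a b : Fin d → ℍ[ℝ]) : herm (hermReflection w a) (hermReflection w b) = herm a b := by
  have h1 : herm (hermReflection w a) w = -herm a w := by
    rw [← star_herm, herm_hermReflection hw, star_neg, star_herm]
  have h2 : herm (hermReflection w a) (hermReflection w b) = herm (hermReflection w a) b -
      herm (hermReflection w a) w * ((2 / (herm w w).re) • herm w b) :=
    (herm_sub _ _ _).trans (congrArg _ (herm_mul _ _ _))
  have h3 : herm (hermReflection w a) b =
      herm a b - star ((2 / (herm w w).re) • herm w a) * herm w b :=
    (sub_herm _ _ _).trans (congrArg _ (mul_herm _ _ _))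
  rw [h2, h3, h1, Quaternion.star_smul, star_herm]
  simp

theorem hermReflection_mem {K : DivAlg} {w a : Fin d → ℍ[ℝ]} (hw : ∀ i, w i ∈ K.toSubalgebra)
    (ha : ∀ i, a i ∈ K.toSubalgebra) (i : Fin d) : hermReflection w a i ∈ K.toSubalgebra :=
  Subalgebra.sub_mem _ (ha i)
    (Subalgebra.mul_mem _ (hw i) (Subalgebra.smul_mem _ (DivAlg.herm_mem hw ha) _))

theorem continuous_herm {X : Type*} [TopologicalSpace X] {a b : X → Fin d → ℍ[ℝ]}
    (ha : Continuous a) (hb : Continuous b) : Continuous fun x => herm (a x) (b x) :=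
  continuous_finsetSum _ fun i _ =>
    (((continuous_apply i).comp ha).star).mul ((continuous_apply i).comp hb)

/-- The reflections in the hyperplanes orthogonal to the vectors of a plane in the affine space
`⟨o, w⟩ = 1` move `o` injectively: the reflection of `o` is `o - 2 w / |w|²`, from which `w` is
recovered by means of `⟨o, w⟩ = 1`. -/
theorem exists_plane_of_reflections {K : DivAlg} (hK : K ≠ .octonion) (o : HypBoundary K d)
    {w : ℝ × ℝ → Fin d → ℍ[ℝ]} (hw : ∀ s i, w s i ∈ K.toSubalgebra) (hwc : Continuous w)
    (hwi : Function.Injective w) (hwo : ∀ s, herm (toQuat o.1) (w s) = 1) :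
    ∃ c : ℝ × ℝ → HypIso K d, Continuous c ∧
      ∀ s t, (c s)⁻¹ * c t ∈ HypIso.boundaryStabilizer o → s = t := by
  have hw0 : ∀ s, w s ≠ 0 := fun s h => by
    have := hwo s
    simp [h, herm] at this
  refine exists_plane_of_herm hK o (T := fun s => hermReflection (w s))
    (T' := fun s => hermReflection (w s)) (fun s a ha => hermReflection_mem (hw s) ha)
    (fun s a ha => hermReflection_mem (hw s) ha)
    (fun s => herm_hermReflection_hermReflection (hw0 s))
    (fun s => hermReflection_hermReflection (hw0 s))
    (fun s => hermReflection_hermReflection (hw0 s)) ?_ fun s t hst => hwi ?_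
  · have h1 : Continuous fun x : (ℝ × ℝ) × (Fin d → ℍ[ℝ]) => w x.1 := hwc.comp continuous_fst
    have h2 : Continuous fun x : (ℝ × ℝ) × (Fin d → ℍ[ℝ]) =>
        (2 / (herm (w x.1) (w x.1)).re) • herm (w x.1) x.2 :=
      (continuous_const.div (Quaternion.continuous_re.comp (continuous_herm h1 h1))
        fun x => (re_herm_self_pos (hw0 x.1)).ne').smul (continuous_herm h1 continuous_snd)
    exact continuous_snd.sub (continuous_pi fun i => ((continuous_apply i).comp h1).mul h2)
  · have hwo' : ∀ s, herm (w s) (toQuat o.1) = 1 := fun s => by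
      rw [← star_herm, hwo, star_one]
    have h1 : ∀ i, (2 / (herm (w s) (w s)).re) • w s i = (2 / (herm (w t) (w t)).re) • w t i := by
      intro i
      have h2 := sub_right_injective (congrFun hst i)
      simpa [hwo'] using h2
    have h3 : ∀ s, herm (toQuat o.1) (fun i => (2 / (herm (w s) (w s)).re) • w s i) =
        (((2 / (herm (w s) (w s)).re : ℝ)) : ℍ[ℝ]) := fun s => by
      have h4 := herm_mul (toQuat o.1) (w s) (((2 / (herm (w s) (w s)).re : ℝ)) : ℍ[ℝ])
      simp only [Quaternion.mul_coe_eq_smul] at h4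
      rw [h4, hwo, ← Quaternion.mul_coe_eq_smul, one_mul]
    have h5 : (2 / (herm (w s) (w s)).re) = (2 / (herm (w t) (w t)).re) := by
      refine Quaternion.coe_injective ?_
      rw [← h3, ← h3, funext h1]
    funext i
    have h6 := h1 i
    rw [h5] at h6
    exact smul_right_injective _ (div_pos two_pos (re_herm_self_pos (hw0 t))).ne' h6

/-- A vector orthogonal to `a`, when the coordinates of `a` commute. -/
def orthoVector (a : Fin d → ℍ[ℝ]) (i j : Fin d) (c : ℍ[ℝ]) : Fin d → ℍ[ℝ] :=
  Pi.single j (star (a i) * c) - Pi.single i (star (a j) * c)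

theorem herm_single (a : Fin d → ℍ[ℝ]) (i : Fin d) (c : ℍ[ℝ]) :
    herm a (Pi.single i c) = star (a i) * c := by
  simp [herm, Pi.single_apply]

theorem herm_orthoVector {a : Fin d → ℍ[ℝ]} (ha : ∀ i, a i ∈ DivAlg.complex.toSubalgebra)
    (i j : Fin d) (c : ℍ[ℝ]) : herm a (orthoVector a i j c) = 0 := by
  have h : star (a i) * star (a j) = star (a j) * star (a i) := by
    obtain ⟨h1, h2⟩ := DivAlg.mem_complex.1 (ha i)
    obtain ⟨h3, h4⟩ := DivAlg.mem_complex.1 (ha j)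
    ext <;> simp [h1, h2, h3, h4] <;> ring
  rw [orthoVector, herm_sub, herm_single, herm_single, ← mul_assoc, ← mul_assoc, h, sub_self]

theorem orthoVector_mem {K : DivAlg} {a : Fin d → ℍ[ℝ]} (ha : ∀ i, a i ∈ K.toSubalgebra)
    (i j : Fin d) {c : ℍ[ℝ]} (hc : c ∈ K.toSubalgebra) (l : Fin d) :
    orthoVector a i j c l ∈ K.toSubalgebra := by
  have h : ∀ (i j l : Fin d), (Pi.single j (star (a i) * c) : Fin d → ℍ[ℝ]) l ∈ K.toSubalgebra := by
    intro i j l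
    rw [Pi.single_apply]
    split_ifs
    · exact Subalgebra.mul_mem _ (DivAlg.star_mem (ha i)) hc
    · exact Subalgebra.zero_mem _
  exact Subalgebra.sub_mem _ (h i j l) (h j i l)

theorem continuous_orthoVector (a : Fin d → ℍ[ℝ]) (i j : Fin d) :
    Continuous (orthoVector a i j) := by
  have h : ∀ i j : Fin d,
      Continuous fun c : ℍ[ℝ] => (Pi.single j (star (a i) * c) : Fin d → ℍ[ℝ]) := fun i j =>
    (continuous_single (A := fun _ => ℍ[ℝ]) j).comp (continuous_const_mul (star (a i)))
  exact (h i j).sub (h j i)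

theorem orthoVector_apply_right (a : Fin d → ℍ[ℝ]) {i j : Fin d} (h : j ≠ i) (c : ℍ[ℝ]) :
    orthoVector a i j c j = star (a i) * c := by
  simp [orthoVector, h]

theorem orthoVector_apply_of_ne (a : Fin d → ℍ[ℝ]) {i j l : Fin d} (hi : l ≠ i) (hj : l ≠ j)
    (c : ℍ[ℝ]) : orthoVector a i j c l = 0 := by
  simp [orthoVector, hi, hj]

theorem HypBoundary.herm_self {K : DivAlg} (hK : K ≠ .octonion) (o : HypBoundary K d) :
    herm (toQuat o.1) (toQuat o.1) = 1 := by
  rw [← normSq_eq_re_herm hK o.2.1, o.2.2, Quaternion.coe_one]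

theorem HypBoundary.exists_ne_zero {K : DivAlg} (hK : K ≠ .octonion) (o : HypBoundary K d) :
    ∃ i, toQuat o.1 i ≠ 0 := by
  by_contra! h
  have := o.herm_self hK
  simp [herm, h] at this

theorem exists_plane_complex (hd : 2 ≤ d) (o : HypBoundary .complex d) :
    ∃ c : ℝ × ℝ → HypIso .complex d, Continuous c ∧
      ∀ s t, (c s)⁻¹ * c t ∈ HypIso.boundaryStabilizer o → s = t := by
  have hK : DivAlg.complex ≠ .octonion := by simp
  obtain ⟨i, hi⟩ := o.exists_ne_zero hK
  have : Nontrivial (Fin d) := Fin.nontrivial_iff_two_le.2 hd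
  obtain ⟨j, hj⟩ := exists_ne i
  set a := toQuat o.1 with hadef
  have ha : ∀ i, a i ∈ DivAlg.complex.toSubalgebra := fun i =>
    ((DivAlg.mem_carrier_iff hK).1 (o.2.1 i)).2
  refine exists_plane_of_reflections hK o
    (w := fun s => a + orthoVector a i j (s.1 + s.2 • quatI)) (fun s l => ?_) ?_ (fun s t h => ?_)
    fun s => ?_
  · refine Subalgebra.add_mem _ (ha l) (orthoVector_mem ha i j ?_ l)
    exact DivAlg.mem_complex.2 (by simp)
  · exact continuous_const.add ((continuous_orthoVector a i j).comp
      ((Quaternion.continuous_coe.comp continuous_fst).add (by fun_prop)))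
  · have h1 := congrFun h j
    simp only [Pi.add_apply, orthoVector_apply_right a hj] at h1
    have h2 := mul_left_cancel₀ (star_ne_zero.2 hi) (add_left_cancel h1)
    have h3 := congrArg (fun q : ℍ[ℝ] => q.re) h2
    have h4 := congrArg (fun q : ℍ[ℝ] => q.imI) h2
    simp at h3 h4
    exact Prod.ext h3 h4
  · rw [herm_add, herm_orthoVector ha, o.herm_self hK, add_zero]

theorem exists_plane_real (hd : 3 ≤ d) (o : HypBoundary .real d) :
    ∃ c : ℝ × ℝ → HypIso .real d, Continuous c ∧
      ∀ s t, (c s)⁻¹ * c t ∈ HypIso.boundaryStabilizer o → s = t := by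
  have hK : DivAlg.real ≠ .octonion := by simp
  obtain ⟨i, hi⟩ := o.exists_ne_zero hK
  obtain ⟨j, hj, k, hk, hjk⟩ : ∃ j ∈ Finset.univ.erase i, ∃ k ∈ Finset.univ.erase i, j ≠ k := by
    refine Finset.one_lt_card.1 ?_
    rw [Finset.card_erase_of_mem (Finset.mem_univ i), Finset.card_univ, Fintype.card_fin]
    omega
  replace hj := Finset.ne_of_mem_erase hj
  replace hk := Finset.ne_of_mem_erase hk
  set a := toQuat o.1 with hadef
  have ha : ∀ i, a i ∈ DivAlg.real.toSubalgebra := fun i =>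
    ((DivAlg.mem_carrier_iff hK).1 (o.2.1 i)).2
  have ha' : ∀ i, a i ∈ DivAlg.complex.toSubalgebra := fun i => (DivAlg.mem_real.1 (ha i)).2
  refine exists_plane_of_reflections hK o
    (w := fun s => a + orthoVector a i j s.1 + orthoVector a i k s.2) (fun s l => ?_) ?_
    (fun s t h => ?_) fun s => ?_
  · exact Subalgebra.add_mem _ (Subalgebra.add_mem _ (ha l)
      (orthoVector_mem ha i j (Subalgebra.algebraMap_mem _ s.1) l))
      (orthoVector_mem ha i k (Subalgebra.algebraMap_mem _ s.2) l)
  · exact (continuous_const.add ((continuous_orthoVector a i j).comp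
      (Quaternion.continuous_coe.comp continuous_fst))).add
      ((continuous_orthoVector a i k).comp (Quaternion.continuous_coe.comp continuous_snd))
  · have h1 := congrFun h j
    have h2 := congrFun h k
    simp only [Pi.add_apply, orthoVector_apply_right a hj, orthoVector_apply_right a hk,
      orthoVector_apply_of_ne a hj hjk, orthoVector_apply_of_ne a hk hjk.symm, add_zero] at h1 h2
    exact Prod.ext
      (Quaternion.coe_injective (mul_left_cancel₀ (star_ne_zero.2 hi) (add_left_cancel h1)))
      (Quaternion.coe_injective (mul_left_cancel₀ (star_ne_zero.2 hi) (add_left_cancel h2)))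
  · rw [herm_add, herm_add, herm_orthoVector ha', herm_orthoVector ha', o.herm_self hK, add_zero,
      add_zero]

/-- For all admissible `𝕂` and `d`, the boundary of `H^d_𝕂` contains the image of a plane under a
continuous injective map which lifts to the isometry group. -/
theorem DivAlg.Admissible.exists_plane {K : DivAlg} (hK : K.Admissible d) (o : HypBoundary K d) :
    ∃ c : ℝ × ℝ → HypIso K d, Continuous c ∧
      ∀ s t, (c s)⁻¹ * c t ∈ HypIso.boundaryStabilizer o → s = t := by
  cases K
  · exact exists_plane_real hK o
  · exact exists_plane_complex hK o
  · exact exists_plane_quaternion o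
  · obtain rfl : d = 2 := hK
    exact exists_plane_octonion o

end Planes

end

theorem mainTheorem2
    -- the hyperbolic space `H^d_𝕂` and a point `o` of its boundary
    (K : DivAlg) (d : ℕ) (hKd : K.Admissible d) (o : HypBoundary K d)
    -- the Lie group structures of `G = Iso(H^d_𝕂)` and of the stabilizer `P` of `o`
    {E : Type*} [NormedAddCommGroup E] [NormedSpace ℝ E] [FiniteDimensional ℝ E]
    [ChartedSpace E (HypIso K d)] [LieGroup 𝓘(ℝ, E) ∞ (HypIso K d)]
    {F : Type*} [NormedAddCommGroup F] [NormedSpace ℝ F] [FiniteDimensional ℝ F]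
    [ChartedSpace F (HypIso.boundaryStabilizer o)]
    [LieGroup 𝓘(ℝ, F) ∞ (HypIso.boundaryStabilizer o)]
    [IsClosedLieSubgroup E F (HypIso.boundaryStabilizer o)]
    -- a connected manifold `M` with a Cartan geometry `(M, B, ω)` modelled on `∂H^d_𝕂 = G/P`
    {EM : Type*} [NormedAddCommGroup EM] [NormedSpace ℝ EM] [FiniteDimensional ℝ EM]
    {M : Type*} [TopologicalSpace M] [ChartedSpace EM M] [IsManifold 𝓘(ℝ, EM) ∞ M]
    [T2Space M] [ConnectedSpace M]
    {EB : Type*} [NormedAddCommGroup EB] [NormedSpace ℝ EB] [FiniteDimensional ℝ EB]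
    {B : Type*} [TopologicalSpace B] [ChartedSpace EB B] [IsManifold 𝓘(ℝ, EB) ∞ B]
    (C : CartanGeometry E F (HypIso.boundaryStabilizer o) EM M EB B)
    -- a discrete subgroup `Γ` of `P` acting freely and properly discontinuously on `Ω_o`
    (Γ : Subgroup (HypIso.boundaryStabilizer o)) [DiscreteTopology Γ]
    (hfree : ∀ (γ : Γ) (x : Omega (HypIso.boundaryStabilizer o)), γ • x = x → γ = 1)
    [ProperlyDiscontinuousSMul Γ (Omega (HypIso.boundaryStabilizer o))]
    -- a geometric embedding of `Γ \ Ω_o` into `M`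
    (σ : KleinBase Γ → M)
    (hσ : IsGeometricEmbedding (kleinGeometry (E := E) (F := F) Γ) C.toCartanData σ) :
    (GeometricallyIsomorphic C.toCartanData
        (modelGeometry E (HypIso.boundaryStabilizer o)) ∧
      Γ = ⊥ ∧ ∃ κ : M, Set.range σ = {κ}ᶜ) ∨
    IsGeometricIso (kleinGeometry (E := E) (F := F) Γ) C.toCartanData σ := by
  obtain ⟨c, hc, hinj⟩ := hKd.exists_plane o
  exact rigidity_of_plane C hσ hc hinj
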